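/- For $n\ge 0$ let $F(n)$ be the number of non-degenerate rectangles, of arbitrary orientation, whose four vertices are lattice points of $[0,n)\times[0,n)$. Put $$F_0(n)=\frac{n^2(n-1)^2}{4}+\frac{n(n-1)^2(n-2)}{12},\qquad \operatorname{mult}(x,y)=\begin{cases}2,&x=y\\4,&x>y,\end{cases}\qquad B=\lfloor n^{2/3}\rfloor ,$$ $$c_{u,v}(n)=\sum_{\substack{x\ge y\ge 1\\ xu+yv\le n}}\operatorname{mult}(x,y)(n-xu-yv)(n-xv-yu),\qquad C_j(u;X)=\sum_{\substack{1\le v\le X\\ \gcd(u,v)=1}}v^j ,$$ $$v_{\max}(u,x,y)=\min\Bigl(u-1,\Bigl\lfloor\frac{n-xu}{y}\Bigr\rfloor\Bigr),\qquad \mathcal H_{p,q}(N;m,a,b)=\sum_{t=0}^{N-1}t^p\Bigl\lfloor\frac{at+b}{m}\Bigr\rfloor^q .$$ **Theorem (cubic-root decomposition).** (a) For every $n\ge 0$, $$F(n)=F_0(n)+\sum_{\substack{0<v<u\le B\\ \gcd(u,v)=1}}c_{u,v}(n)+\sum_{B<u\le n}\ \sum_{\substack{1\le y\le x\le n/u\\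 v_{\max}\ge 1}}\operatorname{mult}(x,y)\bigl((n-xu)(n-yu)C_0-(x(n-xu)+y(n-yu))C_1+xy\,C_2\bigr),$$ where $C_j=C_j(u;v_{\max}(u,x,y))$. (b) Consider a random access machine with integer memory cells, indirect addressing, procedures, and unit-cost $+,-,\times,\lfloor\cdot/\cdot\rfloor$ and comparison, all integers that occur being bounded in absolute value by a fixed polynomial in the input numbers. There is one program for this machine with the following procedures. 1. *Six-moment kernel.* Given integers $N\ge 0$, $m\ge1$, $a,b\ge0$, it computes $\mathcal H_{p,q}(N;m,a,b)$ for all $(p,q)\in\{(0,1),(1,1),(2,1),(0,2),(1,2),(0,3)\}$ in $O(1+\log m)$ steps. 2. *One direction.* Given $n\ge2$ and coprime $u\ge v\ge1$, it computes $c_{u,v}(n)$ in $O(\log n)$ steps, by $O(1)$ queries to the six-moment kernel and $O(1)$ further steps; it calls no other procedure. 3. *Coprime prefix sums.* In each of its calls by procedure 4, with arguments $(u,X)$, it returns $C_0(u;X),C_1(u;X),C_2(u;X)$ in $O(\tau(u))$ steps, where $\tau(u)$ is the number of divisors of $u$. 4. *Main procedure.* Given $n\ge0$ (and otherwise zero memory)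 it halts with the exact value $F(n)$, and for $n\ge 2$ it uses $O(n^{4/3}\log n)$ steps, the time spent in all called procedures included. It calls procedure 2 exactly once, with arguments $(n,u,v)$, for each coprime pair $u>v>0$ with $u\le n^{2/3}$, each call returning $c_{u,v}(n)$ in $O(\log n)$ steps, and for no other arguments. It calls procedure 3 exactly once, with arguments $(u,v_{\max}(u,x,y))$, for each triple $(u,x,y)$ with $n^{2/3}<u\le n$, $1\le y\le x\le n/u$ and $v_{\max}(u,x,y)\ge1$, and otherwise never. All implied constants are absolute. -/

import Mathlib

/-! ## Lattice rectangles -/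

/-- `R` is the vertex set of a nondegenerate rectangle with vertices in `ℤ²`:
`p, p + a, p + b, p + a + b` with nonzero orthogonal side vectors `a`, `b`. -/
def IsLatticeRectangle (R : Finset (ℤ × ℤ)) : Prop :=
  ∃ p a b : ℤ × ℤ, a ≠ 0 ∧ b ≠ 0 ∧ a.1 * b.1 + a.2 * b.2 = 0 ∧
    R = {p, p + a, p + b, p + a + b}

/-- The number of lattice rectangles, of any orientation, in the square `[0,n) × [0,n)`. -/
noncomputable def rectangleCount (n : ℕ) : ℕ :=
  {R : Finset (ℤ × ℤ) | IsLatticeRectangle R ∧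
    ∀ z ∈ R, 0 ≤ z.1 ∧ z.1 < (n : ℤ) ∧ 0 ≤ z.2 ∧ z.2 < (n : ℤ)}.ncard

/-! ## The quantities of the decomposition -/

/-- The contribution of the axis-parallel directions and of the direction `(1,1)`. -/
def boundaryCount (n : ℕ) : ℚ :=
  (n : ℚ) ^ 2 * ((n : ℚ) - 1) ^ 2 / 4 + (n : ℚ) * ((n : ℚ) - 1) ^ 2 * ((n : ℚ) - 2) / 12

/-- The multiplicity of a pair of side lengths `x ≥ y`. -/
def sideMult (x y : ℕ) : ℤ := if x = y then 2 else 4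

/-- The contribution `c_{u,v}(n)` of one direction `(u,v)`. For `u, v ≥ 1` the condition
`x * u + y * v ≤ n` already forces `x, y ≤ n`. -/
def directionContribution (n u v : ℕ) : ℤ :=
  ∑ p ∈ (Finset.Icc 1 n ×ˢ Finset.Icc 1 n).filter
      (fun p => p.2 ≤ p.1 ∧ p.1 * u + p.2 * v ≤ n),
    sideMult p.1 p.2 * ((n : ℤ) - p.1 * u - p.2 * v) * ((n : ℤ) - p.1 * v - p.2 * u)

/-- The six-moment kernel `H_{p,q}(N;m,a,b) = ∑_{t<N} t^p ⌊(a t + b)/m⌋^q`. -/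
def floorMoment (p q N m a b : ℕ) : ℕ :=
  ∑ t ∈ Finset.range N, t ^ p * ((a * t + b) / m) ^ q

/-- The coprime prefix sum `C_j(u;X)`. -/
def coprimePrefix (j u X : ℕ) : ℤ :=
  ∑ v ∈ (Finset.Icc 1 X).filter (fun v => Nat.gcd u v = 1), (v : ℤ) ^ j

/-- The threshold `⌊n^(2/3)⌋`. -/
noncomputable def threshold (n : ℕ) : ℕ := ⌊(n : ℝ) ^ (2 / 3 : ℝ)⌋₊

/-- The primitive directions `(u,v)`, `u > v > 0`, with `u ≤ n^(2/3)`. -/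
noncomputable def smallDirections (n : ℕ) : Finset (ℕ × ℕ) :=
  (Finset.Icc 1 (threshold n) ×ˢ Finset.Icc 1 (threshold n)).filter
    (fun d => d.2 < d.1 ∧ Nat.gcd d.1 d.2 = 1)

/-- The largest `v < u` with `x * u + y * v ≤ n` (for `x * u ≤ n` and `y ≥ 1`). -/
def vMax (n u x y : ℕ) : ℕ := min (u - 1) ((n - x * u) / y)

/-- The index triples `(u,x,y)` of the dual parametrization of the directions with
`u > n^(2/3)`: `1 ≤ y ≤ x ≤ ⌊n/u⌋`, restricted to those with a nonempty range of `v`. -/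
noncomputable def dualTriples (n : ℕ) : Finset (ℕ × ℕ × ℕ) :=
  (Finset.Ioc (threshold n) n ×ˢ Finset.Icc 1 n ×ˢ Finset.Icc 1 n).filter
    (fun s => s.2.2 ≤ s.2.1 ∧ s.2.1 ≤ n / s.1 ∧ 1 ≤ vMax n s.1 s.2.1 s.2.2)

/-- The contribution of one triple `(u,x,y)`, expressed through `C_0, C_1, C_2`. -/
def dualTerm (n u x y : ℕ) : ℤ :=
  sideMult x y *
    (((n : ℤ) - x * u) * ((n : ℤ) - y * u) * coprimePrefix 0 u (vMax n u x y)
      - ((x : ℤ) * ((n : ℤ) - x * u) + (y : ℤ) * ((n : ℤ) - y * u)) *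
          coprimePrefix 1 u (vMax n u x y)
      + (x : ℤ) * (y : ℤ) * coprimePrefix 2 u (vMax n u x y))

/-! ## A random access machine with unit-cost arithmetic on words of bounded size -/

/-- Memory contents. Only cells with nonnegative address are accessible. -/
abbrev Memory : Type := ℤ → ℤ

/-- Integer expressions; `read e` is the content of the cell whose address is the value
of `e` (indirect addressing). -/
inductive Expr : Type
  | lit (c : ℤ)
  | read (e : Expr)
  | add (e f : Expr)
  | sub (e f : Expr)
  | mul (e f : Expr)
  | div (e f : Expr)

namespace Expr

/-- The value of an expression. -/
def eval (σ : Memory) : Expr → ℤ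
  | lit c => c
  | read e => σ (e.eval σ)
  | add e f => e.eval σ + f.eval σ
  | sub e f => e.eval σ - f.eval σ
  | mul e f => e.eval σ * f.eval σ
  | div e f => e.eval σ / f.eval σ

/-- The cost of evaluation: one step for each literal, memory access and operation. -/
def cost : Expr → ℕ
  | lit _ => 1
  | read e => e.cost + 1
  | add e f => e.cost + f.cost + 1
  | sub e f => e.cost + f.cost + 1
  | mul e f => e.cost + f.cost + 1
  | div e f => e.cost + f.cost + 1

/-- The evaluation is legal for words in `[-w, w]`: every intermediate value fits into a
word, addresses are nonnegative and divisors are positive (so that division rounds down). -/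
def Legal (w : ℕ) (σ : Memory) : Expr → Prop
  | lit c => |c| ≤ (w : ℤ)
  | read e => e.Legal w σ ∧ 0 ≤ e.eval σ ∧ |σ (e.eval σ)| ≤ (w : ℤ)
  | add e f => e.Legal w σ ∧ f.Legal w σ ∧ |e.eval σ + f.eval σ| ≤ (w : ℤ)
  | sub e f => e.Legal w σ ∧ f.Legal w σ ∧ |e.eval σ - f.eval σ| ≤ (w : ℤ)
  | mul e f => e.Legal w σ ∧ f.Legal w σ ∧ |e.eval σ * f.eval σ| ≤ (w : ℤ)
  | div e f => e.Legal w σ ∧ f.Legal w σ ∧ 0 < f.eval σ ∧ |e.eval σ / f.eval σ| ≤ (w : ℤ)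

end Expr

/-- Statements. `assign e f` stores the value of `f` in the cell with address `e`; the tests
of `ite e f` and `loop e f` (a while loop) are `e ≤ f`; `call p` runs the procedure number
`p`. All memory is global. -/
inductive Stmt : Type
  | skip
  | assign (e f : Expr)
  | seq (s s' : Stmt)
  | ite (e f : Expr) (s s' : Stmt)
  | loop (e f : Expr) (s : Stmt)
  | call (p : ℕ)

/-- A program is a finite list of procedures. -/
abbrev Program : Type := List Stmt

/-- The record of one procedure call: the procedure, the memory on entry, the number of
steps spent in the call, the memory on exit. -/
structure CallRecord : Type where
  proc : ℕ
  entry : Memory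
  cost : ℕ
  exit : Memory

/-- `Exec Γ w s σ t L τ`: in the program `Γ`, on a machine with words in `[-w, w]`, the
statement `s` started with memory `σ` halts after `t` steps with memory `τ`, and `L` is the
list of the procedure calls that `s` itself makes (calls nested inside these are counted in
the cost but not listed). An execution that leaves the word range is not an execution. -/
inductive Exec (Γ : Program) (w : ℕ) :
    Stmt → Memory → ℕ → List CallRecord → Memory → Prop
  | skip (σ : Memory) : Exec Γ w Stmt.skip σ 1 [] σ
  | assign (e f : Expr) (σ : Memory) (he : e.Legal w σ) (hf : f.Legal w σ)
      (h0 : 0 ≤ e.eval σ) :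
      Exec Γ w (Stmt.assign e f) σ (e.cost + f.cost + 1) []
        (Function.update σ (e.eval σ) (f.eval σ))
  | seq {s s' : Stmt} {σ σ' σ'' : Memory} {t t' : ℕ} {L L' : List CallRecord}
      (h : Exec Γ w s σ t L σ') (h' : Exec Γ w s' σ' t' L' σ'') :
      Exec Γ w (Stmt.seq s s') σ (t + t' + 1) (L ++ L') σ''
  | ite_true {e f : Expr} {s s' : Stmt} {σ σ' : Memory} {t : ℕ} {L : List CallRecord}
      (he : e.Legal w σ) (hf : f.Legal w σ) (hc : e.eval σ ≤ f.eval σ)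
      (h : Exec Γ w s σ t L σ') :
      Exec Γ w (Stmt.ite e f s s') σ (e.cost + f.cost + 1 + t) L σ'
  | ite_false {e f : Expr} {s s' : Stmt} {σ σ' : Memory} {t : ℕ} {L : List CallRecord}
      (he : e.Legal w σ) (hf : f.Legal w σ) (hc : ¬ e.eval σ ≤ f.eval σ)
      (h : Exec Γ w s' σ t L σ') :
      Exec Γ w (Stmt.ite e f s s') σ (e.cost + f.cost + 1 + t) L σ'
  | loop_done {e f : Expr} {s : Stmt} {σ : Memory}
      (he : e.Legal w σ) (hf : f.Legal w σ) (hc : ¬ e.eval σ ≤ f.eval σ) :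
      Exec Γ w (Stmt.loop e f s) σ (e.cost + f.cost + 1) [] σ
  | loop_step {e f : Expr} {s : Stmt} {σ σ' σ'' : Memory} {t t' : ℕ}
      {L L' : List CallRecord}
      (he : e.Legal w σ) (hf : f.Legal w σ) (hc : e.eval σ ≤ f.eval σ)
      (h : Exec Γ w s σ t L σ') (h' : Exec Γ w (Stmt.loop e f s) σ' t' L' σ'') :
      Exec Γ w (Stmt.loop e f s) σ (e.cost + f.cost + 1 + t + t') (L ++ L') σ''
  | call {p : ℕ} {s : Stmt} {σ σ' : Memory} {t : ℕ} {L : List CallRecord}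
      (hp : Γ[p]? = some s) (h : Exec Γ w s σ t L σ') :
      Exec Γ w (Stmt.call p) σ (t + 1) [⟨p, σ, t + 1, σ'⟩] σ'

/-- Execution of the body of procedure number `p`. -/
def RunsProc (Γ : Program) (w p : ℕ) (σ : Memory) (t : ℕ) (L : List CallRecord)
    (τ : Memory) : Prop :=
  ∃ s : Stmt, Γ[p]? = some s ∧ Exec Γ w s σ t L τ

/-! ## Numbering and input/output conventions of the four distinguished procedures

Arguments and results are passed in the cells `0, 1, 2, …`. -/

/-- Evaluates the six moments. -/
abbrev kernelProc : ℕ := 0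
/-- Evaluates the contribution of one direction. -/
abbrev directionProc : ℕ := 1
/-- Evaluates the three coprime prefix sums. -/
abbrev prefixProc : ℕ := 2
/-- Evaluates the rectangle count. -/
abbrev mainProc : ℕ := 3

/-- The arguments `N, m, a, b` of a six-moment query are in the cells `0, 1, 2, 3`. -/
def KernelInput (σ : Memory) (N m a b : ℕ) : Prop :=
  σ 0 = N ∧ σ 1 = m ∧ σ 2 = a ∧ σ 3 = b

/-- The six moments are in the cells `0, …, 5`. -/
def KernelOutput (τ : Memory) (N m a b : ℕ) : Prop :=
  τ 0 = floorMoment 0 1 N m a b ∧ τ 1 = floorMoment 1 1 N m a b ∧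
  τ 2 = floorMoment 2 1 N m a b ∧ τ 3 = floorMoment 0 2 N m a b ∧
  τ 4 = floorMoment 1 2 N m a b ∧ τ 5 = floorMoment 0 3 N m a b

/-- The call is a correctly answered query to the six-moment kernel. -/
def CallRecord.IsKernelQuery (r : CallRecord) : Prop :=
  r.proc = kernelProc ∧
    ∃ N m a b : ℕ, 1 ≤ m ∧ KernelInput r.entry N m a b ∧ KernelOutput r.exit N m a b

/-- The initial memory of the main procedure: `n` in cell `0`, zero elsewhere. -/
def initialMemory (n : ℕ) : Memory := Function.update (fun _ => 0) 0 (n : ℤ)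

/-- The arguments, read off from the memory on entry, of the calls of the direction
procedure in a list of calls. -/
def directionCalls (L : List CallRecord) : Multiset (ℤ × ℤ × ℤ) :=
  ((L.filter (fun r => r.proc = directionProc)).map
    (fun r => (r.entry 0, r.entry 1, r.entry 2)) : List (ℤ × ℤ × ℤ))

/-- The arguments of the calls of the prefix-sum procedure in a list of calls. -/
def prefixCalls (L : List CallRecord) : Multiset (ℤ × ℤ) :=
  ((L.filter (fun r => r.proc = prefixProc)).map
    (fun r => (r.entry 0, r.entry 1)) : List (ℤ × ℤ))

/-! Geometry. Reversing and interchanging sides brings every rectangle into a unique form: the first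
side `a` satisfies `a₁ > 0, a₂ ≥ 0`, the second side `b` satisfies `b₁ ≤ 0 < b₂`
(`IsLatticeRectangle.exists_oriented`, `boxedRectangle_injective`). Write `a = x(u,v)` with `(u,v)`
primitive; orthogonality forces `b = y(-v,u)`. The bounding box has sides `xu+yv` and `xv+yu`, so
the shape has `(n-xu-yv)(n-xv-yu)` positions (`rectangleCount_eq_sum`). The directions `(1,0)` and
`(1,1)` give the boundary term. Any other direction is paired with its mirror image `(v,u)`, and the
symmetry in `x, y` accounts for the multiplicities (`rectangleCount_eq_primitiveSum`,
`two_mul_directionWeight`). For `u` above the threshold the sum over `v` is moved inside: the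
summand is a quadratic polynomial in `v`, so the coprime power sums of order 0, 1, 2 suffice
(`sum_dualTriples`).

Kernel. The sums of `t^p ⌊(at+b)/m⌋^q` with `q ≥ 1` and `p+q ≤ 3` are closed, up to ordinary power
sums, under two operations: reducing `a` and `b` modulo `m` (`floorMoment_reduce`), and counting the
lattice points under the line by rows instead of columns, which exchanges `m` and `a`
(`floorMoment_swap`). Together these are a step of the Euclidean algorithm, and `m * (a % m)` at
least halves from one level to the next, so there are `O(1 + log m)` levels. For a fixed direction
and fixed `y`, the sum over `x` is a cubic polynomial in `⌊(n-yv)/u⌋`; hence the sum over `y` is a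
combination of the six moments from a single query (`six_mul_directionContribution`).

Prefix sums. Möbius inversion over the divisors of `u` gives each coprime power sum with `O(1)` work
per divisor (`coprimePrefix_eq_sum_divisors`), once a sieve has listed the divisors and Möbius
values of all numbers up to `n`.

Cost. Let `B` be the threshold. The small directions cost `O(B² log n)`, the sieve `O(n log n)`, and
the large directions `∑_{u>B} (n/u)² τ(u) = O(n² log n / B)` (`dualWork_le`). The choice `B ≈
n^(2/3)` balances the first and the last of these at `n^(4/3) log n` (`mainCost_le`).

Machine. `Runs` is a total correctness statement whose postcondition also sees the cost and the list
of calls. Overflow is handled by degrees: if all cells that are read have size at most `Z`, an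
expression of degree at most 200 never exceeds `Z ^ 200`, so it suffices to bound the contents of
cells by a power of the input. -/

/-! ## Reasoning about machine programs -/

namespace Expr

instance : Add Expr := ⟨Expr.add⟩
instance : Sub Expr := ⟨Expr.sub⟩
instance : Mul Expr := ⟨Expr.mul⟩
instance : Div Expr := ⟨Expr.div⟩
instance (k : ℕ) : OfNat Expr k := ⟨Expr.lit k⟩

/-- The content of the cell with the fixed address `i`. -/
def cell (i : ℤ) : Expr := Expr.read (Expr.lit i)

variable (σ : Memory) (e f : Expr)

@[simp] theorem eval_lit (c : ℤ) : (Expr.lit c).eval σ = c := rfl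
@[simp] theorem eval_ofNat (k : ℕ) [k.AtLeastTwo] :
    (ofNat(k) : Expr).eval σ = (ofNat(k) : ℤ) := rfl
@[simp] theorem eval_zero : (0 : Expr).eval σ = 0 := rfl
@[simp] theorem eval_one : (1 : Expr).eval σ = 1 := rfl
@[simp] theorem eval_cell (i : ℤ) : (cell i).eval σ = σ i := rfl
@[simp] theorem eval_read : (Expr.read e).eval σ = σ (e.eval σ) := rfl
@[simp] theorem eval_add : (e + f).eval σ = e.eval σ + f.eval σ := rfl
@[simp] theorem eval_sub : (e - f).eval σ = e.eval σ - f.eval σ := rfl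
@[simp] theorem eval_mul : (e * f).eval σ = e.eval σ * f.eval σ := rfl
@[simp] theorem eval_div : (e / f).eval σ = e.eval σ / f.eval σ := rfl

/-- If all cells that are read have absolute value at most `Z`, where `Z ≥ 2`, then all
intermediate values have absolute value at most `Z ^ e.deg`. -/
def deg : Expr → ℕ
  | lit c => c.natAbs
  | read e => max e.deg 1
  | add e f => max e.deg f.deg + 1
  | sub e f => max e.deg f.deg + 1
  | mul e f => e.deg + f.deg
  | div e f => max e.deg f.deg

/-- All cells that are read have nonnegative address and content of size at most `Z`, and all
divisors are positive. -/
def Safe (Z : ℕ) (σ : Memory) : Expr → Prop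
  | lit _ => True
  | read e => e.Safe Z σ ∧ 0 ≤ e.eval σ ∧ |σ (e.eval σ)| ≤ (Z : ℤ)
  | add e f => e.Safe Z σ ∧ f.Safe Z σ
  | sub e f => e.Safe Z σ ∧ f.Safe Z σ
  | mul e f => e.Safe Z σ ∧ f.Safe Z σ
  | div e f => e.Safe Z σ ∧ f.Safe Z σ ∧ 0 < f.eval σ

section
variable (Z : ℕ)
@[simp] theorem safe_lit (c : ℤ) : (Expr.lit c).Safe Z σ ↔ True := Iff.rfl
@[simp] theorem safe_ofNat (k : ℕ) [k.AtLeastTwo] :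
    (ofNat(k) : Expr).Safe Z σ ↔ True := Iff.rfl
@[simp] theorem safe_zero : (0 : Expr).Safe Z σ ↔ True := Iff.rfl
@[simp] theorem safe_one : (1 : Expr).Safe Z σ ↔ True := Iff.rfl
@[simp] theorem safe_cell (i : ℤ) : (cell i).Safe Z σ ↔ 0 ≤ i ∧ |σ i| ≤ (Z : ℤ) := by
  simp [cell, Safe]
@[simp] theorem safe_read :
    (Expr.read e).Safe Z σ ↔ e.Safe Z σ ∧ 0 ≤ e.eval σ ∧ |σ (e.eval σ)| ≤ (Z : ℤ) := Iff.rfl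
@[simp] theorem safe_add : (e + f).Safe Z σ ↔ e.Safe Z σ ∧ f.Safe Z σ := Iff.rfl
@[simp] theorem safe_sub : (e - f).Safe Z σ ↔ e.Safe Z σ ∧ f.Safe Z σ := Iff.rfl
@[simp] theorem safe_mul : (e * f).Safe Z σ ↔ e.Safe Z σ ∧ f.Safe Z σ := Iff.rfl
@[simp] theorem safe_div :
    (e / f).Safe Z σ ↔ e.Safe Z σ ∧ f.Safe Z σ ∧ 0 < f.eval σ := Iff.rfl
end

variable {σ e}

theorem abs_ediv_le_abs (a b : ℤ) : |a / b| ≤ |a| := by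
  rw [Int.abs_eq_natAbs, Int.abs_eq_natAbs]
  exact_mod_cast Int.natAbs_ediv_le_natAbs a b

/-- A literal satisfies `|c| ≤ 2^|c| ≤ Z^|c|`; two terms of size `Z^d` add up to at most `2 Z^d ≤
Z^(d+1)`; degrees add under multiplication; floor division never increases the absolute value of the
dividend. -/
theorem abs_eval_le {Z : ℕ} (hZ : 2 ≤ Z) (h : e.Safe Z σ) :
    |e.eval σ| ≤ (Z : ℤ) ^ e.deg := by
  have hZ' : (2 : ℤ) ≤ Z := by exact_mod_cast hZ
  have hmono : ∀ {a b : ℕ}, a ≤ b → (Z : ℤ) ^ a ≤ (Z : ℤ) ^ b := fun hab =>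
    pow_le_pow_right₀ (by linarith) hab
  induction e with
  | lit c =>
    have h1 : c.natAbs ≤ Z ^ c.natAbs :=
      (Nat.lt_two_pow_self).le.trans (Nat.pow_le_pow_left hZ _)
    show |c| ≤ _
    rw [Int.abs_eq_natAbs]
    exact_mod_cast h1
  | read e ih =>
    refine h.2.2.trans ?_
    simpa [deg] using hmono (le_max_right e.deg 1)
  | add e f ihe ihf =>
    have h1 := (ihe h.1).trans (hmono (le_max_left e.deg f.deg))
    have h2 := (ihf h.2).trans (hmono (le_max_right e.deg f.deg))
    refine (abs_add_le _ _).trans ?_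
    rw [deg, pow_succ]
    nlinarith [abs_nonneg (e.eval σ)]
  | sub e f ihe ihf =>
    have h1 := (ihe h.1).trans (hmono (le_max_left e.deg f.deg))
    have h2 := (ihf h.2).trans (hmono (le_max_right e.deg f.deg))
    refine (abs_sub _ _).trans ?_
    rw [deg, pow_succ]
    nlinarith [abs_nonneg (e.eval σ)]
  | mul e f ihe ihf =>
    show |_ * _| ≤ _
    rw [abs_mul, deg, pow_add]
    exact mul_le_mul (ihe h.1) (ihf h.2) (abs_nonneg _) (by positivity)
  | div e f ihe ihf =>
    exact (abs_ediv_le_abs _ _).trans ((ihe h.1).trans (hmono (le_max_left _ _)))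

/-- The degree of a subexpression is at most that of the whole, so one inequality controls all
intermediate values. -/
theorem legal_of_safe {Z w : ℕ} (hZ : 2 ≤ Z) (h : e.Safe Z σ) (hw : Z ^ e.deg ≤ w) :
    e.Legal w σ := by
  have hmono : ∀ {a b : ℕ}, a ≤ b → Z ^ a ≤ Z ^ b := fun hab =>
    Nat.pow_le_pow_right (by omega) hab
  have key : |e.eval σ| ≤ (w : ℤ) := (abs_eval_le hZ h).trans (by exact_mod_cast hw)
  induction e with
  | lit c => exact key
  | read e ih =>
    have h1 : Z ^ e.deg ≤ w := (hmono (le_max_left e.deg 1)).trans hw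
    exact ⟨ih h.1 h1 ((abs_eval_le hZ h.1).trans (by exact_mod_cast h1)), h.2.1, key⟩
  | add e f ihe ihf =>
    have h1 : Z ^ e.deg ≤ w := (hmono ((le_max_left _ _).trans (Nat.le_succ _))).trans hw
    have h2 : Z ^ f.deg ≤ w := (hmono ((le_max_right _ _).trans (Nat.le_succ _))).trans hw
    exact ⟨ihe h.1 h1 ((abs_eval_le hZ h.1).trans (by exact_mod_cast h1)),
      ihf h.2 h2 ((abs_eval_le hZ h.2).trans (by exact_mod_cast h2)), key⟩
  | sub e f ihe ihf =>
    have h1 : Z ^ e.deg ≤ w := (hmono ((le_max_left _ _).trans (Nat.le_succ _))).trans hw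
    have h2 : Z ^ f.deg ≤ w := (hmono ((le_max_right _ _).trans (Nat.le_succ _))).trans hw
    exact ⟨ihe h.1 h1 ((abs_eval_le hZ h.1).trans (by exact_mod_cast h1)),
      ihf h.2 h2 ((abs_eval_le hZ h.2).trans (by exact_mod_cast h2)), key⟩
  | mul e f ihe ihf =>
    have h1 : Z ^ e.deg ≤ w := (hmono (Nat.le_add_right _ _)).trans hw
    have h2 : Z ^ f.deg ≤ w := (hmono (Nat.le_add_left _ _)).trans hw
    exact ⟨ihe h.1 h1 ((abs_eval_le hZ h.1).trans (by exact_mod_cast h1)),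
      ihf h.2 h2 ((abs_eval_le hZ h.2).trans (by exact_mod_cast h2)), key⟩
  | div e f ihe ihf =>
    have h1 : Z ^ e.deg ≤ w := (hmono (le_max_left _ _)).trans hw
    have h2 : Z ^ f.deg ≤ w := (hmono (le_max_right _ _)).trans hw
    exact ⟨ihe h.1 h1 ((abs_eval_le hZ h.1).trans (by exact_mod_cast h1)),
      ihf h.2.1 h2 ((abs_eval_le hZ h.2.1).trans (by exact_mod_cast h2)), h.2.2, key⟩

/-- The expression reads only cells with fixed addresses from the list `l` and divides only by
positive literals. -/
def simpleOn (l : List ℤ) : Expr → Bool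
  | lit _ => true
  | read (lit i) => decide (0 ≤ i) && l.contains i
  | read _ => false
  | add e f => e.simpleOn l && f.simpleOn l
  | sub e f => e.simpleOn l && f.simpleOn l
  | mul e f => e.simpleOn l && f.simpleOn l
  | div e (lit c) => e.simpleOn l && decide (0 < c)
  | div _ _ => false

/-- For the long closed formulas, safety reduces to a syntactic check by `decide` and finitely many
bounds on cells. -/
theorem safe_of_simpleOn {Z : ℕ} {l : List ℤ} (hl : ∀ i ∈ l, |σ i| ≤ (Z : ℤ))
    (h : e.simpleOn l = true) : e.Safe Z σ := by
  induction e with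
  | lit c => trivial
  | read e ih =>
    cases e with
    | lit i =>
      simp only [simpleOn, Bool.and_eq_true, decide_eq_true_eq, List.contains_iff_mem] at h
      exact ⟨trivial, h.1, hl _ h.2⟩
    | _ => simp [simpleOn] at h
  | add e f ihe ihf =>
    simp only [simpleOn, Bool.and_eq_true] at h
    exact ⟨ihe h.1, ihf h.2⟩
  | sub e f ihe ihf =>
    simp only [simpleOn, Bool.and_eq_true] at h
    exact ⟨ihe h.1, ihf h.2⟩
  | mul e f ihe ihf =>
    simp only [simpleOn, Bool.and_eq_true] at h
    exact ⟨ihe h.1, ihf h.2⟩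
  | div e f ihe ihf =>
    cases f with
    | lit c =>
      simp only [simpleOn, Bool.and_eq_true, decide_eq_true_eq] at h
      exact ⟨ihe h.1, trivial, h.2⟩
    | _ => simp [simpleOn] at h

end Expr

/-! ### Step counts of loop-free statements. -/

namespace Stmt

/-- Store the value of `f` in the cell with the fixed address `i`. -/
def set (i : ℤ) (f : Expr) : Stmt := Stmt.assign (Expr.lit i) f

/-- There is no loop in the statement. -/
def loopFree : Stmt → Bool
  | skip => true
  | assign _ _ => true
  | seq s s' => s.loopFree && s'.loopFree
  | ite _ _ s s' => s.loopFree && s'.loopFree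
  | loop _ _ _ => false
  | call _ => true

/-- The cost of a statement without loops does not exceed its size and the cost of its calls. -/
def size : Stmt → ℕ
  | skip => 1
  | assign e f => e.cost + f.cost + 1
  | seq s s' => s.size + s'.size + 1
  | ite e f s s' => e.cost + f.cost + 1 + (s.size + s'.size)
  | loop e f s => e.cost + f.cost + 1 + s.size
  | call _ => 0

end Stmt

infixr:60 " ;; " => Stmt.seq

/-- The total cost of the calls in a list. -/
def callCost (L : List CallRecord) : ℕ := (L.map CallRecord.cost).sum

@[simp] theorem callCost_nil : callCost [] = 0 := rfl
@[simp] theorem callCost_cons (r : CallRecord) (L : List CallRecord) :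
    callCost (r :: L) = r.cost + callCost L := by simp [callCost]
@[simp] theorem callCost_append (L L' : List CallRecord) :
    callCost (L ++ L') = callCost L + callCost L' := by simp [callCost]

/-- The size counts both branches of a conditional, hence dominates every execution path.
Correctness proofs of loop-free code therefore need not follow the step counter at all. -/
theorem Exec.cost_le {Γ : Program} {w : ℕ} {s : Stmt} {σ τ : Memory} {t : ℕ}
    {L : List CallRecord} (h : Exec Γ w s σ t L τ) (hs : s.loopFree = true) :
    t ≤ s.size + callCost L := by
  induction h with
  | skip σ => simp [Stmt.size]
  | assign e f σ he hf h0 => simp [Stmt.size]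
  | seq h h' ih ih' =>
    simp only [Stmt.loopFree, Bool.and_eq_true] at hs
    have := ih hs.1
    have := ih' hs.2
    simp only [Stmt.size, callCost_append]
    omega
  | ite_true he hf hc h ih =>
    simp only [Stmt.loopFree, Bool.and_eq_true] at hs
    have := ih hs.1
    simp only [Stmt.size]
    omega
  | ite_false he hf hc h ih =>
    simp only [Stmt.loopFree, Bool.and_eq_true] at hs
    have := ih hs.2
    simp only [Stmt.size]
    omega
  | loop_done => simp [Stmt.loopFree] at hs
  | loop_step => simp [Stmt.loopFree] at hs
  | call hp h ih => simp [Stmt.size]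

/-- The statement `s`, started with memory `σ`, halts, and cost, calls and final memory
satisfy `Q`. -/
def Runs (Γ : Program) (w : ℕ) (s : Stmt) (σ : Memory)
    (Q : ℕ → List CallRecord → Memory → Prop) : Prop :=
  ∃ t L τ, Exec Γ w s σ t L τ ∧ Q t L τ

/-- The words of the machine hold all values of expressions of degree at most `200` in cells
of size at most `Z`. -/
structure WordBound (w Z : ℕ) : Prop where
  two_le : 2 ≤ Z
  pow_le : Z ^ 200 ≤ w

theorem WordBound.legal {w Z : ℕ} (hW : WordBound w Z) {e : Expr} {σ : Memory}
    (h : e.Safe Z σ) (hd : e.deg ≤ 200) : e.Legal w σ :=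
  Expr.legal_of_safe hW.two_le h
    ((Nat.pow_le_pow_right (by have := hW.two_le; omega) hd).trans hW.pow_le)

/-! ### Proof rules for total correctness with cost. -/

namespace Runs

variable {Γ : Program} {w Z : ℕ} {s s' : Stmt} {σ : Memory} {e f : Expr}
  {Q Q' : ℕ → List CallRecord → Memory → Prop}

theorem mono (h : Runs Γ w s σ Q) (hQ : ∀ t L τ, Q t L τ → Q' t L τ) : Runs Γ w s σ Q' := by
  obtain ⟨t, L, τ, h, hq⟩ := h
  exact ⟨t, L, τ, h, hQ _ _ _ hq⟩

/-- Supplies the time bound afterwards to a correctness proof that ignored `t`. -/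
theorem with_cost (hs : s.loopFree = true) (h : Runs Γ w s σ Q) :
    Runs Γ w s σ (fun t L τ => t ≤ s.size + callCost L ∧ Q t L τ) := by
  obtain ⟨t, L, τ, h, hq⟩ := h
  exact ⟨t, L, τ, h, h.cost_le hs, hq⟩

theorem skip (h : Q 1 [] σ) : Runs Γ w Stmt.skip σ Q := ⟨_, _, _, Exec.skip σ, h⟩

/-- In weakest-precondition style: the postcondition of the first statement is that the second one
runs, so a program is verified by symbolic execution from left to right. -/
theorem seq (h : Runs Γ w s σ
      (fun t L σ' => Runs Γ w s' σ' (fun t' L' τ => Q (t + t' + 1) (L ++ L') τ))) :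
    Runs Γ w (s ;; s') σ Q := by
  obtain ⟨t, L, σ', h, t', L', τ, h', hq⟩ := h
  exact ⟨_, _, _, Exec.seq h h', hq⟩

/-- The address `x` and the value `v` are separate from the expressions, so that the new memory is
an update with mathematical values and not with unevaluated terms. -/
theorem assign (hW : WordBound w Z) (v x : ℤ) (he : e.eval σ = x) (hv : f.eval σ = v)
    (hx : 0 ≤ x) (hes : e.Safe Z σ) (hfs : f.Safe Z σ) (hd : max e.deg f.deg ≤ 200)
    (h : Q (e.cost + f.cost + 1) [] (Function.update σ x v)) :
    Runs Γ w (Stmt.assign e f) σ Q := by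
  subst he hv
  exact ⟨_, _, _, Exec.assign e f σ (hW.legal hes ((le_max_left _ _).trans hd))
    (hW.legal hfs ((le_max_right _ _).trans hd)) hx, h⟩

theorem set (hW : WordBound w Z) {i : ℤ} (v : ℤ) (hv : f.eval σ = v)
    (hfs : f.Safe Z σ) (hd : 0 ≤ i ∧ max i.natAbs f.deg ≤ 200)
    (h : Q (1 + f.cost + 1) [] (Function.update σ i v)) :
    Runs Γ w (Stmt.set i f) σ Q :=
  assign hW v i rfl hv hd.1 trivial hfs hd.2 h

theorem ite (hW : WordBound w Z) (hes : e.Safe Z σ) (hfs : f.Safe Z σ)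
    (hd : max e.deg f.deg ≤ 200)
    (h : e.eval σ ≤ f.eval σ → Runs Γ w s σ (fun t L τ => Q (e.cost + f.cost + 1 + t) L τ))
    (h' : f.eval σ < e.eval σ →
      Runs Γ w s' σ (fun t L τ => Q (e.cost + f.cost + 1 + t) L τ)) :
    Runs Γ w (Stmt.ite e f s s') σ Q := by
  have he := hW.legal hes ((le_max_left _ _).trans hd)
  have hf := hW.legal hfs ((le_max_right _ _).trans hd)
  by_cases hc : e.eval σ ≤ f.eval σ
  · obtain ⟨t, L, τ, hx, hq⟩ := h hc
    exact ⟨_, _, _, Exec.ite_true he hf hc hx, hq⟩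
  · obtain ⟨t, L, τ, hx, hq⟩ := h' (not_le.1 hc)
    exact ⟨_, _, _, Exec.ite_false he hf hc hx, hq⟩

theorem call {p : ℕ} (hp : Γ[p]? = some s)
    (h : Runs Γ w s σ (fun t _ τ => Q (t + 1) [⟨p, σ, t + 1, τ⟩] τ)) :
    Runs Γ w (Stmt.call p) σ Q := by
  obtain ⟨t, L, τ, hx, hq⟩ := h
  exact ⟨_, _, _, Exec.call hp hx, hq⟩

/-- A loop that makes exactly `K` iterations; `I k t L σ` is the invariant after `k`
iterations of total cost `t` with calls `L`. -/
theorem loop (hW : WordBound w Z) (hd : max e.deg f.deg ≤ 200) (K : ℕ)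
    (I : ℕ → ℕ → List CallRecord → Memory → Prop) (h0 : I 0 0 [] σ)
    (hsafe : ∀ k t L σ, k ≤ K → I k t L σ → e.Safe Z σ ∧ f.Safe Z σ ∧
      (e.eval σ ≤ f.eval σ ↔ k < K))
    (hstep : ∀ k t L σ, k < K → I k t L σ →
      Runs Γ w s σ (fun t' L' τ => I (k + 1) (t + (e.cost + f.cost + 1 + t')) (L ++ L') τ))
    (hend : ∀ t L σ, I K t L σ → Q (t + (e.cost + f.cost + 1)) L σ) :
    Runs Γ w (Stmt.loop e f s) σ Q := by
  -- Induction on the number `j` of iterations still to be made, with the state after `k` of them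
  -- arbitrary.
  have main : ∀ j k t L σ, k + j = K → I k t L σ →
      ∃ t' L' τ, Exec Γ w (Stmt.loop e f s) σ t' L' τ ∧ Q (t + t') (L ++ L') τ := by
    intro j
    induction j with
    | zero =>
      intro k t L σ hk hI
      obtain rfl : k = K := by omega
      obtain ⟨hes, hfs, hc⟩ := hsafe k t L σ le_rfl hI
      refine ⟨_, [], σ, Exec.loop_done (hW.legal hes ((le_max_left _ _).trans hd))
        (hW.legal hfs ((le_max_right _ _).trans hd)) (by rw [hc]; omega), ?_⟩
      simpa using hend t L σ hI
    | succ j ih =>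
      intro k t L σ hk hI
      obtain ⟨hes, hfs, hc⟩ := hsafe k t L σ (by omega) hI
      obtain ⟨t₁, L₁, σ₁, hx, hI₁⟩ := hstep k t L σ (by omega) hI
      obtain ⟨t₂, L₂, τ, hy, hq⟩ := ih (k + 1) _ _ σ₁ (by omega) hI₁
      refine ⟨_, _, τ, Exec.loop_step (hW.legal hes ((le_max_left _ _).trans hd))
        (hW.legal hfs ((le_max_right _ _).trans hd)) (by rw [hc]; omega) hx hy, ?_⟩
      have e1 : t + (e.cost + f.cost + 1 + t₁ + t₂) = t + (e.cost + f.cost + 1 + t₁) + t₂ := by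
        ring
      rw [e1, ← List.append_assoc]
      exact hq
  obtain ⟨t, L, τ, h, hq⟩ := main K 0 0 [] σ (by omega) h0
  exact ⟨t, L, τ, h, by simpa using hq⟩

end Runs

/-! ## Floor moments: Euclidean reduction -/

theorem two_mul_sum_range_id (N : ℕ) :
    2 * ∑ t ∈ Finset.range N, (t : ℤ) = N * ((N : ℤ) - 1) := by
  induction N with
  | zero => simp
  | succ N ih => rw [Finset.sum_range_succ, mul_add, ih]; push_cast; ring

theorem six_mul_sum_range_sq (N : ℕ) :
    6 * ∑ t ∈ Finset.range N, (t : ℤ) ^ 2 = N * ((N : ℤ) - 1) * (2 * N - 1) := by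
  induction N with
  | zero => simp
  | succ N ih => rw [Finset.sum_range_succ, mul_add, ih]; push_cast; ring

theorem four_mul_sum_range_cube (N : ℕ) :
    4 * ∑ t ∈ Finset.range N, (t : ℤ) ^ 3 = (N * ((N : ℤ) - 1)) ^ 2 := by
  induction N with
  | zero => simp
  | succ N ih => rw [Finset.sum_range_succ, mul_add, ih]; push_cast; ring

/-- Summation by layers, for `f` and `h` in Galois connection. -/
theorem sum_mul_sum_range_eq_of_galois {N M : ℕ} {f h : ℕ → ℕ} (hf : ∀ t < N, f t ≤ M)
    (hh : ∀ j < M, h j ≤ N) (hfh : ∀ t < N, ∀ j < M, (j < f t ↔ h j ≤ t)) (φ ψ : ℕ → ℤ) :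
    ∑ t ∈ Finset.range N, φ t * ∑ j ∈ Finset.range (f t), ψ j =
      ∑ j ∈ Finset.range M, ψ j *
        (∑ t ∈ Finset.range N, φ t - ∑ t ∈ Finset.range (h j), φ t) := by
  have h1 : ∀ t ∈ Finset.range N, φ t * ∑ j ∈ Finset.range (f t), ψ j =
      ∑ j ∈ Finset.range M, if h j ≤ t then φ t * ψ j else 0 := by
    intro t ht
    rw [Finset.mem_range] at ht
    rw [Finset.mul_sum, ← Finset.sum_filter]
    refine Finset.sum_congr ?_ fun _ _ => rfl
    ext j
    simp only [Finset.mem_range, Finset.mem_filter]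
    constructor
    · intro hj
      have := hf t ht
      exact ⟨by omega, (hfh t ht j (by omega)).1 hj⟩
    · rintro ⟨hj, hj'⟩
      exact (hfh t ht j hj).2 hj'
  rw [Finset.sum_congr rfl h1, Finset.sum_comm]
  refine Finset.sum_congr rfl fun j hj => ?_
  rw [Finset.mem_range] at hj
  have h2 : (Finset.range N).filter (fun t => h j ≤ t) = Finset.range N \ Finset.range (h j) := by
    ext t; simp
  have h3 := Finset.sum_sdiff (f := φ) (Finset.range_subset_range.2 (hh j hj))
  rw [← Finset.sum_filter, h2, ← h3, add_sub_cancel_right, Finset.mul_sum]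
  exact Finset.sum_congr rfl fun _ _ => mul_comm _ _

theorem floorMoment_cast (p q N m a b : ℕ) : (floorMoment p q N m a b : ℤ) =
    ∑ t ∈ Finset.range N, (t : ℤ) ^ p * (((a * t + b) / m : ℕ) : ℤ) ^ q := by
  simp only [floorMoment, Nat.cast_sum, Nat.cast_mul, Nat.cast_pow]

section Swap

variable {N m a b : ℕ}

/-- Exchange of the roles of `m` and `a`. -/
theorem sum_mul_sum_floor_eq (ha : 1 ≤ a) (hb : b < m) (φ ψ : ℕ → ℤ) :
    ∑ t ∈ Finset.range N, φ t * ∑ j ∈ Finset.range ((a * t + b) / m), ψ j =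
      ∑ j ∈ Finset.range ((a * N + b) / m), ψ j *
        (∑ t ∈ Finset.range N, φ t -
          ∑ t ∈ Finset.range ((m * j + (m - b + a - 1)) / a), φ t) := by
  have hm : 0 < m := by omega
  -- `j < ⌊(at+b)/m⌋` means `(j+1)m ≤ at+b`, that is `t ≥ ⌈(mj+m-b)/a⌉`. Writing this ceiling as a
  -- floor adds `a - 1` to the offset.
  have key : ∀ t j : ℕ, j < (a * t + b) / m ↔ (m * j + (m - b + a - 1)) / a ≤ t := by
    intro t j
    rw [← Nat.succ_le_iff, Nat.le_div_iff_mul_le hm, ← Nat.lt_succ_iff (n := t),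
      Nat.div_lt_iff_lt_mul ha]
    have e1 : j.succ * m = m * j + m := by rw [Nat.succ_mul, mul_comm]
    have e2 : t.succ * a = a * t + a := by rw [Nat.succ_mul, mul_comm]
    rw [e1, e2]
    omega
  refine sum_mul_sum_range_eq_of_galois (fun t ht => ?_) (fun j hj => (key N j).1 hj)
    (fun t _ j _ => key t j) φ ψ
  exact Nat.div_le_div_right (Nat.add_le_add_right (Nat.mul_le_mul_left a ht.le) b)

/-- The six moments for `a, b < m` in terms of the moments with `m` and `a` exchanged. -/
theorem floorMoment_swap (ha : a < m) (hb : b < m) {M : ℕ} (hM : M = (a * N + b) / m)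
    {K01 K11 K21 K02 K12 K03 : ℤ}
    (h01 : K01 = floorMoment 0 1 M a m (m - b + a - 1))
    (h11 : K11 = floorMoment 1 1 M a m (m - b + a - 1))
    (h21 : K21 = floorMoment 2 1 M a m (m - b + a - 1))
    (h02 : K02 = floorMoment 0 2 M a m (m - b + a - 1))
    (h12 : K12 = floorMoment 1 2 M a m (m - b + a - 1))
    (h03 : K03 = floorMoment 0 3 M a m (m - b + a - 1)) :
    (floorMoment 0 1 N m a b : ℤ) = M * N - K01 ∧
    2 * (floorMoment 1 1 N m a b : ℤ) = M * (N * (N - 1)) - K02 + K01 ∧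
    6 * (floorMoment 2 1 N m a b : ℤ) =
      M * (N * (N - 1) * (2 * N - 1)) - 2 * K03 + 3 * K02 - K01 ∧
    (floorMoment 0 2 N m a b : ℤ) = M * M * N - 2 * K11 - K01 ∧
    2 * (floorMoment 1 2 N m a b : ℤ) =
      M * M * (N * (N - 1)) - 2 * K12 - K02 + 2 * K11 + K01 ∧
    (floorMoment 0 3 N m a b : ℤ) = M * M * M * N - 3 * K21 - 3 * K11 - K01 := by
  have hm : 0 < m := by omega
  -- For `a = 0` the exchanged sums have modulus `0`, but then `M = 0`, so their ranges are empty
  -- and everything vanishes.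
  rcases Nat.eq_zero_or_pos a with rfl | ha'
  · have hM0 : M = 0 := by rw [hM]; simpa using Nat.div_eq_of_lt hb
    subst hM0
    have hz : ∀ p q, q ≠ 0 → (floorMoment p q N m 0 b : ℤ) = 0 := by
      intro p q hq
      rw [floorMoment_cast]
      refine Finset.sum_eq_zero fun t _ => ?_
      simp [Nat.div_eq_of_lt hb, hq]
    have hz' : ∀ p q b', (floorMoment p q 0 0 m b' : ℤ) = 0 := by
      intro p q b'
      simp [floorMoment]
    rw [hz'] at h01 h11 h21 h02 h12 h03
    subst h01 h11 h21 h02 h12 h03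
    simp [hz]
  · rw [floorMoment_cast] at h01 h11 h21 h02 h12 h03
    set h : ℕ → ℕ := fun j => (m * j + (m - b + a - 1)) / a with hh
    have sw := fun φ ψ => sum_mul_sum_floor_eq (N := N) ha' hb φ ψ
    -- The powers `k, k², k³` are sums over `j < k` of the differences `1`, `2j+1`, `3j²+3j+1`.
    -- Taken as the layer weights `ψ`, these produce the powers of the floor.
    have d1 : ∀ k : ℕ, ∑ j ∈ Finset.range k, (1 : ℤ) = k := by simp
    have d2 : ∀ k : ℕ, ∑ j ∈ Finset.range k, (2 * (j : ℤ) + 1) = (k : ℤ) ^ 2 := by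
      intro k
      rw [Finset.sum_add_distrib, ← Finset.mul_sum, two_mul_sum_range_id, d1]; ring
    have d3 : ∀ k : ℕ, ∑ j ∈ Finset.range k, (3 * (j : ℤ) ^ 2 + 3 * j + 1) = (k : ℤ) ^ 3 := by
      intro k
      induction k with
      | zero => simp
      | succ k ih => rw [Finset.sum_range_succ, ih]; push_cast; ring
    have s01 := sw (fun _ => 1) (fun _ => 1)
    have s11 := sw (fun t => t) (fun _ => 1)
    have s21 := sw (fun t => (t : ℤ) ^ 2) (fun _ => 1)
    have s02 := sw (fun _ => 1) (fun j => 2 * (j : ℤ) + 1)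
    have s12 := sw (fun t => t) (fun j => 2 * (j : ℤ) + 1)
    have s03 := sw (fun _ => 1) (fun j => 3 * (j : ℤ) ^ 2 + 3 * j + 1)
    simp only [d1, d2, d3] at s01 s11 s21 s02 s12 s03
    simp only [floorMoment_cast]
    have m1 := d1 M
    have m2 := d2 M
    have m3 := d3 M
    refine ⟨?_, ?_, ?_, ?_, ?_, ?_⟩
    · simp only [pow_zero, pow_one] at h01 ⊢
      rw [h01, ← m1, s01, ← hM]
      simp only [Finset.sum_mul, ← Finset.sum_sub_distrib]
      exact Finset.sum_congr rfl fun j _ => by ring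
    · simp only [pow_zero, pow_one] at h01 h02 ⊢
      rw [h01, h02, ← m1, s11, ← hM]
      simp only [Finset.sum_mul, Finset.mul_sum, ← Finset.sum_sub_distrib,
        ← Finset.sum_add_distrib]
      refine Finset.sum_congr rfl fun j _ => ?_
      -- The sum of `t` over `h j ≤ t < N` is a difference of values of one quadratic polynomial at
      -- `N` and at `h j`. Its denominator is the reason for the factor 2; the factor 6 arises
      -- likewise from the sum of squares.
      linear_combination two_mul_sum_range_id N - two_mul_sum_range_id (h j)
    · simp only [pow_zero, pow_one] at h01 h02 h03 ⊢
      rw [h01, h02, h03, ← m1, s21, ← hM]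
      rw [Finset.mul_sum, Finset.sum_mul, Finset.mul_sum, Finset.mul_sum]
      simp only [← Finset.sum_sub_distrib, ← Finset.sum_add_distrib]
      refine Finset.sum_congr rfl fun j _ => ?_
      linear_combination six_mul_sum_range_sq N - six_mul_sum_range_sq (h j)
    · simp only [pow_zero, pow_one] at h01 h11 ⊢
      rw [h01, h11, ← pow_two, ← m2, s02, ← hM]
      simp only [Finset.sum_mul, Finset.mul_sum, ← Finset.sum_sub_distrib]
      exact Finset.sum_congr rfl fun j _ => by ring
    · simp only [pow_zero, pow_one] at h01 h11 h02 h12 ⊢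
      rw [h01, h11, h02, h12, ← pow_two, ← m2, s12, ← hM]
      rw [Finset.mul_sum, Finset.sum_mul, Finset.mul_sum, Finset.mul_sum]
      simp only [← Finset.sum_sub_distrib, ← Finset.sum_add_distrib]
      refine Finset.sum_congr rfl fun j _ => ?_
      linear_combination (2 * (j : ℤ) + 1) *
        (two_mul_sum_range_id N - two_mul_sum_range_id (h j))
    · simp only [pow_zero, pow_one] at h01 h11 h21 ⊢
      rw [h01, h11, h21, ← pow_two, ← pow_succ, ← m3, s03, ← hM]
      simp only [Finset.sum_mul, Finset.mul_sum, ← Finset.sum_sub_distrib]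
      exact Finset.sum_congr rfl fun j _ => by ring

end Swap

/-- The six moments in terms of the moments with `a` and `b` reduced modulo `m`. -/
theorem floorMoment_reduce (N m a b : ℕ) (hm : 1 ≤ m) {A B : ℤ} (hA : A = (a / m : ℕ))
    (hB : B = (b / m : ℕ)) {G01 G11 G21 G02 G12 G03 P1 P2 P3 : ℤ}
    (h01 : G01 = floorMoment 0 1 N m (a % m) (b % m))
    (h11 : G11 = floorMoment 1 1 N m (a % m) (b % m))
    (h21 : G21 = floorMoment 2 1 N m (a % m) (b % m))
    (h02 : G02 = floorMoment 0 2 N m (a % m) (b % m))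
    (h12 : G12 = floorMoment 1 2 N m (a % m) (b % m))
    (h03 : G03 = floorMoment 0 3 N m (a % m) (b % m))
    (h1 : P1 = ∑ t ∈ Finset.range N, (t : ℤ)) (h2 : P2 = ∑ t ∈ Finset.range N, (t : ℤ) ^ 2)
    (h3 : P3 = ∑ t ∈ Finset.range N, (t : ℤ) ^ 3) :
    (floorMoment 0 1 N m a b : ℤ) = A * P1 + B * N + G01 ∧
    (floorMoment 1 1 N m a b : ℤ) = A * P2 + B * P1 + G11 ∧
    (floorMoment 2 1 N m a b : ℤ) = A * P3 + B * P2 + G21 ∧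
    (floorMoment 0 2 N m a b : ℤ) = A * A * P2 + 2 * A * B * P1 + B * B * N +
      2 * A * G11 + 2 * B * G01 + G02 ∧
    (floorMoment 1 2 N m a b : ℤ) = A * A * P3 + 2 * A * B * P2 + B * B * P1 +
      2 * A * G21 + 2 * B * G11 + G12 ∧
    (floorMoment 0 3 N m a b : ℤ) = A * A * A * P3 + 3 * A * A * B * P2 +
      3 * A * B * B * P1 + B * B * B * N + 3 * A * A * G21 + 6 * A * B * G11 +
      3 * B * B * G01 + 3 * A * G12 + 3 * B * G02 + G03 := by
  have key : ∀ t : ℕ, (((a * t + b) / m : ℕ) : ℤ) =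
      A * t + B + ((a % m * t + b % m) / m : ℕ) := by
    intro t
    have e : a * t + b = a % m * t + b % m + m * (a / m * t + b / m) := by
      conv_lhs => rw [← Nat.mod_add_div a m, ← Nat.mod_add_div b m]
      ring
    rw [e, Nat.add_mul_div_left _ _ hm, hA, hB]
    push_cast
    ring
  have hN : (N : ℤ) = ∑ t ∈ Finset.range N, (1 : ℤ) := by simp
  rw [floorMoment_cast] at h01 h11 h21 h02 h12 h03
  simp only [floorMoment_cast, key]
  rw [hN, h01, h11, h21, h02, h12, h03, h1, h2, h3]
  refine ⟨?_, ?_, ?_, ?_, ?_, ?_⟩ <;>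
  · simp only [Finset.mul_sum, ← Finset.sum_add_distrib]
    exact Finset.sum_congr rfl fun t _ => by ring

/-- A bound for the moments. -/
theorem floorMoment_le {Z N m a b p q : ℕ} (hN : N ≤ Z) (ha : a ≤ Z) (hb : b ≤ Z)
    (hZ : 2 ≤ Z) (hp : p + q ≤ 3) : floorMoment p q N m a b ≤ Z ^ 10 := by
  have h1 : ∀ t ∈ Finset.range N, t ^ p * ((a * t + b) / m) ^ q ≤ Z ^ (p + 3 * q) := by
    intro t ht
    rw [Finset.mem_range] at ht
    have h2 : (a * t + b) / m ≤ Z ^ 3 := by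
      refine (Nat.div_le_self _ _).trans ?_
      have : a * t ≤ Z * Z := Nat.mul_le_mul ha (by omega)
      nlinarith
    rw [pow_add, pow_mul]
    exact Nat.mul_le_mul (Nat.pow_le_pow_left (by omega) _) (Nat.pow_le_pow_left h2 _)
  refine (Finset.sum_le_card_nsmul _ _ _ h1).trans ?_
  rw [Finset.card_range, smul_eq_mul]
  calc N * Z ^ (p + 3 * q) ≤ Z * Z ^ (p + 3 * q) := Nat.mul_le_mul_right _ hN
    _ = Z ^ (p + 3 * q + 1) := by rw [pow_succ, mul_comm]
    -- Under `p + q ≤ 3` the exponent `p + 3q + 1` is largest for `q = 3`. This is the origin of the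
    -- bound `Y ^ 10` for cell contents in all later word bounds.
    _ ≤ Z ^ 10 := Nat.pow_le_pow_right (by omega) (by omega)

/-! ## The contribution of one direction through the moments -/

theorem sum_range_sub_eq_sum_Icc {M : Type*} [AddCommMonoid M] (Y : ℕ) (g : ℕ → M) :
    ∑ t ∈ Finset.range Y, g (Y - t) = ∑ y ∈ Finset.Icc 1 Y, g y := by
  refine Finset.sum_nbij' (fun t => Y - t) (fun y => Y - y) ?_ ?_ ?_ ?_ ?_ <;>
    simp only [Finset.mem_range, Finset.mem_Icc] <;> intros <;> first | omega | trivial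

/-- `y ≤ x` and `xu + yv ≤ n` force `y(u+v) ≤ n`; for each such `y` the admissible `x` form an
interval. -/
theorem directionContribution_eq_sum (n u v : ℕ) (hu : 1 ≤ u) :
    directionContribution n u v =
      ∑ y ∈ Finset.Icc 1 (n / (u + v)), ∑ x ∈ Finset.Icc y ((n - y * v) / u),
        sideMult x y * ((n : ℤ) - x * u - y * v) * ((n : ℤ) - x * v - y * u) := by
  rw [directionContribution, Finset.sum_sigma']
  refine Finset.sum_nbij' (fun p => ⟨p.2, p.1⟩) (fun p => (p.2, p.1)) ?_ ?_ ?_ ?_ ?_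
  · rintro ⟨x, y⟩ h
    simp only [Finset.mem_filter, Finset.mem_product, Finset.mem_Icc, Finset.mem_sigma] at h ⊢
    obtain ⟨⟨⟨hx1, hxn⟩, hy1, hyn⟩, hyx, hle⟩ := h
    rw [Nat.le_div_iff_mul_le (by omega), Nat.le_div_iff_mul_le (by omega)]
    have : y * u ≤ x * u := Nat.mul_le_mul_right _ hyx
    have : y * (u + v) = y * u + y * v := by ring
    exact ⟨⟨hy1, by omega⟩, hyx, by omega⟩
  · rintro ⟨y, x⟩ h
    simp only [Finset.mem_filter, Finset.mem_product, Finset.mem_Icc, Finset.mem_sigma] at h ⊢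
    obtain ⟨⟨hy1, hy⟩, hyx, hx⟩ := h
    rw [Nat.le_div_iff_mul_le (by omega)] at hy hx
    have : y * (u + v) = y * u + y * v := by ring
    have : x ≤ x * u := Nat.le_mul_of_pos_right _ hu
    exact ⟨⟨⟨by omega, by omega⟩, hy1, by omega⟩, hyx, by omega⟩
  · intros; rfl
  · intros; rfl
  · intros; rfl

/-- With `f` the summand without its multiplicity, the sum is `4 (∑_{x ≤ G} f - ∑_{x < y} f) - 2
f(y)`, the last term correcting the diagonal `x = y`. The right-hand side separates the part
depending on `G`, which becomes moments, from a polynomial in `y` alone; the factor 6 clears the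
denominators of the power sums. -/
theorem six_mul_sum_Icc_direction {n u v y G : ℕ} (hG : y ≤ G) :
    6 * ∑ x ∈ Finset.Icc y G,
        sideMult x y * ((n : ℤ) - x * u - y * v) * ((n : ℤ) - x * v - y * u) =
      4 * (u * v * (2 * (G : ℤ) ^ 3 + 3 * (G : ℤ) ^ 2 + G) +
        3 * (((u : ℤ) ^ 2 + (v : ℤ) ^ 2) * y - n * (u + v)) * ((G : ℤ) ^ 2 + G) +
        6 * (((n : ℤ) - y * v) * (n - y * u)) * G) +
      (12 * (n : ℤ) ^ 2 - (12 * n * (u + v) + 4 * u * v + 24 * (n : ℤ) ^ 2) * y +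
        (12 * u * v + 36 * n * (u + v)) * (y : ℤ) ^ 2 -
        4 * (8 * u * v + 3 * ((u : ℤ) ^ 2 + (v : ℤ) ^ 2)) * (y : ℤ) ^ 3) := by
  set f : ℕ → ℤ := fun x => ((n : ℤ) - x * u - y * v) * ((n : ℤ) - x * v - y * u) with hf
  have hsum : ∀ X : ℕ, 6 * ∑ x ∈ Finset.range X, f x =
      u * v * (X * ((X : ℤ) - 1) * (2 * X - 1)) +
      3 * (((u : ℤ) ^ 2 + (v : ℤ) ^ 2) * y - n * (u + v)) * (X * ((X : ℤ) - 1)) +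
      6 * (((n : ℤ) - y * v) * (n - y * u)) * X := by
    intro X
    induction X with
    | zero => simp
    | succ X ih => rw [Finset.sum_range_succ, mul_add, ih, hf]; push_cast; ring
  have h1 : ∑ x ∈ Finset.Icc y G,
        sideMult x y * ((n : ℤ) - x * u - y * v) * ((n : ℤ) - x * v - y * u) =
      4 * (∑ x ∈ Finset.range (G + 1), f x - ∑ x ∈ Finset.range y, f x) - 2 * f y := by
    rw [← Finset.sum_Ico_eq_sub _ (by omega : y ≤ G + 1),
      show Finset.Ico y (G + 1) = Finset.Icc y G by ext; simp]
    have hy : y ∈ Finset.Icc y G := Finset.mem_Icc.2 ⟨le_rfl, hG⟩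
    rw [← Finset.add_sum_erase _ _ hy, ← Finset.add_sum_erase _ f hy,
      Finset.sum_congr rfl (g := fun x => 4 * f x), ← Finset.mul_sum]
    · simp only [sideMult, if_true, hf]; ring
    · intro x hx
      simp only [sideMult, if_neg (Finset.ne_of_mem_erase hx), hf]; ring
  have h2 := hsum (G + 1)
  have h3 := hsum y
  rw [h1]
  push_cast at h2
  have hfy : f y = ((n : ℤ) - y * u - y * v) * ((n : ℤ) - y * v - y * u) := rfl
  rw [hfy]
  linear_combination 4 * h2 - 4 * h3

theorem two_mul_sum_range_sub (Y : ℕ) :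
    2 * ∑ t ∈ Finset.range Y, ((Y : ℤ) - t) = Y * ((Y : ℤ) + 1) := by
  rw [Finset.sum_sub_distrib, mul_sub, two_mul_sum_range_id]; simp; ring

theorem six_mul_sum_range_sub_sq (Y : ℕ) :
    6 * ∑ t ∈ Finset.range Y, ((Y : ℤ) - t) ^ 2 = Y * ((Y : ℤ) + 1) * (2 * Y + 1) := by
  have : ∑ t ∈ Finset.range Y, ((Y : ℤ) - t) ^ 2 = (Y : ℤ) ^ 2 * ∑ t ∈ Finset.range Y, (1 : ℤ)
      - 2 * Y * ∑ t ∈ Finset.range Y, (t : ℤ) + ∑ t ∈ Finset.range Y, (t : ℤ) ^ 2 := by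
    rw [Finset.mul_sum, Finset.mul_sum, ← Finset.sum_sub_distrib, ← Finset.sum_add_distrib]
    exact Finset.sum_congr rfl fun _ _ => by ring
  rw [this, Finset.sum_const, Finset.card_range, nsmul_eq_mul]
  linear_combination six_mul_sum_range_sq Y - 6 * (Y : ℤ) * two_mul_sum_range_id Y

theorem four_mul_sum_range_sub_cube (Y : ℕ) :
    4 * ∑ t ∈ Finset.range Y, ((Y : ℤ) - t) ^ 3 = (Y * ((Y : ℤ) + 1)) ^ 2 := by
  have : ∑ t ∈ Finset.range Y, ((Y : ℤ) - t) ^ 3 = (Y : ℤ) ^ 3 * ∑ t ∈ Finset.range Y, (1 : ℤ)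
      - 3 * (Y : ℤ) ^ 2 * ∑ t ∈ Finset.range Y, (t : ℤ) +
      3 * Y * ∑ t ∈ Finset.range Y, (t : ℤ) ^ 2 - ∑ t ∈ Finset.range Y, (t : ℤ) ^ 3 := by
    rw [Finset.mul_sum, Finset.mul_sum, Finset.mul_sum, ← Finset.sum_sub_distrib,
      ← Finset.sum_add_distrib, ← Finset.sum_sub_distrib]
    exact Finset.sum_congr rfl fun _ _ => by ring
  rw [this, Finset.sum_const, Finset.card_range, nsmul_eq_mul]
  linear_combination -four_mul_sum_range_cube Y + 2 * (Y : ℤ) * six_mul_sum_range_sq Y -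
    6 * (Y : ℤ) ^ 2 * two_mul_sum_range_id Y

/-- The contribution of one direction by a single query to the six-moment kernel. -/
theorem six_mul_directionContribution {n u v : ℕ} (hu : 1 ≤ u) {Y : ℕ}
    (hY : Y = n / (u + v)) {K01 K11 K21 K02 K12 K03 : ℤ}
    (h01 : K01 = floorMoment 0 1 Y u v (n - Y * v))
    (h11 : K11 = floorMoment 1 1 Y u v (n - Y * v))
    (h21 : K21 = floorMoment 2 1 Y u v (n - Y * v))
    (h02 : K02 = floorMoment 0 2 Y u v (n - Y * v))
    (h12 : K12 = floorMoment 1 2 Y u v (n - Y * v))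
    (h03 : K03 = floorMoment 0 3 Y u v (n - Y * v)) :
    6 * directionContribution n u v =
      4 * (u * v * (2 * K03 + 3 * K02 + K01) +
        3 * ((u : ℤ) * u + v * v) * ((Y * K02 - K12) + (Y * K01 - K11)) -
        3 * n * (u + v) * (K02 + K01) +
        6 * (n * n * K01 - n * (u + v) * (Y * K01 - K11) +
          u * v * (Y * Y * K01 - 2 * Y * K11 + K21))) +
      (12 * n * n * Y - (6 * n * (u + v) + 2 * u * v + 12 * (n * n)) * (Y * (Y + 1)) +
        (2 * u * v + 6 * n * (u + v)) * (Y * (Y + 1) * (2 * Y + 1)) -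
        (8 * u * v + 3 * ((u : ℤ) * u + v * v)) * (Y * (Y + 1) * (Y * (Y + 1)))) := by
  have hYn : Y * (u + v) ≤ n := hY ▸ Nat.div_mul_le_self n (u + v)
  have hYv : Y * (u + v) = Y * u + Y * v := by ring
  -- Reversing the order by `y = Y - t` turns `⌊(n-yv)/u⌋`, whose slope is negative, into a floor
  -- with nonnegative coefficients, as the kernel requires; `Y * v ≤ n` makes the subtraction exact.
  set G : ℕ → ℕ := fun t => (v * t + (n - Y * v)) / u with hG
  have e1 : 6 * directionContribution n u v = ∑ t ∈ Finset.range Y,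
      (4 * (u * v * (2 * (G t : ℤ) ^ 3 + 3 * (G t : ℤ) ^ 2 + G t) +
        3 * (((u : ℤ) ^ 2 + (v : ℤ) ^ 2) * (Y - t) - n * (u + v)) * ((G t : ℤ) ^ 2 + G t) +
        6 * (((n : ℤ) - (Y - t) * v) * (n - (Y - t) * u)) * G t) +
      (12 * (n : ℤ) ^ 2 - (12 * n * (u + v) + 4 * u * v + 24 * (n : ℤ) ^ 2) * (Y - t) +
        (12 * u * v + 36 * n * (u + v)) * ((Y : ℤ) - t) ^ 2 -
        4 * (8 * u * v + 3 * ((u : ℤ) ^ 2 + (v : ℤ) ^ 2)) * ((Y : ℤ) - t) ^ 3)) := by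
    rw [directionContribution_eq_sum n u v hu, ← hY, Finset.mul_sum,
      ← sum_range_sub_eq_sum_Icc]
    refine Finset.sum_congr rfl fun t ht => ?_
    rw [Finset.mem_range] at ht
    have hGt : (n - (Y - t) * v) / u = G t := by
      have : (Y - t) * v = Y * v - t * v := Nat.sub_mul _ _ _
      have : t * v ≤ Y * v := Nat.mul_le_mul_right _ ht.le
      have : v * t = t * v := mul_comm _ _
      simp only [hG]
      congr 1
      omega
    have hle : Y - t ≤ (n - (Y - t) * v) / u := by
      rw [Nat.le_div_iff_mul_le hu]
      have h1 : (Y - t) * (u + v) ≤ Y * (u + v) := Nat.mul_le_mul_right _ (Nat.sub_le _ _)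
      have h2 : (Y - t) * (u + v) = (Y - t) * u + (Y - t) * v := by ring
      omega
    rw [six_mul_sum_Icc_direction hle, hGt, Nat.cast_sub ht.le]
  have hc : ∀ c : ℤ, ∑ _t ∈ Finset.range Y, c = Y * c := by simp
  rw [e1]
  rw [floorMoment_cast] at h01 h11 h21 h02 h12 h03
  have t1 := two_mul_sum_range_sub Y
  have t2 := six_mul_sum_range_sub_sq Y
  have t3 := four_mul_sum_range_sub_cube Y
  have t0 := hc 1
  set T0 := ∑ _t ∈ Finset.range Y, (1 : ℤ) with hT0
  set T1 := ∑ t ∈ Finset.range Y, ((Y : ℤ) - t) with hT1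
  set T2 := ∑ t ∈ Finset.range Y, ((Y : ℤ) - t) ^ 2 with hT2
  set T3 := ∑ t ∈ Finset.range Y, ((Y : ℤ) - t) ^ 3 with hT3
  -- Any combination of the six moments and four power sums is one sum over `t`. This reduces the
  -- claim to an identity between summands, followed by inserting the closed forms of the power
  -- sums.
  have e2 : ∀ c1 c2 c3 c4 c5 c6 c7 c8 c9 c10 : ℤ,
      c1 * K01 + c2 * K11 + c3 * K21 + c4 * K02 + c5 * K12 + c6 * K03 +
        c7 * T0 + c8 * T1 + c9 * T2 + c10 * T3 = ∑ t ∈ Finset.range Y,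
      (c1 * G t + c2 * (t * G t) + c3 * (t ^ 2 * G t) + c4 * (G t : ℤ) ^ 2 +
        c5 * (t * (G t : ℤ) ^ 2) + c6 * (G t : ℤ) ^ 3 + c7 * 1 + c8 * (Y - t) +
        c9 * ((Y : ℤ) - t) ^ 2 + c10 * ((Y : ℤ) - t) ^ 3) := by
    intro c1 c2 c3 c4 c5 c6 c7 c8 c9 c10
    rw [h01, h11, h21, h02, h12, h03]
    simp only [Finset.sum_add_distrib, ← Finset.mul_sum, pow_zero, pow_one, one_mul]
    rfl
  trans (4 * (u * v) - 12 * (n * (u + v)) + 12 * ((u : ℤ) ^ 2 + (v : ℤ) ^ 2) * Y +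
      24 * (n ^ 2 - n * (u + v) * Y + u * v * Y ^ 2)) * K01 +
    (-12 * ((u : ℤ) ^ 2 + (v : ℤ) ^ 2) + 24 * (n * (u + v)) - 48 * (u * v) * Y) * K11 +
    24 * (u * v) * K21 +
    (12 * (u * v) + 12 * ((u : ℤ) ^ 2 + (v : ℤ) ^ 2) * Y - 12 * (n * (u + v))) * K02 +
    (-12 * ((u : ℤ) ^ 2 + (v : ℤ) ^ 2)) * K12 + 8 * (u * v) * K03 +
    12 * (n : ℤ) ^ 2 * T0 + (- (12 * n * (u + v) + 4 * u * v + 24 * (n : ℤ) ^ 2)) * T1 +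
    (12 * u * v + 36 * n * (u + v)) * T2 + (-4 * (8 * u * v + 3 * ((u : ℤ) ^ 2 + (v : ℤ) ^ 2))) * T3
  · rw [e2]
    refine Finset.sum_congr rfl fun t _ => ?_
    ring
  · linear_combination 12 * (n : ℤ) ^ 2 * t0 -
      (6 * n * (u + v) + 2 * u * v + 12 * (n : ℤ) ^ 2) * t1 +
      (2 * u * v + 6 * n * (u + v)) * t2 - (8 * u * v + 3 * ((u : ℤ) ^ 2 + (v : ℤ) ^ 2)) * t3

/-! ## The six-moment kernel -/

open Expr in
/-- The reduced moments, from the query answer in the cells `0, …, 5`, `N` in cell `7` and `M`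
in cell `10`. -/
def swappedMoment : Fin 6 → Expr
  | 0 => cell 10 * cell 7 - cell 0
  | 1 => (cell 10 * (cell 7 * (cell 7 - 1)) - cell 3 + cell 0) / 2
  | 2 => (cell 10 * (cell 7 * (cell 7 - 1) * (2 * cell 7 - 1)) - 2 * cell 5 + 3 * cell 3
      - cell 0) / 6
  | 3 => cell 10 * cell 10 * cell 7 - 2 * cell 1 - cell 0
  | 4 => (cell 10 * cell 10 * (cell 7 * (cell 7 - 1)) - 2 * cell 4 - cell 3 + 2 * cell 1
      + cell 0) / 2
  | 5 => cell 10 * cell 10 * cell 10 * cell 7 - 3 * cell 2 - 3 * cell 1 - cell 0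

open Expr in
/-- The power sums of the integers `0 ≤ t < N` for `N` in cell `7`. -/
def powerSum : Fin 3 → Expr
  | 0 => cell 7 * (cell 7 - 1) / 2
  | 1 => cell 7 * (cell 7 - 1) * (2 * cell 7 - 1) / 6
  | 2 => (cell 7 * (cell 7 - 1)) * (cell 7 * (cell 7 - 1)) / 4

open Expr in
/-- The moments, with `⌊a/m⌋` in cell `8` and `⌊b/m⌋` in cell `9`. -/
def fullMoment : Fin 6 → Expr
  | 0 => cell 8 * powerSum 0 + cell 9 * cell 7 + swappedMoment 0
  | 1 => cell 8 * powerSum 1 + cell 9 * powerSum 0 + swappedMoment 1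
  | 2 => cell 8 * powerSum 2 + cell 9 * powerSum 1 + swappedMoment 2
  | 3 => cell 8 * cell 8 * powerSum 1 + 2 * cell 8 * cell 9 * powerSum 0 +
      cell 9 * cell 9 * cell 7 + 2 * cell 8 * swappedMoment 1 + 2 * cell 9 * swappedMoment 0 +
      swappedMoment 3
  | 4 => cell 8 * cell 8 * powerSum 2 + 2 * cell 8 * cell 9 * powerSum 1 +
      cell 9 * cell 9 * powerSum 0 + 2 * cell 8 * swappedMoment 2 +
      2 * cell 9 * swappedMoment 1 + swappedMoment 4
  | 5 => cell 8 * cell 8 * cell 8 * powerSum 2 + 3 * cell 8 * cell 8 * cell 9 * powerSum 1 +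
      3 * cell 8 * cell 9 * cell 9 * powerSum 0 + cell 9 * cell 9 * cell 9 * cell 7 +
      3 * cell 8 * cell 8 * swappedMoment 2 + 6 * cell 8 * cell 9 * swappedMoment 1 +
      3 * cell 9 * cell 9 * swappedMoment 0 + 3 * cell 8 * swappedMoment 4 +
      3 * cell 9 * swappedMoment 3 + swappedMoment 5

/-- The memory holds the data from which `fullMoment` computes the moments. -/
structure MomentData (σ : Memory) (N m a b M : ℕ) : Prop where
  output : KernelOutput σ M (a % m) m (m - b % m + a % m - 1)
  cell7 : σ 7 = N
  cell8 : σ 8 = (a / m : ℕ)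
  cell9 : σ 9 = (b / m : ℕ)
  cell10 : σ 10 = M

theorem MomentData.update {σ : Memory} {N m a b M : ℕ} (h : MomentData σ N m a b M) {i : ℤ}
    (hi : 11 ≤ i) (v : ℤ) : MomentData (Function.update σ i v) N m a b M := by
  obtain ⟨⟨k0, k1, k2, k3, k4, k5⟩, h7, h8, h9, h10⟩ := h
  constructor
  · refine ⟨?_, ?_, ?_, ?_, ?_, ?_⟩ <;> rw [Function.update_of_ne (by omega)] <;> assumption
  all_goals rw [Function.update_of_ne (by omega)]; assumption

/-- The machine divisions by 2, 4 and 6 are exact, because each numerator is the corresponding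
multiple of an integer moment or power sum. -/
theorem MomentData.eval_fullMoment {σ : Memory} {N m a b M : ℕ} (hD : MomentData σ N m a b M)
    (hm : 1 ≤ m) (hM : M = (a % m * N + b % m) / m) :
    (fullMoment 0).eval σ = floorMoment 0 1 N m a b ∧
    (fullMoment 1).eval σ = floorMoment 1 1 N m a b ∧
    (fullMoment 2).eval σ = floorMoment 2 1 N m a b ∧
    (fullMoment 3).eval σ = floorMoment 0 2 N m a b ∧
    (fullMoment 4).eval σ = floorMoment 1 2 N m a b ∧
    (fullMoment 5).eval σ = floorMoment 0 3 N m a b := by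
  obtain ⟨⟨k0, k1, k2, k3, k4, k5⟩, h7, h8, h9, h10⟩ := hD
  obtain ⟨g0, g1, g2, g3, g4, g5⟩ := floorMoment_swap (N := N) (Nat.mod_lt a hm)
    (Nat.mod_lt b hm) hM k0 k1 k2 k3 k4 k5
  have e0 : (swappedMoment 0).eval σ = floorMoment 0 1 N m (a % m) (b % m) := by
    simp [swappedMoment, h7, h10, g0]
  have e1 : (swappedMoment 1).eval σ = floorMoment 1 1 N m (a % m) (b % m) := by
    simp [swappedMoment, h7, h10, ← g1]
  have e2 : (swappedMoment 2).eval σ = floorMoment 2 1 N m (a % m) (b % m) := by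
    simp [swappedMoment, h7, h10, ← g2]
  have e3 : (swappedMoment 3).eval σ = floorMoment 0 2 N m (a % m) (b % m) := by
    simp [swappedMoment, h7, h10, g3]
  have e4 : (swappedMoment 4).eval σ = floorMoment 1 2 N m (a % m) (b % m) := by
    simp [swappedMoment, h7, h10, ← g4]
  have e5 : (swappedMoment 5).eval σ = floorMoment 0 3 N m (a % m) (b % m) := by
    simp [swappedMoment, h7, h10, g5]
  have p0 : (powerSum 0).eval σ = ∑ t ∈ Finset.range N, (t : ℤ) := by
    simp [powerSum, h7, ← two_mul_sum_range_id]
  have p1 : (powerSum 1).eval σ = ∑ t ∈ Finset.range N, (t : ℤ) ^ 2 := by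
    simp [powerSum, h7, ← six_mul_sum_range_sq]
  have p2 : (powerSum 2).eval σ = ∑ t ∈ Finset.range N, (t : ℤ) ^ 3 := by
    have := four_mul_sum_range_cube N
    rw [pow_two] at this
    simp [powerSum, h7, ← this]
  obtain ⟨r0, r1, r2, r3, r4, r5⟩ := floorMoment_reduce N m a b hm h8 h9 e0 e1 e2 e3 e4 e5
    p0 p1 p2
  simp only [fullMoment, Expr.eval_add, Expr.eval_mul, Expr.eval_cell, Expr.eval_ofNat, h7]
  rw [r0, r1, r2, r3, r4, r5]
  exact ⟨rfl, rfl, rfl, rfl, rfl, rfl⟩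

open Stmt Expr in
/-- Computes the moments from the answer of the recursive query and the saved values. -/
def kernelTail : Stmt :=
  set 7 (read (cell 6)) ;; set 8 (read (cell 6 + 1)) ;; set 9 (read (cell 6 + 2)) ;;
  set 10 (read (cell 6 + 3)) ;;
  set 11 (fullMoment 0) ;; set 12 (fullMoment 1) ;; set 13 (fullMoment 2) ;;
  set 14 (fullMoment 3) ;; set 15 (fullMoment 4) ;; set 16 (fullMoment 5) ;;
  set 0 (cell 11) ;; set 1 (cell 12) ;; set 2 (cell 13) ;; set 3 (cell 14) ;;
  set 4 (cell 15) ;; set 5 (cell 16)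

/-- All six formulas read the answer of the recursive query in the cells `0, …, 5`, so the results
are collected in `11, …, 16` and copied down only at the end. -/
theorem kernelTail_runs {Γ : Program} {w Z : ℕ} (hW : WordBound w Z) {σ : Memory}
    {N m a b M : ℕ} (hm : 1 ≤ m) (hM : M = (a % m * N + b % m) / m)
    (hK : KernelOutput σ M (a % m) m (m - b % m + a % m - 1)) (h6 : 64 ≤ σ 6)
    (h6Z : σ 6 ≤ Z) (h7 : σ (σ 6) = N) (h8 : σ (σ 6 + 1) = (a / m : ℕ))
    (h9 : σ (σ 6 + 2) = (b / m : ℕ)) (h10 : σ (σ 6 + 3) = M)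
    (hNZ : N ≤ Z) (haZ : a / m ≤ Z) (hbZ : b / m ≤ Z) (hMZ : M ≤ Z)
    (hKZ : ∀ p q, p + q ≤ 3 → floorMoment p q M (a % m) m (m - b % m + a % m - 1) ≤ Z)
    (hHZ : ∀ p q, p + q ≤ 3 → floorMoment p q N m a b ≤ Z) :
    Runs Γ w kernelTail σ (fun _ L τ => L = [] ∧ KernelOutput τ N m a b ∧
      ∀ i, (17 ≤ i ∨ i = 6) → τ i = σ i) := by
  obtain ⟨s, hs⟩ : ∃ s, s = σ 6 := ⟨_, rfl⟩
  rw [← hs] at h6 h6Z h7 h8 h9 h10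
  have hs6 : |s| ≤ (Z : ℤ) := by rw [abs_of_nonneg (by omega)]; exact h6Z
  have c : ∀ {x : ℕ}, x ≤ Z → |(x : ℤ)| ≤ (Z : ℤ) := fun h => by
    rw [Nat.abs_cast]; exact_mod_cast h
  have hsafe : ∀ {σ : Memory} {j : Fin 6}, MomentData σ N m a b M →
      (fullMoment j).Safe Z σ := by
    rintro σ j ⟨⟨k0, k1, k2, k3, k4, k5⟩, h7, h8, h9, h10⟩
    refine Expr.safe_of_simpleOn (l := [0, 1, 2, 3, 4, 5, 7, 8, 9, 10]) ?_
      (by revert j; decide)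
    simp only [List.forall_mem_cons, k0, k1, k2, k3, k4, k5, h7, h8, h9, h10]
    exact ⟨c (hKZ 0 1 (by norm_num)), c (hKZ 1 1 (by norm_num)), c (hKZ 2 1 (by norm_num)),
      c (hKZ 0 2 (by norm_num)), c (hKZ 1 2 (by norm_num)), c (hKZ 0 3 (by norm_num)), c hNZ,
      c haZ, c hbZ, c hMZ, by simp⟩
  refine Runs.seq (Runs.set hW (N : ℤ) (by simp [← hs, h7])
    (by simp only [Expr.safe_read, Expr.safe_cell, Expr.eval_cell, ← hs, h7]
        exact ⟨⟨by norm_num, hs6⟩, by omega, c hNZ⟩) (by decide) ?_)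
  refine Runs.seq (Runs.set hW ((a / m : ℕ) : ℤ)
    (by simp (disch := omega) only [Expr.eval_read, Expr.eval_cell, Expr.eval_add,
      Expr.eval_one, Function.update_of_ne, ← hs, h8])
    (by simp (disch := omega) only [Expr.safe_read, Expr.safe_cell, Expr.safe_add,
          Expr.safe_one, Expr.eval_cell, Expr.eval_add, Expr.eval_one, Function.update_of_ne,
          ← hs, h8]
        exact ⟨⟨⟨by norm_num, hs6⟩, trivial⟩, by omega, c haZ⟩) (by decide) ?_)
  refine Runs.seq (Runs.set hW ((b / m : ℕ) : ℤ)
    (by simp (disch := omega) only [Expr.eval_read, Expr.eval_cell, Expr.eval_add,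
      Expr.eval_ofNat, Function.update_of_ne, ← hs, h9])
    (by simp (disch := omega) only [Expr.safe_read, Expr.safe_cell, Expr.safe_add,
          Expr.safe_ofNat, Expr.eval_cell, Expr.eval_add, Expr.eval_ofNat,
          Function.update_of_ne, ← hs, h9]
        exact ⟨⟨⟨by norm_num, hs6⟩, trivial⟩, by omega, c hbZ⟩) (by decide) ?_)
  refine Runs.seq (Runs.set hW (M : ℤ)
    (by simp (disch := omega) only [Expr.eval_read, Expr.eval_cell, Expr.eval_add,
      Expr.eval_ofNat, Function.update_of_ne, ← hs, h10])
    (by simp (disch := omega) only [Expr.safe_read, Expr.safe_cell, Expr.safe_add,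
          Expr.safe_ofNat, Expr.eval_cell, Expr.eval_add, Expr.eval_ofNat,
          Function.update_of_ne, ← hs, h10]
        exact ⟨⟨⟨by norm_num, hs6⟩, trivial⟩, by omega, c hMZ⟩) (by decide) ?_)
  have hD : MomentData (Function.update (Function.update (Function.update (Function.update
      σ 7 N) 8 (a / m : ℕ)) 9 (b / m : ℕ)) 10 M) N m a b M :=
    ⟨by simpa [KernelOutput] using hK, by simp, by simp, by simp, by simp⟩
  have hfr : ∀ i, (17 ≤ i ∨ i = 6) → Function.update (Function.update (Function.update
      (Function.update σ 7 N) 8 (a / m : ℕ)) 9 (b / m : ℕ)) 10 M i = σ i := by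
    intro i hi
    simp (disch := omega) only [Function.update_of_ne]
  generalize Function.update (Function.update (Function.update (Function.update
      σ 7 N) 8 (a / m : ℕ)) 9 (b / m : ℕ)) 10 M = σ₀ at hD hfr
  have out := fun {σ : Memory} (h : MomentData σ N m a b M) => h.eval_fullMoment hm hM
  refine Runs.seq (Runs.set hW _ (out hD).1 (hsafe hD) (by decide) ?_)
  have hD1 := hD.update (i := 11) (by norm_num) (floorMoment 0 1 N m a b : ℤ)
  refine Runs.seq (Runs.set hW _ (out hD1).2.1 (hsafe hD1) (by decide) ?_)
  have hD2 := hD1.update (i := 12) (by norm_num) (floorMoment 1 1 N m a b : ℤ)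
  refine Runs.seq (Runs.set hW _ (out hD2).2.2.1 (hsafe hD2) (by decide) ?_)
  have hD3 := hD2.update (i := 13) (by norm_num) (floorMoment 2 1 N m a b : ℤ)
  refine Runs.seq (Runs.set hW _ (out hD3).2.2.2.1 (hsafe hD3) (by decide) ?_)
  have hD4 := hD3.update (i := 14) (by norm_num) (floorMoment 0 2 N m a b : ℤ)
  refine Runs.seq (Runs.set hW _ (out hD4).2.2.2.2.1 (hsafe hD4) (by decide) ?_)
  have hD5 := hD4.update (i := 15) (by norm_num) (floorMoment 1 2 N m a b : ℤ)
  refine Runs.seq (Runs.set hW _ (out hD5).2.2.2.2.2 (hsafe hD5) (by decide) ?_)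
  have h01 := c (hHZ 0 1 (by norm_num))
  have h11 := c (hHZ 1 1 (by norm_num))
  have h21 := c (hHZ 2 1 (by norm_num))
  have h02 := c (hHZ 0 2 (by norm_num))
  have h12 := c (hHZ 1 2 (by norm_num))
  have h03 := c (hHZ 0 3 (by norm_num))
  refine Runs.seq (Runs.set hW (floorMoment 0 1 N m a b : ℤ) (by simp)
    (by simpa using h01) (by decide) ?_)
  refine Runs.seq (Runs.set hW (floorMoment 1 1 N m a b : ℤ) (by simp)
    (by simpa using h11) (by decide) ?_)
  refine Runs.seq (Runs.set hW (floorMoment 2 1 N m a b : ℤ) (by simp)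
    (by simpa using h21) (by decide) ?_)
  refine Runs.seq (Runs.set hW (floorMoment 0 2 N m a b : ℤ) (by simp)
    (by simpa using h02) (by decide) ?_)
  refine Runs.seq (Runs.set hW (floorMoment 1 2 N m a b : ℤ) (by simp)
    (by simpa using h12) (by decide) ?_)
  refine Runs.set hW (floorMoment 0 3 N m a b : ℤ) (by simp)
    (by simpa using h03) (by decide) ?_
  refine ⟨rfl, by simp [KernelOutput], fun i hi => ?_⟩
  simp (disch := omega) only [Function.update_of_ne]
  exact hfr i hi

open Stmt Expr in
/-- Saves `N, ⌊a/m⌋, ⌊b/m⌋, M` on the stack, with `a mod m`, `b mod m` and `M` also in the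
cells `7, 8, 9`. -/
def kernelHead : Stmt :=
  Stmt.assign (cell 6) (cell 0) ;;
  Stmt.assign (cell 6 + 1) (cell 2 / cell 1) ;;
  Stmt.assign (cell 6 + 2) (cell 3 / cell 1) ;;
  set 7 (cell 2 - cell 1 * (cell 2 / cell 1)) ;;
  set 8 (cell 3 - cell 1 * (cell 3 / cell 1)) ;;
  set 9 ((cell 7 * cell 0 + cell 8) / cell 1) ;;
  Stmt.assign (cell 6 + 3) (cell 9)

open Stmt Expr in
/-- Calls the recursive procedure with the roles of `m` and `a` exchanged. -/
def kernelRecurse : Stmt :=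
  set 0 (cell 9) ;; set 3 (cell 1 - cell 8 + cell 7 - 1) ;; set 2 (cell 1) ;;
  set 1 (cell 7) ;; set 6 (cell 6 + 4) ;; Stmt.call 4 ;; set 6 (cell 6 - 4)

open Stmt in
/-- The moments of an empty range. -/
def kernelZero : Stmt :=
  set 0 0 ;; set 1 0 ;; set 2 0 ;; set 3 0 ;; set 4 0 ;; set 5 0

/-- The recursive procedure for the six moments. The stack pointer is in cell `6`. -/
def recKernelBody : Stmt :=
  kernelHead ;; Stmt.ite 1 (Expr.cell 9) kernelRecurse kernelZero ;; kernelTail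

theorem abs_natCast_le {x Z : ℕ} (h : x ≤ Z) : |(x : ℤ)| ≤ (Z : ℤ) := by
  rw [Nat.abs_cast]; exact_mod_cast h

/-- Each activation owns the four cells `s, …, s + 3`. That the cells from `17` up to `s` are
unchanged protects the frames of the callers and the variables of the calling procedures. -/
theorem kernelHead_runs {Γ : Program} {w Z : ℕ} (hW : WordBound w Z) {σ : Memory}
    {N m a b : ℕ} {s : ℤ} (hm : 1 ≤ m) (hin : KernelInput σ N m a b) (h6 : σ 6 = s)
    (hs : 64 ≤ s) (hsZ : s ≤ Z) (hN : N ≤ Z) (hmZ : m ≤ Z) (ha : a ≤ Z) (hb : b ≤ Z)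
    (hM : (a % m * N + b % m) / m ≤ Z) :
    Runs Γ w kernelHead σ (fun _ L τ => L = [] ∧ τ 1 = m ∧ τ 6 = s ∧ τ 7 = (a % m : ℕ) ∧
      τ 8 = (b % m : ℕ) ∧ τ 9 = ((a % m * N + b % m) / m : ℕ) ∧ τ s = N ∧
      τ (s + 1) = (a / m : ℕ) ∧ τ (s + 2) = (b / m : ℕ) ∧
      τ (s + 3) = ((a % m * N + b % m) / m : ℕ) ∧
      ∀ i, 17 ≤ i → i < s → τ i = σ i) := by
  obtain ⟨h0, h1, h2, h3⟩ := hin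
  have hs6 : |s| ≤ (Z : ℤ) := by rw [abs_of_nonneg (by omega)]; exact hsZ
  have cN := abs_natCast_le hN
  have cm := abs_natCast_le hmZ
  have ca := abs_natCast_le ha
  have cb := abs_natCast_le hb
  have cam := abs_natCast_le (((Nat.mod_lt a hm).le).trans hmZ)
  have cbm := abs_natCast_le (((Nat.mod_lt b hm).le).trans hmZ)
  have cM := abs_natCast_le hM
  have hm' : (0 : ℤ) < m := by omega
  have hmod : ∀ x : ℕ, (x : ℤ) - m * (x / m) = (x % m : ℕ) := fun x => by
    push_cast; rw [Int.emod_def]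
  refine Runs.seq (Runs.assign hW (N : ℤ) s (by simp [h6]) (by simp [h0]) (by omega)
    (by simp [h6, hs6]) (by simp [h0, hN]) (by decide) ?_)
  refine Runs.seq (Runs.assign hW ((a / m : ℕ) : ℤ) (s + 1)
    (by simp (disch := omega) [h6]) (by simp (disch := omega) [h1, h2]) (by omega)
    (by simp (disch := omega) [h6, hs6]) (by simp (disch := omega) [h1, h2]; omega)
    (by decide) ?_)
  refine Runs.seq (Runs.assign hW ((b / m : ℕ) : ℤ) (s + 2)
    (by simp (disch := omega) [h6]) (by simp (disch := omega) [h1, h3]) (by omega)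
    (by simp (disch := omega) [h6, hs6]) (by simp (disch := omega) [h1, h3]; omega)
    (by decide) ?_)
  refine Runs.seq (Runs.set hW ((a % m : ℕ) : ℤ)
    (by simp (disch := omega) [h1, h2, ← hmod]) (by simp (disch := omega) [h1, h2]; omega)
    (by decide) ?_)
  refine Runs.seq (Runs.set hW ((b % m : ℕ) : ℤ)
    (by simp (disch := omega) [h1, h3, ← hmod]) (by simp (disch := omega) [h1, h3]; omega)
    (by decide) ?_)
  refine Runs.seq (Runs.set hW (((a % m * N + b % m) / m : ℕ) : ℤ)
    (by simp (disch := omega) [h0, h1])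
    (by simp (disch := omega) only [Expr.safe_div, Expr.safe_add, Expr.safe_mul,
          Expr.safe_cell, Expr.eval_cell, Function.update_of_ne, Function.update_self, h0, h1]
        exact ⟨⟨⟨⟨by norm_num, cam⟩, by norm_num, cN⟩, by norm_num, cbm⟩,
          ⟨by norm_num, cm⟩, hm'⟩)
    (by decide) ?_)
  refine Runs.assign hW (((a % m * N + b % m) / m : ℕ) : ℤ) (s + 3)
    (by simp (disch := omega) [h6]) (by simp) (by omega)
    (by simp (disch := omega) [h6, hs6])
    (by simp only [Expr.safe_cell, Function.update_self]; exact ⟨by norm_num, cM⟩)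
    (by decide) ?_
  refine ⟨rfl, ?_, ?_, ?_, ?_, ?_, ?_, ?_, ?_, ?_, fun i hi his => ?_⟩ <;>
    simp (disch := omega) only [Function.update_of_ne, Function.update_self, h1, h6]

/-- If `m` divides `a`, the floor is `⌊(b % m)/m⌋ = 0`. Hence a nonempty recursive range guarantees
that the new modulus is positive. -/
theorem floor_pos_imp {N m a b : ℕ} (hm : 1 ≤ m) (h : 1 ≤ (a % m * N + b % m) / m) :
    1 ≤ a % m := by
  by_contra h0
  have h1 : a % m = 0 := by omega
  rw [h1, zero_mul, zero_add, Nat.div_eq_of_lt (Nat.mod_lt b hm)] at h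
  omega

/-- The reduced slope and intercept are both below 1, so the length of the range does not grow along
the recursion. -/
theorem floor_le_of_reduced {N m a b : ℕ} (hm : 1 ≤ m) : (a % m * N + b % m) / m ≤ N := by
  rw [← Nat.lt_succ_iff, Nat.div_lt_iff_lt_mul hm, Nat.succ_mul]
  have h1 := Nat.mod_lt a hm
  have h2 := Nat.mod_lt b hm
  have h3 : a % m * N ≤ m * N := Nat.mul_le_mul_right _ h1.le
  have h4 : m * N = N * m := mul_comm _ _
  omega

/-- One level of the recursion. -/
theorem recKernelBody_step {Γ : Program} {w Y : ℕ} (hΓ : Γ[4]? = some recKernelBody)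
    (hY : 2 ≤ Y) (hW : WordBound w (Y ^ 10)) {N m a b T : ℕ} {σ : Memory} {s : ℤ}
    (hm : 1 ≤ m) (hN : N ≤ Y) (hmY : 2 * m ≤ Y) (ha : a ≤ Y) (hb : b ≤ Y)
    (hin : KernelInput σ N m a b) (h6 : σ 6 = s) (hs : 64 ≤ s) (hsY : s + 4 * m ≤ 64 + 2 * Y)
    (hrec : 1 ≤ (a % m * N + b % m) / m → ∀ σ' : Memory,
      KernelInput σ' ((a % m * N + b % m) / m) (a % m) m (m - b % m + a % m - 1) →
      σ' 6 = s + 4 →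
      Runs Γ w recKernelBody σ' (fun t _ τ => t ≤ T ∧
        KernelOutput τ ((a % m * N + b % m) / m) (a % m) m (m - b % m + a % m - 1) ∧
        τ 6 = s + 4 ∧ ∀ i, 17 ≤ i → i < s + 4 → τ i = σ' i)) :
    Runs Γ w recKernelBody σ (fun t _ τ => t ≤ recKernelBody.size + (T + 1) ∧
      KernelOutput τ N m a b ∧ τ 6 = s ∧ ∀ i, 17 ≤ i → i < s → τ i = σ i) := by
  obtain ⟨M, hM⟩ : ∃ M, M = (a % m * N + b % m) / m := ⟨_, rfl⟩
  have hYZ : 64 + 2 * Y ≤ Y ^ 10 := by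
    have : 2 ^ 9 ≤ Y ^ 9 := Nat.pow_le_pow_left hY 9
    rw [pow_succ]; nlinarith
  have hMN : M ≤ N := hM ▸ floor_le_of_reduced hm
  have hbm := Nat.mod_lt b hm
  have ham := Nat.mod_lt a hm
  have hsZ : s + 4 ≤ ((Y ^ 10 : ℕ) : ℤ) := by
    have : ((64 + 2 * Y : ℕ) : ℤ) ≤ ((Y ^ 10 : ℕ) : ℤ) := by exact_mod_cast hYZ
    push_cast at this ⊢
    omega
  generalize hZ : Y ^ 10 = Z at hW hYZ hsZ
  have cm := abs_natCast_le (show m ≤ Z by omega)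
  have cam := abs_natCast_le (show a % m ≤ Z by omega)
  have cbm := abs_natCast_le (show b % m ≤ Z by omega)
  have cM := abs_natCast_le (show M ≤ Z by omega)
  have cs : |s| ≤ (Z : ℤ) := by rw [abs_of_nonneg (by omega)]; omega
  have cs4 : |s + 4| ≤ (Z : ℤ) := by rw [abs_of_nonneg (by omega)]; omega
  rw [← hM] at hrec
  -- The body has no loop, so only the cost of the recursive call has to be tracked.
  suffices h : Runs Γ w recKernelBody σ (fun _ L τ => callCost L ≤ T + 1 ∧
      KernelOutput τ N m a b ∧ τ 6 = s ∧ ∀ i, 17 ≤ i → i < s → τ i = σ i) by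
    refine (h.with_cost (by decide)).mono fun t L τ h => ⟨?_, h.2.2⟩
    have := h.1
    have := h.2.1
    omega
  refine Runs.seq ((kernelHead_runs hW hm hin h6 hs (by omega) (by omega) (by omega)
    (by omega) (by omega) (by omega)).mono ?_)
  rintro _ L₁ σ₁ ⟨rfl, k1, k6, k7, k8, k9, ks, ks1, ks2, ks3, kfr⟩
  rw [← hM] at k9 ks3
  -- Both branches end in the same situation: the answer for the exchanged query is in the cells `0,
  -- …, 5` and the frame at `s` is intact.
  have tail : ∀ (L : List CallRecord) (σ₂ : Memory), callCost L ≤ T + 1 →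
      KernelOutput σ₂ M (a % m) m (m - b % m + a % m - 1) → σ₂ 6 = s →
      (∀ i, 17 ≤ i → i < s + 4 → σ₂ i = σ₁ i) →
      Runs Γ w kernelTail σ₂ (fun _ L' τ => callCost ([] ++ (L ++ L')) ≤ T + 1 ∧
        KernelOutput τ N m a b ∧ τ 6 = s ∧ ∀ i, 17 ≤ i → i < s → τ i = σ i) := by
    intro L σ₂ hL hK h6' hfr
    refine (kernelTail_runs hW hm hM hK (by omega) (by omega) ?_ ?_ ?_ ?_ (by omega)
      ((Nat.div_le_self _ _).trans (by omega)) ((Nat.div_le_self _ _).trans (by omega))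
      (by omega) ?_ ?_).mono ?_
    · rw [h6', hfr _ (by omega) (by omega), ks]
    · rw [h6', hfr _ (by omega) (by omega), ks1]
    · rw [h6', hfr _ (by omega) (by omega), ks2]
    · rw [h6', hfr _ (by omega) (by omega), ks3]
    · intro p q hpq
      rw [← hZ]
      exact floorMoment_le (by omega) (by omega) (by omega) hY hpq
    · intro p q hpq
      rw [← hZ]
      exact floorMoment_le hN ha hb hY hpq
    · rintro _ L' τ ⟨rfl, hout, hτ⟩
      refine ⟨by simpa using hL, hout, by rw [hτ 6 (Or.inr rfl), h6'], fun i hi his => ?_⟩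
      rw [hτ i (Or.inl hi), hfr i hi (by omega), kfr i hi his]
  refine Runs.seq (Runs.ite hW (by simp)
    (by simp only [Expr.safe_cell, k9]; exact ⟨by norm_num, cM⟩) (by decide) ?_ ?_)
  · intro hc
    have hM1 : 1 ≤ M := by simpa [k9] using hc
    have ham1 : 1 ≤ a % m := floor_pos_imp hm (hM ▸ hM1)
    refine Runs.seq (Runs.set hW (M : ℤ) (by simp [k9])
      (by simp only [Expr.safe_cell, k9]; exact ⟨by norm_num, cM⟩) (by decide) ?_)
    refine Runs.seq (Runs.set hW ((m - b % m + a % m - 1 : ℕ) : ℤ)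
      (by simp [k1, k7, k8]; omega)
      (by simp only [Expr.safe_sub, Expr.safe_add, Expr.safe_cell, Expr.safe_one,
            Function.update_of_ne, ne_eq, OfNat.ofNat_ne_zero, one_ne_zero,
            not_false_eq_true, k1, k7, k8]
          exact ⟨⟨⟨⟨by norm_num, cm⟩, by norm_num, cbm⟩, by norm_num, cam⟩, trivial⟩)
      (by decide) ?_)
    refine Runs.seq (Runs.set hW (m : ℤ) (by simp [k1])
      (by simp only [Expr.safe_cell]; simpa [k1] using cm) (by decide) ?_)
    refine Runs.seq (Runs.set hW ((a % m : ℕ) : ℤ) (by simp [k7])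
      (by simp only [Expr.safe_cell]; simpa [k7] using cam) (by decide) ?_)
    refine Runs.seq (Runs.set hW (s + 4) (by simp [k6])
      (by simp [k6, cs]) (by decide) ?_)
    refine Runs.seq (Runs.call hΓ ((hrec hM1 _ ⟨by simp, by simp, by simp, by simp⟩
      (by simp)).mono ?_))
    rintro t _ τ ⟨ht, hout, hτ6, hτ⟩
    refine Runs.set hW s (by simp [hτ6]) (by simp [hτ6, cs4]) (by decide) ?_
    refine tail _ _ (by simpa using ht) ?_ (by simp) fun i hi his => ?_
    · simpa [KernelOutput] using hout
    · rw [Function.update_of_ne (by omega), hτ i hi his]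
      simp (disch := omega) only [Function.update_of_ne]
  · intro hc
    -- The exchanged query has an empty range, so zeros are the right answer. A call must be avoided
    -- here because its modulus `a % m` may be `0`.
    have hM0 : M = 0 := by
      simp only [Expr.eval_cell, k9, Expr.eval_one] at hc
      omega
    refine Runs.seq (Runs.set hW 0 (by simp) (by simp) (by decide) ?_)
    refine Runs.seq (Runs.set hW 0 (by simp) (by simp) (by decide) ?_)
    refine Runs.seq (Runs.set hW 0 (by simp) (by simp) (by decide) ?_)
    refine Runs.seq (Runs.set hW 0 (by simp) (by simp) (by decide) ?_)
    refine Runs.seq (Runs.set hW 0 (by simp) (by simp) (by decide) ?_)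
    refine Runs.set hW 0 (by simp) (by simp) (by decide) ?_
    refine tail _ _ (by simp) ?_ (by simp [k6]) fun i hi his => ?_
    · subst hM0
      simp [KernelOutput, floorMoment]
    · simp (disch := omega) only [Function.update_of_ne]

/-! ### Depth of the Euclidean recursion. -/

/-- Since `r < m`, the quotient is at least 1, so `2 (m % r) ≤ m % r + r ≤ m`. The product of two
consecutive terms of the Euclidean algorithm thus at least halves; this bounds the kernel recursion
and the gcd loop. -/
theorem mul_mod_halves {m r k : ℕ} (hr : 1 ≤ r) (hrm : r < m) (h : m * r < 2 ^ (k + 1)) :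
    r * (m % r) < 2 ^ k := by
  have h1 := Nat.mod_lt m hr
  have h2 := Nat.mod_add_div m r
  have h3 : 1 ≤ m / r := (Nat.one_le_div_iff hr).2 hrm.le
  have h4 : r * 1 ≤ r * (m / r) := Nat.mul_le_mul_left r h3
  have h5 : 2 * (m % r) ≤ m := by omega
  have h6 : r * (2 * (m % r)) ≤ r * m := Nat.mul_le_mul_left r h5
  rw [pow_succ] at h
  nlinarith

/-- The recursive procedure is correct; each level costs `O(1)`, and the number of levels is
at most `k + 1` if `m * (a % m) < 2 ^ k`. -/
theorem recKernelBody_runs {Γ : Program} {w Y : ℕ} (hΓ : Γ[4]? = some recKernelBody)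
    (hY : 2 ≤ Y) (hW : WordBound w (Y ^ 10)) :
    ∀ (k N m a b : ℕ) (σ : Memory) (s : ℤ), 1 ≤ m → N ≤ Y → 2 * m ≤ Y → a ≤ Y → b ≤ Y →
      m * (a % m) < 2 ^ k → KernelInput σ N m a b → σ 6 = s → 64 ≤ s →
      s + 4 * m ≤ 64 + 2 * Y →
      Runs Γ w recKernelBody σ (fun t _ τ => t ≤ (k + 1) * (recKernelBody.size + 1) ∧
        KernelOutput τ N m a b ∧ τ 6 = s ∧ ∀ i, 17 ≤ i → i < s → τ i = σ i) := by
  intro k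
  induction k with
  | zero =>
    intro N m a b σ s hm hN hmY ha hb hk hin h6 hs hsY
    -- `m * (a % m) < 1` forces `a % m = 0`, so there is no recursive call and `T = 0` is allowed.
    refine (recKernelBody_step (T := 0) hΓ hY hW hm hN hmY ha hb hin h6 hs hsY ?_).mono ?_
    · intro hM
      have := floor_pos_imp hm hM
      have : 1 * 1 ≤ m * (a % m) := Nat.mul_le_mul hm this
      omega
    · rintro t L τ ⟨ht, h⟩
      exact ⟨by omega, h⟩
  | succ k ih =>
    intro N m a b σ s hm hN hmY ha hb hk hin h6 hs hsY
    refine (recKernelBody_step (T := (k + 1) * (recKernelBody.size + 1)) hΓ hY hW hm hN hmY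
      ha hb hin h6 hs hsY ?_).mono ?_
    · intro hM σ' hin' h6'
      have h1 := floor_pos_imp hm hM
      have h2 := Nat.mod_lt a hm
      have h3 := floor_le_of_reduced (N := N) (a := a) (b := b) hm
      have h4 := Nat.mod_lt b hm
      -- The stack pointer rises by 4 while the modulus drops by at least 1, so `s + 4 * m` does not
      -- increase. The new intercept is below `2 * m`, which is why `2 * m ≤ Y` is carried along.
      exact ih _ _ _ _ σ' (s + 4) h1 (by omega) (by omega) (by omega) (by omega)
        (mul_mod_halves h1 h2 hk) hin' h6' (by omega) (by omega)
    · rintro t L τ ⟨ht, h⟩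
      exact ⟨by linarith, h⟩

/-- The six-moment kernel. -/
def kernelBody : Stmt := Stmt.set 6 64 ;; Stmt.call 4

/-- The cost of the kernel per unit of `1 + log m`. -/
def kernelCost : ℕ := 3 * (recKernelBody.size + 1) + kernelBody.size + 1

/-- Both `m` and `a % m` are below `2 ^ (Nat.log 2 m + 1)`, so the recursion depth is at most twice
this exponent plus 1. The stack starts at cell `64`, above all named variables. -/
theorem kernelBody_runs {Γ : Program} {w Y : ℕ} (hΓ : Γ[4]? = some recKernelBody)
    (hY : 2 ≤ Y) (hW : WordBound w (Y ^ 10)) {N m a b : ℕ} {σ : Memory} (hm : 1 ≤ m)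
    (hN : N ≤ Y) (hmY : 2 * m ≤ Y) (ha : a ≤ Y) (hb : b ≤ Y) (hin : KernelInput σ N m a b) :
    Runs Γ w kernelBody σ (fun t _ τ => t ≤ kernelCost * (Nat.log 2 m + 1) ∧
      KernelOutput τ N m a b ∧ ∀ i, 17 ≤ i → i < 64 → τ i = σ i) := by
  have hlog : m * (a % m) < 2 ^ (2 * (Nat.log 2 m + 1)) := by
    have h1 : m < 2 ^ (Nat.log 2 m + 1) := Nat.lt_pow_succ_log_self (by norm_num) m
    have h2 := Nat.mod_lt a hm
    rw [two_mul, pow_add]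
    exact Nat.mul_lt_mul'' h1 (h2.trans h1)
  suffices h : Runs Γ w kernelBody σ (fun _ L τ =>
      callCost L ≤ (2 * (Nat.log 2 m + 1) + 1) * (recKernelBody.size + 1) + 1 ∧
      KernelOutput τ N m a b ∧ ∀ i, 17 ≤ i → i < 64 → τ i = σ i) by
    refine (h.with_cost (by decide)).mono ?_
    rintro t L τ ⟨h1, h2, h3⟩
    refine ⟨?_, h3⟩
    rw [kernelCost]
    nlinarith [Nat.zero_le (Nat.log 2 m), Nat.zero_le (kernelBody.size),
      Nat.zero_le (recKernelBody.size),
      mul_nonneg (Nat.zero_le (Nat.log 2 m)) (Nat.zero_le (kernelBody.size)),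
      mul_nonneg (Nat.zero_le (Nat.log 2 m)) (Nat.zero_le (recKernelBody.size))]
  refine Runs.seq (Runs.set hW 64 (by simp) (by simp) (by decide) ?_)
  obtain ⟨h0, h1, h2, h3⟩ := hin
  refine Runs.call hΓ ((recKernelBody_runs hΓ hY hW (2 * (Nat.log 2 m + 1)) N m a b _ 64 hm hN
    hmY ha hb hlog ⟨by simpa using h0, by simpa using h1, by simpa using h2, by simpa using h3⟩
    (by simp) le_rfl (by omega)).mono ?_)
  rintro t L τ ⟨ht, hout, -, hfr⟩
  refine ⟨by simpa using ht, hout, fun i hi hi' => ?_⟩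
  rw [hfr i hi hi', Function.update_of_ne (by omega)]

/-! ## One direction -/

open Expr in
/-- The contribution of one direction, with `n, u, v, ⌊n/(u+v)⌋` in the cells `20, …, 23`, from
the answer of the kernel in the cells `0, …, 5`. -/
def directionExpr : Expr :=
  (4 * (cell 21 * cell 22 * (2 * cell 5 + 3 * cell 3 + cell 0) +
        3 * (cell 21 * cell 21 + cell 22 * cell 22) *
          ((cell 23 * cell 3 - cell 4) + (cell 23 * cell 0 - cell 1)) -
        3 * cell 20 * (cell 21 + cell 22) * (cell 3 + cell 0) +
        6 * (cell 20 * cell 20 * cell 0 -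
          cell 20 * (cell 21 + cell 22) * (cell 23 * cell 0 - cell 1) +
          cell 21 * cell 22 *
            (cell 23 * cell 23 * cell 0 - 2 * cell 23 * cell 1 + cell 2))) +
      (12 * cell 20 * cell 20 * cell 23 -
        (6 * cell 20 * (cell 21 + cell 22) + 2 * cell 21 * cell 22 +
          12 * (cell 20 * cell 20)) * (cell 23 * (cell 23 + 1)) +
        (2 * cell 21 * cell 22 + 6 * cell 20 * (cell 21 + cell 22)) *
          (cell 23 * (cell 23 + 1) * (2 * cell 23 + 1)) -
        (8 * cell 21 * cell 22 + 3 * (cell 21 * cell 21 + cell 22 * cell 22)) *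
          (cell 23 * (cell 23 + 1) * (cell 23 * (cell 23 + 1))))) / 6

theorem eval_directionExpr {σ : Memory} {n u v : ℕ} (hu : 1 ≤ u)
    (hK : KernelOutput σ (n / (u + v)) u v (n - n / (u + v) * v)) (h20 : σ 20 = n)
    (h21 : σ 21 = u) (h22 : σ 22 = v) (h23 : σ 23 = (n / (u + v) : ℕ)) :
    directionExpr.eval σ = directionContribution n u v := by
  obtain ⟨k0, k1, k2, k3, k4, k5⟩ := hK
  have h := six_mul_directionContribution hu (n := n) (v := v) rfl k0 k1 k2 k3 k4 k5
  simp only [directionExpr, Expr.eval_add, Expr.eval_mul, Expr.eval_sub, Expr.eval_div,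
    Expr.eval_cell, Expr.eval_ofNat, Expr.eval_one, h20, h21, h22, h23]
  rw [← h]
  simp

open Stmt Expr in
/-- Computes the contribution of one direction. -/
def directionBody : Stmt :=
  set 20 (cell 0) ;; set 21 (cell 1) ;; set 22 (cell 2) ;;
  set 23 (cell 20 / (cell 21 + cell 22)) ;;
  Stmt.ite 1 (cell 23)
    (set 0 (cell 23) ;; set 1 (cell 21) ;; set 2 (cell 22) ;;
      set 3 (cell 20 - cell 23 * cell 22) ;; Stmt.call 0 ;; set 0 directionExpr)
    (set 0 0)

/-- The query costs `O(1 + log u)`, and `u` may exceed `n`. In that case `⌊n/(u+v)⌋ = 0`, the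
contribution vanishes and no query is made; otherwise `u ≤ n`. So the bound in terms of `log n`
holds for all directions. -/
theorem directionBody_runs {Γ : Program} {w Y : ℕ} (hΓ : Γ[4]? = some recKernelBody)
    (hΓ0 : Γ[0]? = some kernelBody) (hY : 2 ≤ Y) (hW : WordBound w (Y ^ 10)) {n u v : ℕ}
    {σ : Memory} (hv : 1 ≤ v) (hvu : v ≤ u) (hn : n ≤ Y) (huY : 2 * u ≤ Y)
    (h0 : σ 0 = n) (h1 : σ 1 = u) (h2 : σ 2 = v) :
    Runs Γ w directionBody σ (fun t L τ => t ≤ directionBody.size + callCost L ∧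
      L.length ≤ 1 ∧ (∀ r ∈ L, r.IsKernelQuery) ∧
      callCost L ≤ kernelCost * (Nat.log 2 n + 1) + 1 ∧ τ 0 = directionContribution n u v ∧
      ∀ i, 24 ≤ i → i < 64 → τ i = σ i) := by
  have hYZ : Y ≤ Y ^ 10 := Nat.le_self_pow (by norm_num) Y
  have hdiv : n / (u + v) ≤ n := Nat.div_le_self _ _
  have cn := abs_natCast_le (hn.trans hYZ)
  have cu := abs_natCast_le (show u ≤ Y ^ 10 by omega)
  have cv := abs_natCast_le (show v ≤ Y ^ 10 by omega)
  have cY := abs_natCast_le (show n / (u + v) ≤ Y ^ 10 by omega)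
  have hmom : ∀ p q, p + q ≤ 3 →
      |(floorMoment p q (n / (u + v)) u v (n - n / (u + v) * v) : ℤ)| ≤ ((Y ^ 10 : ℕ) : ℤ) :=
    fun p q hpq => abs_natCast_le
      (floorMoment_le (by omega) (by omega) ((Nat.sub_le _ _).trans hn) hY hpq)
  refine Runs.with_cost (by decide) ?_
  generalize hZ : Y ^ 10 = Z at *
  refine Runs.seq (Runs.set hW (n : ℤ) (by simp [h0])
    (by simp only [Expr.safe_cell, h0]; exact ⟨by norm_num, cn⟩) (by decide) ?_)
  refine Runs.seq (Runs.set hW (u : ℤ) (by simp [h1])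
    (by simp [h1]; omega) (by decide) ?_)
  refine Runs.seq (Runs.set hW (v : ℤ) (by simp [h2])
    (by simp [h2]; omega) (by decide) ?_)
  refine Runs.seq (Runs.set hW ((n / (u + v) : ℕ) : ℤ) (by simp) (by simp; omega)
    (by decide) ?_)
  refine Runs.ite hW (by simp)
    (by simp only [Expr.safe_cell, Function.update_self]; exact ⟨by norm_num, cY⟩)
    (by decide) ?_ ?_
  · intro hc
    have hY1 : 1 ≤ n / (u + v) := by
      simp only [Expr.eval_cell, Expr.eval_one, Function.update_self] at hc
      exact_mod_cast hc
    have hun : u ≤ n := by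
      have := (Nat.le_div_iff_mul_le (by omega)).1 hY1
      omega
    have hYv : n / (u + v) * v ≤ n := (Nat.mul_le_mul_left _ (by omega)).trans
      (Nat.div_mul_le_self n (u + v))
    have hYv' : (((n - n / (u + v) * v : ℕ)) : ℤ) = n - (n / (u + v) : ℕ) * v := by
      push_cast [Nat.cast_sub hYv]; ring
    refine Runs.seq (Runs.set hW ((n / (u + v) : ℕ) : ℤ) (by simp)
      (by simp only [Expr.safe_cell, Function.update_self]; exact ⟨by norm_num, cY⟩)
      (by decide) ?_)
    refine Runs.seq (Runs.set hW (u : ℤ) (by simp) (by simp; omega) (by decide) ?_)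
    refine Runs.seq (Runs.set hW (v : ℤ) (by simp) (by simp; omega) (by decide) ?_)
    refine Runs.seq (Runs.set hW ((n - n / (u + v) * v : ℕ) : ℤ)
      (by rw [hYv']; simp)
      (by simp only [Expr.safe_cell, Expr.safe_sub, Expr.safe_mul]
          simp only [Function.update_self, Function.update_of_ne, ne_eq, OfNat.ofNat_ne_zero,
            OfNat.ofNat_ne_one, not_false_eq_true, Nat.reduceEqDiff, OfNat.ofNat_eq_ofNat]
          exact ⟨⟨by norm_num, cn⟩, ⟨by norm_num, cY⟩, by norm_num, cv⟩) (by decide) ?_)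
    have hin : KernelInput (Function.update (Function.update (Function.update (Function.update
        (Function.update (Function.update (Function.update (Function.update σ 20 n) 21 u) 22 v)
        23 (n / (u + v) : ℕ)) 0 (n / (u + v) : ℕ)) 1 u) 2 v) 3 (n - n / (u + v) * v : ℕ))
        (n / (u + v)) u v (n - n / (u + v) * v) := ⟨by simp, by simp, by simp, by simp⟩
    refine Runs.seq (Runs.call hΓ0 ((kernelBody_runs hΓ hY (hZ ▸ hW) (by omega) (by omega) huY
      (by omega) ((Nat.sub_le _ _).trans hn) hin).mono ?_))
    rintro t L τ ⟨ht, hout, hfr⟩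
    have e20 : τ 20 = n := by rw [hfr 20 (by norm_num) (by norm_num)]; simp
    have e21 : τ 21 = u := by rw [hfr 21 (by norm_num) (by norm_num)]; simp
    have e22 : τ 22 = v := by rw [hfr 22 (by norm_num) (by norm_num)]; simp
    have e23 : τ 23 = (n / (u + v) : ℕ) := by rw [hfr 23 (by norm_num) (by norm_num)]; simp
    refine Runs.set hW (directionContribution n u v)
      (eval_directionExpr (by omega) hout e20 e21 e22 e23) ?_ (by decide) ?_
    · refine Expr.safe_of_simpleOn (l := [0, 1, 2, 3, 4, 5, 20, 21, 22, 23]) ?_ (by decide)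
      obtain ⟨k0, k1, k2, k3, k4, k5⟩ := hout
      simp only [List.forall_mem_cons, k0, k1, k2, k3, k4, k5, e20, e21, e22, e23]
      exact ⟨hmom 0 1 (by norm_num), hmom 1 1 (by norm_num), hmom 2 1 (by norm_num),
        hmom 0 2 (by norm_num), hmom 1 2 (by norm_num), hmom 0 3 (by norm_num), cn, cu, cv, cY,
        by simp⟩
    · refine ⟨by simp, ?_, ?_, by simp, fun i hi hi' => ?_⟩
      · intro r hr
        simp only [List.nil_append, List.append_nil, List.mem_singleton] at hr
        subst hr
        exact ⟨rfl, _, _, _, _, by omega, hin, hout⟩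
      · have : Nat.log 2 u ≤ Nat.log 2 n := Nat.log_mono_right hun
        have := Nat.mul_le_mul_left kernelCost (Nat.add_le_add_right this 1)
        simp only [List.nil_append, List.append_nil, callCost_cons, callCost_nil]
        omega
      · rw [Function.update_of_ne (by omega), hfr i (by omega) hi']
        simp (disch := omega) only [Function.update_of_ne]
  · intro hc
    have hY0 : n / (u + v) = 0 := by
      simp only [Expr.eval_cell, Expr.eval_one, Function.update_self] at hc
      exact Nat.lt_one_iff.1 (by exact_mod_cast hc)
    have hc0 : directionContribution n u v = 0 := by
      rw [directionContribution_eq_sum n u v (by omega), hY0]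
      simp
    refine Runs.set hW 0 (by simp) (by simp) (by decide) ?_
    refine ⟨by simp, by simp, by simp, by simp [hc0], fun i hi hi' => ?_⟩
    simp (disch := omega) only [Function.update_of_ne]

open ArithmeticFunction.Moebius

/-! ## Coprime prefix sums -/

theorem sum_divisors_moebius (k : ℕ) :
    ∑ d ∈ k.divisors, μ d = if k = 1 then 1 else 0 := by
  rw [← ArithmeticFunction.coe_zeta_mul_apply, ArithmeticFunction.coe_zeta_mul_moebius,
    ArithmeticFunction.one_apply]

theorem sum_Icc_filter_dvd (X d : ℕ) (hd : 1 ≤ d) (f : ℕ → ℤ) :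
    ∑ v ∈ (Finset.Icc 1 X).filter (d ∣ ·), f v = ∑ e ∈ Finset.Icc 1 (X / d), f (d * e) := by
  refine Finset.sum_nbij' (fun v => v / d) (fun e => d * e) ?_ ?_ ?_ ?_ ?_
  · rintro v hv
    simp only [Finset.mem_filter, Finset.mem_Icc] at hv ⊢
    exact ⟨Nat.div_pos (Nat.le_of_dvd (by omega) hv.2) hd, Nat.div_le_div_right hv.1.2⟩
  · rintro e he
    simp only [Finset.mem_filter, Finset.mem_Icc] at he ⊢
    rw [Nat.le_div_iff_mul_le hd] at he
    exact ⟨⟨Nat.mul_pos hd he.1, by rw [mul_comm]; exact he.2⟩, dvd_mul_right _ _⟩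
  · rintro v hv
    exact Nat.mul_div_cancel' (Finset.mem_filter.1 hv).2
  · rintro e _
    exact Nat.mul_div_cancel_left e hd
  · rintro v hv
    rw [Nat.mul_div_cancel' (Finset.mem_filter.1 hv).2]

/-- The indicator of `gcd(u,v) = 1` is the sum of `μ d` over the common divisors `d` of `u` and `v`.
Exchange the sums and write `v = d e`. -/
theorem coprimePrefix_eq_sum_divisors (j u X : ℕ) (hu : 1 ≤ u) :
    coprimePrefix j u X =
      ∑ d ∈ u.divisors, μ d * ((d : ℤ) ^ j * ∑ e ∈ Finset.Icc 1 (X / d), (e : ℤ) ^ j) := by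
  have h1 : coprimePrefix j u X = ∑ v ∈ Finset.Icc 1 X, ∑ d ∈ u.divisors,
      if d ∣ v then μ d * (v : ℤ) ^ j else 0 := by
    rw [coprimePrefix, Finset.sum_filter]
    refine Finset.sum_congr rfl fun v hv => ?_
    rw [Finset.mem_Icc] at hv
    have hg : Nat.gcd u v ≠ 0 := (Nat.gcd_pos_of_pos_left v hu).ne'
    have h2 : u.divisors.filter (· ∣ v) = (Nat.gcd u v).divisors := by
      ext d
      simp only [Finset.mem_filter, Nat.mem_divisors, Nat.dvd_gcd_iff]
      constructor
      · rintro ⟨⟨h, _⟩, h'⟩; exact ⟨⟨h, h'⟩, hg⟩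
      · rintro ⟨⟨h, h'⟩, _⟩; exact ⟨⟨h, by omega⟩, h'⟩
    rw [← Finset.sum_filter, h2, ← Finset.sum_mul, sum_divisors_moebius]
    split_ifs <;> simp
  rw [h1, Finset.sum_comm]
  refine Finset.sum_congr rfl fun d hd => ?_
  have hd' : 1 ≤ d := Nat.pos_of_mem_divisors hd
  rw [← Finset.sum_filter, sum_Icc_filter_dvd X d hd' (fun v => μ d * (v : ℤ) ^ j),
    ← Finset.mul_sum, Finset.mul_sum (a := (d : ℤ) ^ j)]
  congr 1
  exact Finset.sum_congr rfl fun e _ => by push_cast; ring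

/-- The divisors of `u` that are at most `D`, in increasing order. -/
def divisorList (D u : ℕ) : List ℕ := (List.range' 1 D).filter (· ∣ u)

theorem divisorList_succ (D u : ℕ) :
    divisorList (D + 1) u = divisorList D u ++ if D + 1 ∣ u then [D + 1] else [] := by
  rw [divisorList, List.range'_1_concat, List.filter_append, divisorList, add_comm 1 D]
  congr 1
  split_ifs with h <;> simp [h]

theorem mem_divisorList {D u x : ℕ} : x ∈ divisorList D u ↔ (1 ≤ x ∧ x ≤ D) ∧ x ∣ u := by
  simp only [divisorList, List.mem_filter, List.mem_range'_1, decide_eq_true_eq]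
  constructor <;> rintro ⟨⟨h1, h2⟩, h3⟩ <;> exact ⟨⟨h1, by omega⟩, h3⟩

theorem length_divisorList_le (D u : ℕ) : (divisorList D u).length ≤ D := by
  simpa [divisorList] using List.length_filter_le (fun x => decide (x ∣ u)) (List.range' 1 D)

theorem toFinset_divisorList {D u : ℕ} (hu : 1 ≤ u) (hD : u ≤ D) :
    (divisorList D u).toFinset = u.divisors := by
  ext x
  rw [List.mem_toFinset, mem_divisorList, Nat.mem_divisors]
  constructor
  · rintro ⟨_, h⟩; exact ⟨h, by omega⟩
  · rintro ⟨h, _⟩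
    exact ⟨⟨Nat.pos_of_dvd_of_pos h hu, (Nat.le_of_dvd hu h).trans hD⟩, h⟩

theorem nodup_divisorList (D u : ℕ) : (divisorList D u).Nodup :=
  (List.nodup_range').filter _

theorem sum_map_divisorList {D u : ℕ} (hu : 1 ≤ u) (hD : u ≤ D) (f : ℕ → ℤ) :
    ((divisorList D u).map f).sum = ∑ d ∈ u.divisors, f d := by
  rw [← toFinset_divisorList hu hD, List.sum_toFinset f (nodup_divisorList D u)]

theorem length_divisorList {D u : ℕ} (hu : 1 ≤ u) (hD : u ≤ D) :
    (divisorList D u).length = u.divisors.card := by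
  rw [← toFinset_divisorList hu hD, List.toFinset_card_of_nodup (nodup_divisorList D u)]

theorem sum_map_take_succ {α : Type*} (l : List α) (f : α → ℤ) {k : ℕ} (hk : k < l.length) :
    ((l.take (k + 1)).map f).sum = ((l.take k).map f).sum + f l[k] := by
  rw [List.take_add_one, List.getElem?_eq_getElem hk, List.map_append, List.sum_append]
  simp only [Option.toList_some, List.map_cons, List.map_nil, List.sum_cons, List.sum_nil,
    add_zero]

/-- The cell number `i` of the row of `u` in the divisor table. The cell `0` holds the number of
divisors found so far, the cells `1, 2, …` hold these divisors, the cell `n + 1` the sum of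
their Möbius values, and the cell `n + 2` the Möbius value of `u`. -/
def rowAddr (n u i : ℕ) : ℤ := 64 + u * (n + 3) + i

/-- The row of `u` in the divisor table is correct for the divisors up to `D`. -/
structure RowData (σ : Memory) (n u D : ℕ) : Prop where
  count : σ (rowAddr n u 0) = (divisorList D u).length
  entry : ∀ i (hi : i < (divisorList D u).length),
    σ (rowAddr n u (i + 1)) = (divisorList D u)[i]
  total : σ (rowAddr n u (n + 1)) = ((divisorList D u).map (fun d => μ d)).sum

/-- The divisor table up to `n` is complete. -/
def TableData (σ : Memory) (n : ℕ) : Prop :=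
  ∀ u, 1 ≤ u → u ≤ n → RowData σ n u n ∧ σ (rowAddr n u (n + 2)) = μ u

open Stmt Expr in
/-- The contribution of one divisor to the prefix sums. -/
def prefixStep : Stmt :=
  set 7 (read (cell 2 + cell 3)) ;;
  set 8 (read (64 + cell 7 * (cell 30 + 3) + (cell 30 + 2))) ;;
  set 9 (cell 1 / cell 7) ;;
  set 4 (cell 4 + cell 8 * cell 9) ;;
  set 5 (cell 5 + cell 8 * (cell 7 * (cell 9 * (cell 9 + 1) / 2))) ;;
  set 6 (cell 6 + cell 8 * (cell 7 * cell 7 * (cell 9 * (cell 9 + 1) * (2 * cell 9 + 1) / 6))) ;;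
  set 3 (cell 3 + 1)

open Stmt Expr in
/-- Sums over the divisors in the row of `u`. -/
def prefixLoop : Stmt := Stmt.loop (cell 3) (read (cell 2)) prefixStep

open Stmt Expr in
/-- Initializes the summation over the divisors. -/
def prefixInit : Stmt :=
  set 2 (64 + cell 0 * (cell 30 + 3)) ;; set 3 1 ;; set 4 0 ;; set 5 0 ;; set 6 0

open Stmt Expr in
/-- Computes the coprime prefix sums; `n` is in cell `30`. -/
def prefixBody : Stmt :=
  prefixInit ;; prefixLoop ;;
  (set 0 (cell 4) ;; set 1 (cell 5) ;; set 2 (cell 6))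

theorem two_mul_sum_Icc_id (q : ℕ) : 2 * ∑ e ∈ Finset.Icc 1 q, (e : ℤ) = q * (q + 1) := by
  induction q with
  | zero => simp
  | succ q ih => rw [Finset.sum_Icc_succ_top (by omega), mul_add, ih]; push_cast; ring

theorem six_mul_sum_Icc_sq (q : ℕ) :
    6 * ∑ e ∈ Finset.Icc 1 q, (e : ℤ) ^ 2 = q * (q + 1) * (2 * q + 1) := by
  induction q with
  | zero => simp
  | succ q ih => rw [Finset.sum_Icc_succ_top (by omega), mul_add, ih]; push_cast; ring

/-- The summand of the divisor `d` in the coprime prefix sum. -/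
def prefixTerm (j X d : ℕ) : ℤ := μ d * ((d : ℤ) ^ j * ∑ e ∈ Finset.Icc 1 (X / d), (e : ℤ) ^ j)

theorem abs_prefixTerm_le {n j X d : ℕ} (hX : X ≤ n) (hj : j ≤ 2) :
    |prefixTerm j X d| ≤ ((n + 2) ^ 3 : ℕ) := by
  rw [prefixTerm, abs_mul]
  have h1 : |μ d| ≤ 1 := ArithmeticFunction.abs_moebius_le_one
  have h2 : d ^ j * ∑ e ∈ Finset.Icc 1 (X / d), e ^ j ≤ (n + 2) ^ 3 := by
    have h3 : ∀ e ∈ Finset.Icc 1 (X / d), d ^ j * e ^ j ≤ (n + 2) ^ 2 := by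
      intro e he
      rw [← mul_pow]
      have : d * e ≤ n + 2 := (Nat.mul_le_mul_left d (Finset.mem_Icc.1 he).2).trans
        ((Nat.mul_div_le X d).trans (by omega))
      exact (Nat.pow_le_pow_left this j).trans (Nat.pow_le_pow_right (by omega) hj)
    rw [Finset.mul_sum]
    refine (Finset.sum_le_card_nsmul _ _ _ h3).trans ?_
    rw [Nat.card_Icc, smul_eq_mul, pow_succ (n + 2) 2, mul_comm]
    refine Nat.mul_le_mul_left _ ?_
    have := Nat.div_le_self X d
    omega
  have h4 : |(d : ℤ) ^ j * ∑ e ∈ Finset.Icc 1 (X / d), (e : ℤ) ^ j| ≤ ((n + 2) ^ 3 : ℕ) := by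
    rw [abs_of_nonneg (by positivity)]
    exact_mod_cast h2
  calc |μ d| * _ ≤ 1 * _ := mul_le_mul h1 h4 (abs_nonneg _) (by norm_num)
    _ = _ := one_mul _

theorem abs_sum_take_prefixTerm_le {n j X u k : ℕ} (hX : X ≤ n) (hj : j ≤ 2) :
    |(((divisorList n u).take k).map (prefixTerm j X)).sum| ≤ ((n + 2) ^ 4 : ℕ) := by
  have h : ∀ l : List ℕ, |(l.map (prefixTerm j X)).sum| ≤ l.length * ((n + 2) ^ 3 : ℕ) := by
    intro l
    induction l with
    | nil => simp
    | cons d l ih =>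
      rw [List.map_cons, List.sum_cons, List.length_cons]
      refine (abs_add_le _ _).trans ((add_le_add (abs_prefixTerm_le hX hj) ih).trans ?_)
      push_cast
      linarith
  refine (h _).trans ?_
  have h1 : ((divisorList n u).take k).length ≤ n + 2 :=
    (List.length_take_le' _ _).trans ((length_divisorList_le n u).trans (by omega))
  have h2 := Nat.mul_le_mul_right ((n + 2) ^ 3) h1
  rw [← pow_succ'] at h2
  exact_mod_cast h2

theorem coprimePrefix_eq_sum_list {n j u X : ℕ} (hu : 1 ≤ u) (hun : u ≤ n) :
    coprimePrefix j u X = ((divisorList n u).map (prefixTerm j X)).sum := by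
  rw [sum_map_divisorList hu hun, coprimePrefix_eq_sum_divisors j u X hu]
  rfl

/-- The three quantities are the last address of the divisor table, a bound for the prefix sums, and
a bound for loop variables. -/
theorem table_bound {n Z : ℕ} (hZ : (n + 2) ^ 10 ≤ Z) :
    64 + n * (n + 3) + (n + 2) ≤ Z ∧ (n + 2) ^ 4 ≤ Z ∧ n + 2 ≤ Z := by
  have h1 : 2 ^ 6 ≤ (n + 2) ^ 6 := Nat.pow_le_pow_left (by omega) 6
  have h2 : 1 ≤ (n + 2) ^ 2 := Nat.one_le_pow _ _ (by omega)
  have h3 : (n + 2) ^ 10 = (n + 2) ^ 6 * (n + 2) ^ 4 := by rw [← pow_add]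
  have h4 : (n + 2) ^ 4 ≤ (n + 2) ^ 10 := Nat.pow_le_pow_right (by omega) (by norm_num)
  have h5 : n + 2 ≤ (n + 2) ^ 4 := Nat.le_self_pow (by norm_num) _
  have h6 : 16 ≤ (n + 2) ^ 4 := by
    calc 16 = 2 ^ 4 := by norm_num
      _ ≤ _ := Nat.pow_le_pow_left (by omega) 4
  have h7 : (n + 2) ^ 2 ≤ (n + 2) ^ 4 := Nat.pow_le_pow_right (by omega) (by norm_num)
  refine ⟨?_, h4.trans hZ, (h5.trans h4).trans hZ⟩
  nlinarith

theorem rowAddr_bounds {n Z : ℕ} (hZ : (n + 2) ^ 10 ≤ Z) {u i : ℕ} (hu : u ≤ n)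
    (hi : i ≤ n + 2) : 64 ≤ rowAddr n u i ∧ |rowAddr n u i| ≤ (Z : ℤ) := by
  obtain ⟨hZ1, -, -⟩ := table_bound hZ
  have h1 : 64 + u * (n + 3) + i ≤ 64 + n * (n + 3) + (n + 2) :=
    Nat.add_le_add (Nat.add_le_add_left (Nat.mul_le_mul_right _ hu) _) hi
  have e : rowAddr n u i = ((64 + u * (n + 3) + i : ℕ) : ℤ) := by
    simp only [rowAddr]; push_cast; ring
  rw [e]
  exact ⟨by push_cast; nlinarith [Int.natCast_nonneg u, Int.natCast_nonneg n,
    mul_nonneg (Int.natCast_nonneg u) (Int.natCast_nonneg n), Int.natCast_nonneg i],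
    abs_natCast_le (by omega)⟩

/-- The Möbius value is read from the row of the divisor `d` itself, so one divisor takes `O(1)`
steps. Cell `3` holds `k + 1`, not `k`, because the first cell of a row holds the count. -/
theorem prefixStep_runs {Γ : Program} {w Z n u X k : ℕ} (hW : WordBound w Z)
    (hZ : (n + 2) ^ 10 ≤ Z) {σ : Memory} (hT : TableData σ n) (hu : 1 ≤ u) (hun : u ≤ n)
    (hX : X ≤ n) (hk : k < (divisorList n u).length) (h1 : σ 1 = X)
    (h2 : σ 2 = rowAddr n u 0) (h3 : σ 3 = k + 1) (h30 : σ 30 = n)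
    (h4 : σ 4 = (((divisorList n u).take k).map (prefixTerm 0 X)).sum)
    (h5 : σ 5 = (((divisorList n u).take k).map (prefixTerm 1 X)).sum)
    (h6 : σ 6 = (((divisorList n u).take k).map (prefixTerm 2 X)).sum) :
    Runs Γ w prefixStep σ (fun t L τ => t ≤ prefixStep.size ∧ L = [] ∧
      τ 3 = k + 1 + 1 ∧
      τ 4 = (((divisorList n u).take (k + 1)).map (prefixTerm 0 X)).sum ∧
      τ 5 = (((divisorList n u).take (k + 1)).map (prefixTerm 1 X)).sum ∧
      τ 6 = (((divisorList n u).take (k + 1)).map (prefixTerm 2 X)).sum ∧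
      ∀ i, (i < 3 ∨ 10 ≤ i) → τ i = σ i) := by
  obtain ⟨hZ1, hZ2, hZ3⟩ := table_bound hZ
  suffices h : Runs Γ w prefixStep σ (fun _ L τ => L = [] ∧
      τ 3 = k + 1 + 1 ∧
      τ 4 = (((divisorList n u).take (k + 1)).map (prefixTerm 0 X)).sum ∧
      τ 5 = (((divisorList n u).take (k + 1)).map (prefixTerm 1 X)).sum ∧
      τ 6 = (((divisorList n u).take (k + 1)).map (prefixTerm 2 X)).sum ∧
      ∀ i, (i < 3 ∨ 10 ≤ i) → τ i = σ i) by
    refine (h.with_cost (by decide)).mono ?_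
    rintro t L τ ⟨ht, rfl, h⟩
    exact ⟨by simpa using ht, rfl, h⟩
  obtain ⟨d, hd⟩ : ∃ d, d = (divisorList n u)[k] := ⟨_, rfl⟩
  have hmem : d ∈ divisorList n u := hd ▸ List.getElem_mem hk
  rw [mem_divisorList] at hmem
  obtain ⟨⟨hd1, hdn⟩, -⟩ := hmem
  have hlen := length_divisorList_le n u
  have hrow : rowAddr n u 0 + (k + 1) = rowAddr n u (k + 1) := by
    simp only [rowAddr]; push_cast; ring
  have hmu : 64 + (d : ℤ) * (n + 3) + (n + 2) = rowAddr n d (n + 2) := by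
    simp only [rowAddr]; push_cast; ring
  have r1 := rowAddr_bounds hZ (u := u) (i := 0) hun (by omega)
  have r2 := rowAddr_bounds hZ (u := u) (i := k + 1) hun (by omega)
  have r3 := rowAddr_bounds hZ (u := d) (i := n + 2) hdn (by omega)
  have e1 : σ (rowAddr n u (k + 1)) = d := by rw [(hT u hu hun).1.entry k hk, ← hd]
  have e2 : σ (rowAddr n d (n + 2)) = μ d := (hT d hd1 hdn).2
  have hq : X / d ≤ n := (Nat.div_le_self _ _).trans hX
  have cd := abs_natCast_le (show d ≤ Z by omega)
  have cn := abs_natCast_le (show n ≤ Z by omega)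
  have cq := abs_natCast_le (show X / d ≤ Z by omega)
  have ck := abs_natCast_le (show k + 1 ≤ Z by omega)
  push_cast at ck
  have cX := abs_natCast_le (show X ≤ Z by omega)
  have cmu : |μ d| ≤ (Z : ℤ) := ArithmeticFunction.abs_moebius_le_one.trans (by omega)
  have hZ2' : (((n + 2) ^ 4 : ℕ) : ℤ) ≤ Z := by exact_mod_cast hZ2
  have c4 := (abs_sum_take_prefixTerm_le (u := u) (k := k) hX (show 0 ≤ 2 by omega)).trans hZ2'
  have c5 := (abs_sum_take_prefixTerm_le (u := u) (k := k) hX (show 1 ≤ 2 by omega)).trans hZ2'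
  have c6 := (abs_sum_take_prefixTerm_le (u := u) (k := k) hX (show 2 ≤ 2 by omega)).trans hZ2'
  rw [sum_map_take_succ _ _ hk, sum_map_take_succ _ _ hk, sum_map_take_succ _ _ hk, ← hd]
  generalize hs4 : (((divisorList n u).take k).map (prefixTerm 0 X)).sum = s4 at *
  generalize hs5 : (((divisorList n u).take k).map (prefixTerm 1 X)).sum = s5 at *
  generalize hs6 : (((divisorList n u).take k).map (prefixTerm 2 X)).sum = s6 at *
  refine Runs.seq (Runs.set hW (d : ℤ) (by simp [h2, h3, hrow, e1])
    (by simp only [Expr.safe_read, Expr.safe_cell, Expr.safe_add, Expr.eval_add,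
          Expr.eval_cell, h2, h3, hrow, e1]
        exact ⟨⟨⟨by norm_num, r1.2⟩, by norm_num, ck⟩, by omega, cd⟩) (by decide) ?_)
  refine Runs.seq (Runs.set hW (μ d)
    (by simp (disch := omega) only [Expr.eval_read, Expr.eval_add, Expr.eval_mul,
          Expr.eval_cell, Expr.eval_ofNat, Function.update_self, Function.update_of_ne, h30,
          hmu, e2])
    (by simp (disch := omega) only [Expr.safe_read, Expr.safe_cell, Expr.safe_add,
          Expr.safe_mul, Expr.safe_ofNat, Expr.eval_add, Expr.eval_mul,
          Expr.eval_cell, Expr.eval_ofNat, Function.update_self, Function.update_of_ne, h30,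
          hmu, e2]
        exact ⟨⟨⟨trivial, ⟨by norm_num, cd⟩, ⟨by norm_num, cn⟩, trivial⟩, ⟨by norm_num, cn⟩,
          trivial⟩, by omega, cmu⟩)
    (by decide) ?_)
  refine Runs.seq (Runs.set hW ((X / d : ℕ) : ℤ) (by simp [h1])
    (by simp only [Expr.safe_div, Expr.safe_cell]; simp [h1]; omega) (by decide) ?_)
  have q1 : ((X / d : ℕ) : ℤ) * ((X / d : ℕ) + 1) / 2 =
      ∑ e ∈ Finset.Icc 1 (X / d), (e : ℤ) := by
    rw [← two_mul_sum_Icc_id]; simp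
  have q2 : ((X / d : ℕ) : ℤ) * ((X / d : ℕ) + 1) * (2 * (X / d : ℕ) + 1) / 6 =
      ∑ e ∈ Finset.Icc 1 (X / d), (e : ℤ) ^ 2 := by
    rw [← six_mul_sum_Icc_sq]; simp
  generalize hq' : X / d = q at *
  refine Runs.seq (Runs.set hW (s4 + prefixTerm 0 X d) (by simp [h4, prefixTerm, hq'])
    (by simp only [Expr.safe_add, Expr.safe_cell, Expr.safe_mul]
        simp [h4, c4, cmu]; omega) (by decide) ?_)
  refine Runs.seq (Runs.set hW (s5 + prefixTerm 1 X d)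
    (by simp [h5, prefixTerm, hq', q1])
    (by refine Expr.safe_of_simpleOn (l := [5, 7, 8, 9]) ?_ (by decide)
        simp [h5, c5, cmu]; omega) (by decide) ?_)
  refine Runs.seq (Runs.set hW (s6 + prefixTerm 2 X d)
    (by simp [h6, prefixTerm, hq', q2, pow_two])
    (by refine Expr.safe_of_simpleOn (l := [6, 7, 8, 9]) ?_ (by decide)
        simp [h6, c6, cmu]; omega) (by decide) ?_)
  refine Runs.set hW ((k : ℤ) + 1 + 1) (by simp [h3]) (by simp [h3, ck]) (by decide) ?_
  refine ⟨rfl, by simp, by simp, by simp, by simp, fun i hi => ?_⟩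
  simp (disch := omega) only [Function.update_of_ne]

theorem TableData.congr {σ τ : Memory} {n : ℕ} (h : TableData σ n)
    (hτ : ∀ i, 64 ≤ i → τ i = σ i) : TableData τ n := by
  have h64 : ∀ u i : ℕ, 64 ≤ rowAddr n u i := fun u i => by
    simp only [rowAddr]
    nlinarith [Int.natCast_nonneg u, Int.natCast_nonneg n,
      mul_nonneg (Int.natCast_nonneg u) (Int.natCast_nonneg n), Int.natCast_nonneg i]
  intro u hu hun
  obtain ⟨⟨h1, h2, h3⟩, h4⟩ := h u hu hun
  exact ⟨⟨by rw [hτ _ (h64 _ _), h1], fun i hi => by rw [hτ _ (h64 _ _), h2 i hi],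
    by rw [hτ _ (h64 _ _), h3]⟩, by rw [hτ _ (h64 _ _), h4]⟩

/-- The cost of the prefix-sum procedure per divisor. -/
def prefixCost : ℕ := prefixStep.size + prefixBody.size + 20

/-- For `u ≤ n` the row of `u` contains all divisors of `u`, so the number of iterations is exactly
`τ(u)`. -/
theorem prefixLoop_runs {Γ : Program} {w Z n u X : ℕ} (hW : WordBound w Z)
    (hZ : (n + 2) ^ 10 ≤ Z) {σ : Memory} (hT : TableData σ n) (hu : 1 ≤ u) (hun : u ≤ n)
    (hX : X ≤ n) (h1 : σ 1 = X) (h2 : σ 2 = rowAddr n u 0) (h3 : σ 3 = 1) (h30 : σ 30 = n)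
    (h4 : σ 4 = 0) (h5 : σ 5 = 0) (h6 : σ 6 = 0) :
    Runs Γ w prefixLoop σ (fun t L τ =>
      t ≤ u.divisors.card * (6 + prefixStep.size) + 6 ∧ L = [] ∧
      τ 4 = coprimePrefix 0 u X ∧ τ 5 = coprimePrefix 1 u X ∧ τ 6 = coprimePrefix 2 u X ∧
      ∀ i, (i < 3 ∨ 10 ≤ i) → τ i = σ i) := by
  obtain ⟨hZ1, hZ2, hZ3⟩ := table_bound hZ
  have hlen := length_divisorList_le n u
  have r1 := rowAddr_bounds hZ (u := u) (i := 0) hun (by omega)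
  refine Runs.loop hW (by decide) (divisorList n u).length
    (fun k t L σ' => t ≤ k * (6 + prefixStep.size) ∧ L = [] ∧ σ' 3 = k + 1 ∧
      σ' 4 = (((divisorList n u).take k).map (prefixTerm 0 X)).sum ∧
      σ' 5 = (((divisorList n u).take k).map (prefixTerm 1 X)).sum ∧
      σ' 6 = (((divisorList n u).take k).map (prefixTerm 2 X)).sum ∧
      ∀ i, (i < 3 ∨ 10 ≤ i) → σ' i = σ i) ?_ ?_ ?_ ?_
  · simp [h3, h4, h5, h6]
  · rintro k t L σ' hk ⟨-, -, g3, -, -, -, gfr⟩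
    have e2 : σ' 2 = rowAddr n u 0 := by rw [gfr 2 (by omega), h2]
    have ec : σ' (rowAddr n u 0) = (divisorList n u).length := by
      rw [gfr _ (by omega), (hT u hu hun).1.count]
    simp only [Expr.safe_cell, Expr.safe_read, Expr.eval_cell, Expr.eval_read, g3, e2, ec]
    have ck := abs_natCast_le (show k + 1 ≤ Z by omega)
    push_cast at ck
    exact ⟨⟨by norm_num, ck⟩, ⟨⟨by norm_num, r1.2⟩, by omega, abs_natCast_le (by omega)⟩,
      by omega⟩
  · rintro k t L σ' hk ⟨ht, rfl, g3, g4, g5, g6, gfr⟩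
    refine (prefixStep_runs hW hZ (hT.congr fun i hi => gfr i (by omega)) hu hun hX hk
      (by rw [gfr 1 (by omega), h1]) (by rw [gfr 2 (by omega), h2]) g3
      (by rw [gfr 30 (by omega), h30]) g4 g5 g6).mono ?_
    rintro t' L' τ ⟨ht', rfl, k3, k4, k5, k6, kfr⟩
    refine ⟨?_, rfl, by rw [k3]; push_cast; ring, k4, k5, k6, fun i hi => ?_⟩
    · simp only [Expr.cell, Expr.cost, add_mul, one_mul]
      omega
    · rw [kfr i hi, gfr i hi]
  · rintro t L σ' ⟨ht, rfl, -, g4, g5, g6, gfr⟩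
    rw [List.take_length] at g4 g5 g6
    rw [length_divisorList hu hun] at ht
    simp only [coprimePrefix_eq_sum_list hu hun]
    refine ⟨?_, trivial, g4, g5, g6, gfr⟩
    simp only [Expr.cell, Expr.cost]
    omega

theorem prefixBody_runs {Γ : Program} {w Z n u X : ℕ} (hW : WordBound w Z)
    (hZ : (n + 2) ^ 10 ≤ Z) {σ : Memory} (hT : TableData σ n) (hu : 1 ≤ u) (hun : u ≤ n)
    (hX : X ≤ n) (h0 : σ 0 = u) (h1 : σ 1 = X) (h30 : σ 30 = n) :
    Runs Γ w prefixBody σ (fun t _ τ => t + 1 ≤ prefixCost * u.divisors.card ∧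
      τ 0 = coprimePrefix 0 u X ∧ τ 1 = coprimePrefix 1 u X ∧ τ 2 = coprimePrefix 2 u X ∧
      ∀ i, 10 ≤ i → τ i = σ i) := by
  obtain ⟨hZ1, hZ2, hZ3⟩ := table_bound hZ
  have cu := abs_natCast_le (show u ≤ Z by omega)
  have cn := abs_natCast_le (show n ≤ Z by omega)
  have hrow : 64 + (u : ℤ) * (n + 3) = rowAddr n u 0 := by simp [rowAddr]
  have init : Runs Γ w prefixInit σ (fun _ L τ => L = [] ∧ τ 1 = X ∧ τ 2 = rowAddr n u 0 ∧
      τ 3 = 1 ∧ τ 4 = 0 ∧ τ 5 = 0 ∧ τ 6 = 0 ∧ ∀ i, 10 ≤ i → τ i = σ i) := by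
    refine Runs.seq (Runs.set hW (rowAddr n u 0) (by simp [h0, h30, hrow])
      (by simp [h0, h30]; omega) (by decide) ?_)
    refine Runs.seq (Runs.set hW 1 (by simp) (by simp) (by decide) ?_)
    refine Runs.seq (Runs.set hW 0 (by simp) (by simp) (by decide) ?_)
    refine Runs.seq (Runs.set hW 0 (by simp) (by simp) (by decide) ?_)
    refine Runs.set hW 0 (by simp) (by simp) (by decide) ?_
    refine ⟨rfl, by simp [h1], by simp, by simp, by simp, by simp, by simp, fun i hi => ?_⟩
    simp (disch := omega) only [Function.update_of_ne]
  refine Runs.seq ((init.with_cost (by decide)).mono ?_)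
  rintro t₁ L₁ σ₁ ⟨ht₁, rfl, k1, k2, k3, k4, k5, k6, kfr⟩
  refine Runs.seq ((prefixLoop_runs hW hZ (hT.congr fun i hi => kfr i (by omega)) hu hun hX k1
    k2 k3 (by rw [kfr 30 (by norm_num), h30]) k4 k5 k6).mono ?_)
  rintro t₂ L₂ σ₂ ⟨ht₂, rfl, g4, g5, g6, gfr⟩
  have hZ2' : (((n + 2) ^ 4 : ℕ) : ℤ) ≤ Z := by exact_mod_cast hZ2
  have bound : ∀ j, j ≤ 2 → |coprimePrefix j u X| ≤ (Z : ℤ) := by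
    intro j hj
    rw [coprimePrefix_eq_sum_list hu hun, ← List.take_length (l := divisorList n u)]
    exact (abs_sum_take_prefixTerm_le hX hj).trans hZ2'
  refine (Runs.with_cost (by decide) (Q := fun _ L τ => L = [] ∧ τ 0 = coprimePrefix 0 u X ∧
    τ 1 = coprimePrefix 1 u X ∧ τ 2 = coprimePrefix 2 u X ∧ ∀ i, 10 ≤ i → τ i = σ i) ?_).mono ?_
  · refine Runs.seq (Runs.set hW _ (by simpa using g4)
      (by simp [g4, bound 0]) (by decide) ?_)
    refine Runs.seq (Runs.set hW _ (by simpa using g5)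
      (by simp [g5, bound 1]) (by decide) ?_)
    refine Runs.set hW _ (by simpa using g6) (by simp [g6, bound 2]) (by decide) ?_
    refine ⟨rfl, by simp, by simp, by simp, fun i hi => ?_⟩
    simp (disch := omega) only [Function.update_of_ne]
    rw [gfr i (by omega), kfr i hi]
  · rintro t₃ L₃ τ ⟨ht₃, rfl, h⟩
    refine ⟨?_, h⟩
    -- `τ(u) ≥ 1` absorbs the costs that do not depend on `u`.
    have hc : 1 ≤ u.divisors.card := Finset.card_pos.2 ⟨u, Nat.mem_divisors_self u (by omega)⟩
    have hsize : t₁ + t₃ + 2 ≤ prefixBody.size + 2 := by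
      simp only [callCost_nil, add_zero] at ht₁ ht₃
      simp only [prefixBody, prefixLoop, Stmt.size] at ht₁ ht₃ ⊢
      omega
    have h2 := Nat.mul_le_mul_left (prefixBody.size + 14) hc
    have h3 : prefixCost * u.divisors.card = u.divisors.card * (6 + prefixStep.size) +
      (prefixBody.size + 14) * u.divisors.card := by rw [prefixCost]; ring
    omega

/-! ## The divisor table -/

open Stmt Expr in
/-- Enters the divisor `d` (cell `33`) with Möbius value in cell `36` into the row of its
multiple in cell `34`, and passes to the next multiple. -/
def sieveStep : Stmt :=
  set 35 (64 + cell 34 * (cell 30 + 3)) ;;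
  Stmt.assign (cell 35) (read (cell 35) + 1) ;;
  Stmt.assign (cell 35 + read (cell 35)) (cell 33) ;;
  Stmt.assign (cell 35 + (cell 30 + 1)) (read (cell 35 + (cell 30 + 1)) + cell 36) ;;
  set 34 (cell 34 + cell 33)

open Stmt Expr in
/-- Enters the divisor in cell `33` into the rows of all its multiples. -/
def sieveInner : Stmt := Stmt.loop (cell 34) (cell 30) sieveStep

open Stmt Expr in
/-- Computes the Möbius value of the number in cell `33`. -/
def sieveMoebius : Stmt :=
  set 36 (1 / cell 33 - read (64 + cell 33 * (cell 30 + 3) + (cell 30 + 1))) ;;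
  Stmt.assign (64 + cell 33 * (cell 30 + 3) + (cell 30 + 2)) (cell 36) ;;
  set 34 (cell 33)

open Stmt Expr in
/-- The treatment of one divisor. -/
def sieveStage : Stmt := sieveMoebius ;; sieveInner ;; set 33 (cell 33 + 1)

open Stmt Expr in
/-- Computes the divisor table. -/
def sieve : Stmt := set 33 1 ;; Stmt.loop (cell 33) (cell 30) sieveStage

theorem rowAddr_eq_add (n u i : ℕ) : rowAddr n u i = rowAddr n u 0 + i := by
  simp [rowAddr]

theorem le_rowAddr (n u i : ℕ) : 64 ≤ rowAddr n u i := by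
  simp only [rowAddr]
  nlinarith [Int.natCast_nonneg u, Int.natCast_nonneg n,
    mul_nonneg (Int.natCast_nonneg u) (Int.natCast_nonneg n), Int.natCast_nonneg i]

/-- Rows have `n + 3` cells each, so distinct rows do not overlap. -/
theorem rowAddr_disjoint {n u x i : ℕ} (hx : x ≠ u) (hi : i ≤ n + 2) :
    rowAddr n x i < rowAddr n u 0 ∨ rowAddr n u 0 + (n + 2) < rowAddr n x i := by
  simp only [rowAddr]
  rcases Nat.lt_or_gt_of_ne hx with h | h
  · left
    have : (x : ℤ) + 1 ≤ u := by exact_mod_cast h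
    have : ((x : ℤ) + 1) * (n + 3) ≤ u * (n + 3) := mul_le_mul_of_nonneg_right this (by positivity)
    have : (i : ℤ) ≤ n + 2 := by exact_mod_cast hi
    push_cast
    linarith
  · right
    have : (u : ℤ) + 1 ≤ x := by exact_mod_cast h
    have : ((u : ℤ) + 1) * (n + 3) ≤ x * (n + 3) := mul_le_mul_of_nonneg_right this (by positivity)
    push_cast
    linarith [Int.natCast_nonneg i]

theorem RowData.congr {σ τ : Memory} {n u D : ℕ} (h : RowData σ n u D) (hD : D ≤ n)
    (hτ : ∀ i, i ≤ n + 1 → τ (rowAddr n u i) = σ (rowAddr n u i)) : RowData τ n u D := by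
  have hlen := length_divisorList_le D u
  exact ⟨by rw [hτ _ (by omega), h.count], fun i hi => by rw [hτ _ (by omega), h.entry i hi],
    by rw [hτ _ (by omega), h.total]⟩

theorem RowData.of_not_dvd {σ : Memory} {n u D : ℕ} (h : RowData σ n u D)
    (hD : ¬ D + 1 ∣ u) : RowData σ n u (D + 1) := by
  have e : divisorList (D + 1) u = divisorList D u := by rw [divisorList_succ, if_neg hD]; simp
  obtain ⟨h1, h2, h3⟩ := h
  exact ⟨by rw [e]; exact h1, fun i hi => by simp only [e] at hi ⊢; exact h2 i hi,
    by rw [e]; exact h3⟩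

theorem abs_sum_moebius_le (l : List ℕ) : |(l.map (fun d => μ d)).sum| ≤ l.length := by
  induction l with
  | nil => simp
  | cons d l ih =>
    rw [List.map_cons, List.sum_cons, List.length_cons]
    have := ArithmeticFunction.abs_moebius_le_one (n := d)
    refine (abs_add_le _ _).trans ?_
    push_cast
    linarith

/-- The counter is increased first, so that it points to the first free entry. A row with divisors
up to `D` has at most `D < n` entries, hence the new one stays clear of the cell `n + 1` for the
Möbius sum. -/
theorem sieveStep_runs {Γ : Program} {w Z n u D : ℕ} (hW : WordBound w Z)
    (hZ : (n + 2) ^ 10 ≤ Z) {σ : Memory} (hun : u ≤ n) (hDu : D + 1 ∣ u) (hDn : D + 1 ≤ n)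
    (hrow : RowData σ n u D) (h30 : σ 30 = n) (h33 : σ 33 = (D + 1 : ℕ)) (h34 : σ 34 = u)
    (h36 : σ 36 = μ (D + 1)) :
    Runs Γ w sieveStep σ (fun t L τ => t ≤ sieveStep.size ∧ L = [] ∧
      τ 34 = (u + (D + 1) : ℕ) ∧ RowData τ n u (D + 1) ∧
      (∀ x i, i ≤ n + 2 → (x ≠ u ∨ i = n + 2) → τ (rowAddr n x i) = σ (rowAddr n x i)) ∧
      ∀ i, (i < 34 ∨ i = 36) → τ i = σ i) := by
  obtain ⟨hZ1, hZ2, hZ3⟩ := table_bound hZ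
  suffices h : Runs Γ w sieveStep σ (fun _ L τ => L = [] ∧
      τ 34 = (u + (D + 1) : ℕ) ∧ RowData τ n u (D + 1) ∧
      (∀ x i, i ≤ n + 2 → (x ≠ u ∨ i = n + 2) → τ (rowAddr n x i) = σ (rowAddr n x i)) ∧
      ∀ i, (i < 34 ∨ i = 36) → τ i = σ i) by
    refine (h.with_cost (by decide)).mono ?_
    rintro t L τ ⟨ht, rfl, h⟩
    exact ⟨by simpa using ht, rfl, h⟩
  obtain ⟨R, hR⟩ : ∃ R, R = rowAddr n u 0 := ⟨_, rfl⟩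
  have r1 := rowAddr_bounds hZ (u := u) (i := 0) hun (by omega)
  have hrowR : 64 + (u : ℤ) * (n + 3) = R := by simp [hR, rowAddr]
  obtain ⟨q1, q2, q3⟩ := hrow
  have hadd : ∀ i, rowAddr n u i = R + i := fun i => by rw [hR]; exact rowAddr_eq_add n u i
  rw [← hR] at r1 q1
  obtain ⟨l, hl⟩ : ∃ l, l = (divisorList D u).length := ⟨_, rfl⟩
  have hlD : l ≤ D := hl ▸ length_divisorList_le D u
  have htot := abs_sum_moebius_le (divisorList D u)
  rw [← hl] at q1 htot
  rw [hadd] at q3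
  push_cast at q3
  obtain ⟨s, hs⟩ : ∃ s, s = ((divisorList D u).map (fun d => μ d)).sum := ⟨_, rfl⟩
  rw [← hs] at q3 htot
  have cu := abs_natCast_le (show u ≤ Z by omega)
  have cn := abs_natCast_le (show n ≤ Z by omega)
  have cD := abs_natCast_le (show D + 1 ≤ Z by omega)
  have cl := abs_natCast_le (show l ≤ Z by omega)
  have cl1 := abs_natCast_le (show l + 1 ≤ Z by omega)
  have cs : |s| ≤ (Z : ℤ) := htot.trans (by omega)
  have cmu : |μ (D + 1)| ≤ (Z : ℤ) := ArithmeticFunction.abs_moebius_le_one.trans (by omega)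
  push_cast at cl1
  refine Runs.seq (Runs.set hW R (by simp [h34, h30, hrowR])
    (by simp [h34, h30]; omega) (by decide) ?_)
  refine Runs.seq (Runs.assign hW ((l : ℤ) + 1) R (by simp)
    (by simp (disch := omega) only [Expr.eval_add, Expr.eval_read, Expr.eval_cell,
      Expr.eval_one, Function.update_self, Function.update_of_ne, q1])
    (by omega) (by simp [r1.2])
    (by simp (disch := omega) only [Expr.safe_add, Expr.safe_read, Expr.safe_cell,
          Expr.safe_one, Expr.eval_cell, Function.update_self, Function.update_of_ne, q1]
        exact ⟨⟨⟨by norm_num, r1.2⟩, by omega, cl⟩, trivial⟩) (by decide) ?_)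
  refine Runs.seq (Runs.assign hW ((D + 1 : ℕ) : ℤ) (R + ((l : ℤ) + 1))
    (by simp (disch := omega) only [Expr.eval_add, Expr.eval_read, Expr.eval_cell,
      Function.update_self, Function.update_of_ne])
    (by simp (disch := omega) only [Expr.eval_cell, Function.update_of_ne, h33])
    (by omega)
    (by simp (disch := omega) only [Expr.safe_add, Expr.safe_read, Expr.safe_cell,
          Expr.eval_cell, Function.update_self, Function.update_of_ne]
        exact ⟨⟨by norm_num, r1.2⟩, ⟨by norm_num, r1.2⟩, by omega, cl1⟩)
    (by simp (disch := omega) only [Expr.safe_cell, Function.update_of_ne, h33]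
        exact ⟨by norm_num, cD⟩) (by decide) ?_)
  refine Runs.seq (Runs.assign hW (s + μ (D + 1)) (R + ((n : ℤ) + 1))
    (by simp (disch := omega) only [Expr.eval_add, Expr.eval_cell, Expr.eval_one,
      Function.update_self, Function.update_of_ne, h30])
    (by simp (disch := omega) only [Expr.eval_add, Expr.eval_read, Expr.eval_cell,
      Expr.eval_one, Function.update_self, Function.update_of_ne, h30, h36, q3])
    (by omega)
    (by simp (disch := omega) only [Expr.safe_add, Expr.safe_cell, Expr.safe_one,
          Function.update_self, Function.update_of_ne, h30]
        exact ⟨⟨by norm_num, r1.2⟩, ⟨by norm_num, cn⟩, trivial⟩)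
    (by simp (disch := omega) only [Expr.safe_add, Expr.safe_read, Expr.safe_cell,
          Expr.safe_one, Expr.eval_add, Expr.eval_cell, Expr.eval_one, Function.update_self,
          Function.update_of_ne, h30, h36, q3]
        exact ⟨⟨⟨⟨by norm_num, r1.2⟩, ⟨by norm_num, cn⟩, trivial⟩, by omega, cs⟩, by norm_num,
          cmu⟩) (by decide) ?_)
  refine Runs.set hW ((u + (D + 1) : ℕ) : ℤ)
    (by simp (disch := omega) only [Expr.eval_add, Expr.eval_cell, Function.update_of_ne,
          h33, h34]
        push_cast; ring)
    (by simp (disch := omega) only [Expr.safe_add, Expr.safe_cell, Function.update_of_ne,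
          h33, h34]
        exact ⟨⟨by norm_num, cu⟩, by norm_num, cD⟩) (by decide) ?_
  have hsucc : divisorList (D + 1) u = divisorList D u ++ [D + 1] := by
    rw [divisorList_succ, if_pos hDu]
  refine ⟨rfl, by simp, ⟨?_, fun i hi => ?_, ?_⟩, fun x i hi hx => ?_, fun i hi => ?_⟩
  · rw [← hR, hsucc, List.length_append, ← hl]
    simp (disch := omega) only [Function.update_of_ne, Function.update_self]
    simp
  · simp only [hsucc, List.length_append, ← hl, List.length_singleton] at hi
    simp only [hsucc]
    rw [hadd]
    rcases Nat.lt_or_ge i l with h | h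
    · rw [List.getElem_append_left (by omega), ← q2 i (by omega), hadd]
      push_cast
      simp (disch := omega) only [Function.update_of_ne]
    · obtain rfl : i = l := by omega
      rw [List.getElem_append_right (by omega)]
      push_cast
      simp (disch := omega) only [Function.update_of_ne, Function.update_self]
      simp
  · rw [hadd, hsucc, List.map_append, List.sum_append, ← hs]
    push_cast
    simp (disch := omega) only [Function.update_of_ne, Function.update_self]
    simp
  · have hlx := le_rowAddr n x i
    by_cases hxu : x = u
    · obtain rfl : i = n + 2 := hx.resolve_left (by simpa using hxu)
      subst hxu
      rw [hadd]
      push_cast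
      simp (disch := omega) only [Function.update_of_ne]
    · have := rowAddr_disjoint (n := n) hxu hi
      rw [← hR] at this
      simp (disch := omega) only [Function.update_of_ne]
  · simp (disch := omega) only [Function.update_of_ne]

/-- After `k` iterations the rows up to `k(D+1)` are correct for divisors up to `D + 1` and the
later ones for divisors up to `D`. Rows strictly between two multiples of `D + 1`, or beyond the
last one, are correct without any action. -/
theorem sieveInner_runs {Γ : Program} {w Z n D : ℕ} (hW : WordBound w Z)
    (hZ : (n + 2) ^ 10 ≤ Z) {σ : Memory} (hDn : D + 1 ≤ n)
    (hrow : ∀ x, 1 ≤ x → x ≤ n → RowData σ n x D) (h30 : σ 30 = n)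
    (h33 : σ 33 = (D + 1 : ℕ)) (h34 : σ 34 = (D + 1 : ℕ)) (h36 : σ 36 = μ (D + 1)) :
    Runs Γ w sieveInner σ (fun t L τ => t ≤ n / (D + 1) * (5 + sieveStep.size) + 5 ∧ L = [] ∧
      (∀ x, 1 ≤ x → x ≤ n → RowData τ n x (D + 1)) ∧
      (∀ x, τ (rowAddr n x (n + 2)) = σ (rowAddr n x (n + 2))) ∧
      ∀ i, i < 34 → τ i = σ i) := by
  obtain ⟨hZ1, hZ2, hZ3⟩ := table_bound hZ
  have cn := abs_natCast_le (show n ≤ Z by omega)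
  have hKn : n / (D + 1) * (D + 1) ≤ n := Nat.div_mul_le_self _ _
  have hKn' : n < (n / (D + 1) + 1) * (D + 1) := by
    rw [mul_comm]; exact Nat.lt_mul_div_succ n (by omega)
  refine Runs.loop hW (by decide) (n / (D + 1))
    (fun k t L σ' => t ≤ k * (5 + sieveStep.size) ∧ L = [] ∧ σ' 34 = ((k + 1) * (D + 1) : ℕ) ∧
      (∀ x, 1 ≤ x → x ≤ k * (D + 1) → x ≤ n → RowData σ' n x (D + 1)) ∧
      (∀ x, 1 ≤ x → k * (D + 1) < x → x ≤ n → RowData σ' n x D) ∧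
      (∀ x, σ' (rowAddr n x (n + 2)) = σ (rowAddr n x (n + 2))) ∧
      ∀ i, (i < 34 ∨ i = 36) → σ' i = σ i) ?_ ?_ ?_ ?_
  · refine ⟨by simp, rfl, by simpa using h34, fun x h1 h2 => by omega, fun x h1 _ h3 =>
      hrow x h1 h3, fun _ => rfl, fun _ _ => rfl⟩
  · rintro k t L σ' hk ⟨-, -, g34, -, -, -, gfr⟩
    have h1 : (k + 1) * (D + 1) ≤ n + (D + 1) := by
      have := Nat.mul_le_mul_right (D + 1) hk
      rw [Nat.succ_mul]; omega
    have h2 : n ≤ n * (n + 3) := Nat.le_mul_of_pos_right _ (by omega)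
    have c34 := abs_natCast_le (show (k + 1) * (D + 1) ≤ Z by omega)
    simp only [Expr.safe_cell, Expr.eval_cell, g34, gfr 30 (by omega), h30]
    refine ⟨⟨by norm_num, c34⟩, ⟨by norm_num, cn⟩, ?_⟩
    rw [Nat.cast_le]
    constructor
    · intro h
      exact (Nat.le_div_iff_mul_le (by omega)).2 h
    · intro h
      exact (Nat.mul_le_mul_right (D + 1) (show k + 1 ≤ n / (D + 1) from h)).trans hKn
  · rintro k t L σ' hk ⟨ht, rfl, g34, glow, ghigh, gmu, gfr⟩
    have hu : (k + 1) * (D + 1) ≤ n :=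
      (Nat.mul_le_mul_right (D + 1) (show k + 1 ≤ n / (D + 1) from hk)).trans hKn
    have hsucc : (k + 1) * (D + 1) = k * (D + 1) + (D + 1) := Nat.succ_mul _ _
    refine (sieveStep_runs hW hZ hu (Dvd.intro_left _ rfl) hDn
      (ghigh _ (by omega) (by omega) hu)
      (by rw [gfr 30 (by omega), h30]) (by rw [gfr 33 (by omega), h33]) g34
      (by rw [gfr 36 (by omega), h36])).mono ?_
    rintro t' L' τ ⟨ht', rfl, k34, krow, kother, kfr⟩
    refine ⟨?_, rfl, ?_, fun x h1 h2 h3 => ?_, fun x h1 h2 h3 => ?_, fun x => ?_,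
      fun i hi => by rw [kfr i hi, gfr i hi]⟩
    · simp only [Expr.cell, Expr.cost, add_mul, one_mul]
      omega
    · rw [k34, Nat.succ_mul (k + 1)]
    · by_cases hx : x = (k + 1) * (D + 1)
      · rw [hx]; exact krow
      · refine RowData.congr (σ := σ') ?_ (by omega)
          fun i hi => kother x i (by omega) (Or.inl hx)
        by_cases hxk : x ≤ k * (D + 1)
        · exact glow x h1 hxk h3
        · refine (ghigh x h1 (by omega) h3).of_not_dvd ?_
          rintro ⟨c, rfl⟩
          have h4 : k < c := by
            by_contra h
            have := Nat.mul_le_mul_left (D + 1) (show c ≤ k by omega)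
            rw [mul_comm (D + 1) k] at this
            omega
          have h5 : c < k + 1 := by
            by_contra h
            have := Nat.mul_le_mul_left (D + 1) (show k + 1 ≤ c by omega)
            rw [mul_comm (D + 1) (k + 1)] at this
            omega
          omega
    · exact (ghigh x h1 (by omega) h3).congr (by omega)
        fun i hi => kother x i (by omega) (Or.inl (by omega))
    · rw [kother x (n + 2) le_rfl (Or.inr rfl), gmu]
  · rintro t L σ' ⟨ht, rfl, -, glow, ghigh, gmu, gfr⟩
    refine ⟨?_, rfl, fun x h1 h3 => ?_, gmu, fun i hi => gfr i (by omega)⟩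
    · simp only [Expr.cell, Expr.cost]
      omega
    · by_cases hxk : x ≤ n / (D + 1) * (D + 1)
      · exact glow x h1 hxk h3
      · refine (ghigh x h1 (by omega) h3).of_not_dvd ?_
        rintro ⟨c, rfl⟩
        have := (Nat.le_div_iff_mul_le (Nat.succ_pos D)).2 ((mul_comm _ _).trans_le h3)
        have := Nat.mul_le_mul_left (D + 1) this
        rw [mul_comm (D + 1) (n / (D + 1))] at this
        omega

/-- This is `∑_{d ∣ m} μ(d) = [m = 1]` for `m = D + 1`, solved for the term `d = m`. The floor of
`1/m` is the indicator of `m = 1`, which spares a conditional. -/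
theorem moebius_eq_sub_sum (D : ℕ) :
    (1 : ℤ) / ((D + 1 : ℕ) : ℤ) - ((divisorList D (D + 1)).map (fun d => μ d)).sum =
      μ (D + 1) := by
  have h1 := sum_map_divisorList (D := D + 1) (u := D + 1) (by omega) le_rfl (fun d => μ d)
  rw [sum_divisors_moebius, divisorList_succ, if_pos dvd_rfl, List.map_append,
    List.sum_append] at h1
  simp only [List.map_cons, List.map_nil, List.sum_cons, List.sum_nil, add_zero] at h1
  have h2 : (1 : ℤ) / ((D + 1 : ℕ) : ℤ) = if D + 1 = 1 then 1 else 0 := by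
    split_ifs with h
    · rw [h]; norm_num
    · exact Int.ediv_eq_zero_of_lt (by norm_num) (by omega)
  rw [h2, ← h1]
  ring

/-- When `D + 1` is reached, its row has received precisely its proper divisors, so the stored sum
is the one needed for the recursion of `μ`. -/
theorem sieveMoebius_runs {Γ : Program} {w Z n D : ℕ} (hW : WordBound w Z)
    (hZ : (n + 2) ^ 10 ≤ Z) {σ : Memory} (hDn : D + 1 ≤ n) (hrow : RowData σ n (D + 1) D)
    (h30 : σ 30 = n) (h33 : σ 33 = (D + 1 : ℕ)) :
    Runs Γ w sieveMoebius σ (fun t L τ => t ≤ sieveMoebius.size ∧ L = [] ∧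
      τ 34 = (D + 1 : ℕ) ∧ τ 36 = μ (D + 1) ∧ τ (rowAddr n (D + 1) (n + 2)) = μ (D + 1) ∧
      (∀ x i, i ≤ n + 2 → (x ≠ D + 1 ∨ i ≠ n + 2) → τ (rowAddr n x i) = σ (rowAddr n x i)) ∧
      ∀ i, i < 34 → τ i = σ i) := by
  obtain ⟨hZ1, hZ2, hZ3⟩ := table_bound hZ
  suffices h : Runs Γ w sieveMoebius σ (fun _ L τ => L = [] ∧
      τ 34 = (D + 1 : ℕ) ∧ τ 36 = μ (D + 1) ∧ τ (rowAddr n (D + 1) (n + 2)) = μ (D + 1) ∧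
      (∀ x i, i ≤ n + 2 → (x ≠ D + 1 ∨ i ≠ n + 2) → τ (rowAddr n x i) = σ (rowAddr n x i)) ∧
      ∀ i, i < 34 → τ i = σ i) by
    refine (h.with_cost (by decide)).mono ?_
    rintro t L τ ⟨ht, rfl, h⟩
    exact ⟨by simpa using ht, rfl, h⟩
  have cn := abs_natCast_le (show n ≤ Z by omega)
  have cD := abs_natCast_le (show D + 1 ≤ Z by omega)
  have cmu : |μ (D + 1)| ≤ (Z : ℤ) := ArithmeticFunction.abs_moebius_le_one.trans (by omega)
  have e1 : 64 + ((D + 1 : ℕ) : ℤ) * (n + 3) + (n + 1) = rowAddr n (D + 1) (n + 1) := by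
    simp [rowAddr]
  have e2 : 64 + ((D + 1 : ℕ) : ℤ) * (n + 3) + (n + 2) = rowAddr n (D + 1) (n + 2) := by
    simp [rowAddr]
  have r1 := le_rowAddr n (D + 1) (n + 1)
  have r2 := le_rowAddr n (D + 1) (n + 2)
  have hlen : (divisorList D (D + 1)).length ≤ Z :=
    (length_divisorList_le D (D + 1)).trans (by omega)
  have ctot : |((divisorList D (D + 1)).map (fun d => μ d)).sum| ≤ (Z : ℤ) :=
    (abs_sum_moebius_le _).trans (by exact_mod_cast hlen)
  refine Runs.seq (Runs.set hW (μ (D + 1))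
    (by simp only [Expr.eval_sub, Expr.eval_div, Expr.eval_read, Expr.eval_add, Expr.eval_mul,
          Expr.eval_cell, Expr.eval_ofNat, Expr.eval_one, h30, h33, e1, hrow.total,
          moebius_eq_sub_sum])
    (by simp only [Expr.safe_sub, Expr.safe_div, Expr.safe_read, Expr.safe_add, Expr.safe_mul,
          Expr.safe_cell, Expr.safe_ofNat, Expr.safe_one, Expr.eval_add, Expr.eval_mul,
          Expr.eval_cell, Expr.eval_ofNat, Expr.eval_one, h30, h33, e1, hrow.total]
        exact ⟨⟨trivial, ⟨by norm_num, cD⟩, by omega⟩, ⟨⟨trivial, ⟨by norm_num, cD⟩,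
          ⟨by norm_num, cn⟩, trivial⟩, ⟨by norm_num, cn⟩, trivial⟩, by omega, ctot⟩)
    (by decide) ?_)
  refine Runs.seq (Runs.assign hW (μ (D + 1)) (rowAddr n (D + 1) (n + 2))
    (by simp (disch := omega) only [Expr.eval_add, Expr.eval_mul, Expr.eval_cell,
      Expr.eval_ofNat, Function.update_of_ne, h30, h33, e2])
    (by simp) (by omega)
    (by simp (disch := omega) only [Expr.safe_add, Expr.safe_mul, Expr.safe_cell,
          Expr.safe_ofNat, Function.update_of_ne, h30, h33]
        exact ⟨⟨trivial, ⟨by norm_num, cD⟩, ⟨by norm_num, cn⟩, trivial⟩, ⟨by norm_num, cn⟩,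
          trivial⟩)
    (by simp [cmu]) (by decide) ?_)
  refine Runs.set hW ((D + 1 : ℕ) : ℤ)
    (by simp (disch := omega) only [Expr.eval_cell, Function.update_of_ne, h33])
    (by simp (disch := omega) only [Expr.safe_cell, Function.update_of_ne, h33]
        exact ⟨by norm_num, cD⟩) (by decide) ?_
  refine ⟨rfl, by simp, ?_, ?_, fun x i hi hx => ?_, fun i hi => ?_⟩
  · simp (disch := omega) only [Function.update_of_ne, Function.update_self]
  · simp (disch := omega) only [Function.update_of_ne, Function.update_self]
  · have hlx := le_rowAddr n x i
    have hne : rowAddr n x i ≠ rowAddr n (D + 1) (n + 2) := by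
      by_cases hxu : x = D + 1
      · subst hxu
        have := hx.resolve_left (by simp)
        rw [rowAddr_eq_add n (D + 1) i, rowAddr_eq_add n (D + 1) (n + 2)]
        omega
      · have := rowAddr_disjoint (n := n) hxu hi
        rw [rowAddr_eq_add n (D + 1) (n + 2)]
        push_cast
        omega
    simp (disch := first | omega | exact hne) only [Function.update_of_ne]
  · simp (disch := omega) only [Function.update_of_ne]

/-- The cost of the sieve per entry of the divisor table. -/
def sieveCost : ℕ := 5 + sieveStep.size + sieve.size + 20

/-- The table spans about `n²` cells, too many to initialize within the time bound. Zero memory is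
already a correct table for divisors up to `0`; only `∑ ⌊n/d⌋` divisor entries are then made. -/
theorem sieve_runs {Γ : Program} {w Z n : ℕ} (hW : WordBound w Z)
    (hZ : (n + 2) ^ 10 ≤ Z) {σ : Memory} (h30 : σ 30 = n) (hzero : ∀ i, 64 ≤ i → σ i = 0) :
    Runs Γ w sieve σ (fun t L τ =>
      t ≤ sieveCost * ∑ d ∈ Finset.range n, n / (d + 1) + sieveCost ∧ L = [] ∧
      TableData τ n ∧ ∀ i, i < 33 → τ i = σ i) := by
  obtain ⟨hZ1, hZ2, hZ3⟩ := table_bound hZ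
  have cn := abs_natCast_le (show n ≤ Z by omega)
  refine Runs.seq (Runs.set hW 1 (by simp) (by simp) (by decide) ?_)
  refine Runs.loop hW (by decide) n
    (fun k t L σ' => t ≤ sieveCost * ∑ d ∈ Finset.range k, n / (d + 1) ∧ L = [] ∧
      σ' 33 = (k + 1 : ℕ) ∧ (∀ x, 1 ≤ x → x ≤ n → RowData σ' n x k) ∧
      (∀ x, 1 ≤ x → x ≤ k → σ' (rowAddr n x (n + 2)) = μ x) ∧
      ∀ i, i < 33 → σ' i = σ i) ?_ ?_ ?_ ?_
  · refine ⟨by simp, rfl, by simp, fun x h1 h2 => ?_, fun x h1 h2 => by omega, fun i hi => ?_⟩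
    · have hz : ∀ i, Function.update σ 33 1 (rowAddr n x i) = 0 := fun i => by
        have := le_rowAddr n x i
        rw [Function.update_of_ne (by omega), hzero _ this]
      exact ⟨by rw [hz]; simp [divisorList], fun i hi => by simp [divisorList] at hi,
        by rw [hz]; simp [divisorList]⟩
    · rw [Function.update_of_ne (by omega)]
  · rintro k t L σ' hk ⟨-, -, g33, -, -, gfr⟩
    have ck := abs_natCast_le (show k + 1 ≤ Z by omega)
    simp only [Expr.safe_cell, Expr.eval_cell, g33, gfr 30 (by omega), h30]
    exact ⟨⟨by norm_num, ck⟩, ⟨by norm_num, cn⟩, by rw [Nat.cast_le]; rfl⟩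
  · rintro k t L σ' hk ⟨ht, rfl, g33, grow, gmu, gfr⟩
    refine Runs.seq ((sieveMoebius_runs hW hZ hk (grow _ (by omega) hk)
      (by rw [gfr 30 (by omega), h30]) g33).mono ?_)
    rintro t₁ L₁ σ₁ ⟨ht₁, rfl, k34, k36, kmu, kother, kfr⟩
    refine Runs.seq ((sieveInner_runs hW hZ hk (fun x h1 h2 => (grow x h1 h2).congr (by omega)
      fun i hi => kother x i (by omega) (Or.inr (by omega)))
      (by rw [kfr 30 (by omega), gfr 30 (by omega), h30]) (by rw [kfr 33 (by omega), g33])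
      k34 k36).mono ?_)
    rintro t₂ L₂ σ₂ ⟨ht₂, rfl, lrow, lmu, lfr⟩
    have e33 : σ₂ 33 = (k + 1 : ℕ) := by rw [lfr 33 (by omega), kfr 33 (by omega), g33]
    have ck := abs_natCast_le (show k + 1 ≤ Z by omega)
    refine Runs.set hW ((k + 1 + 1 : ℕ) : ℤ) (by simp [e33])
      (by simp only [Expr.safe_add, Expr.safe_cell, Expr.safe_one, e33]
          exact ⟨⟨by norm_num, ck⟩, trivial⟩) (by decide) ?_
    refine ⟨?_, rfl, by simp, fun x h1 h2 => ?_, fun x h1 h2 => ?_, fun i hi => ?_⟩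
    · rw [Finset.sum_range_succ, mul_add]
      -- The quotient is positive, so it also pays for the fixed cost of the stage.
      have hdiv : 1 ≤ n / (k + 1) := (Nat.one_le_div_iff (by omega)).2 hk
      have h1 : sieveCost * (n / (k + 1)) = n / (k + 1) * (5 + sieveStep.size) +
          (sieve.size + 20) * (n / (k + 1)) := by rw [sieveCost]; ring
      have h2 := Nat.mul_le_mul_left (sieve.size + 20) hdiv
      have h3 : sieveMoebius.size ≤ sieve.size := by
        simp only [sieve, sieveStage, Stmt.size]; omega
      simp only [Expr.cell, Expr.cost]
      omega
    · refine (lrow x h1 h2).congr (by omega) fun i hi => ?_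
      have := le_rowAddr n x i
      rw [Function.update_of_ne (by omega)]
    · have := le_rowAddr n x (n + 2)
      rw [Function.update_of_ne (by omega), lmu]
      by_cases hx : x = k + 1
      · rw [hx]; exact kmu
      · rw [kother x (n + 2) le_rfl (Or.inl hx), gmu x h1 (by omega)]
    · rw [Function.update_of_ne (by omega), lfr i (by omega), kfr i (by omega), gfr i hi]
  · rintro t L σ' ⟨ht, rfl, -, grow, gmu, gfr⟩
    refine ⟨?_, rfl, fun x h1 h2 => ⟨grow x h1 h2, gmu x h1 h2⟩, gfr⟩
    simp only [Expr.cell, Expr.cost, sieveCost] at ht ⊢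
    omega

/-! ## The large directions -/

/-- The calls of the distinguished procedures in the list `L` have the arguments `D` and `P`, are
answered correctly, and satisfy the cost bounds. -/
structure CallsGood (n T : ℕ) (L : List CallRecord) (D : Multiset (ℤ × ℤ × ℤ))
    (P : Multiset (ℤ × ℤ)) : Prop where
  direction_eq : directionCalls L = D
  prefix_eq : prefixCalls L = P
  direction_correct : ∀ r ∈ L, r.proc = directionProc → ∃ u v : ℕ, r.entry 1 = u ∧
    r.entry 2 = v ∧ r.exit 0 = directionContribution n u v ∧ r.cost ≤ T
  prefix_correct : ∀ r ∈ L, r.proc = prefixProc → ∃ u X : ℕ, r.entry 0 = u ∧ r.entry 1 = X ∧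
    r.exit 0 = coprimePrefix 0 u X ∧ r.exit 1 = coprimePrefix 1 u X ∧
    r.exit 2 = coprimePrefix 2 u X ∧ r.cost ≤ prefixCost * u.divisors.card

theorem CallsGood.nil (n T : ℕ) : CallsGood n T [] 0 0 :=
  ⟨rfl, rfl, by simp, by simp⟩

theorem CallsGood.append {n T : ℕ} {L L' : List CallRecord} {D D' : Multiset (ℤ × ℤ × ℤ)}
    {P P' : Multiset (ℤ × ℤ)} (h : CallsGood n T L D P) (h' : CallsGood n T L' D' P') :
    CallsGood n T (L ++ L') (D + D') (P + P') := by
  refine ⟨?_, ?_, fun r hr => ?_, fun r hr => ?_⟩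
  · rw [← h.direction_eq, ← h'.direction_eq]
    simp [directionCalls]
  · rw [← h.prefix_eq, ← h'.prefix_eq]
    simp [prefixCalls]
  · rcases List.mem_append.1 hr with hr | hr
    · exact h.direction_correct r hr
    · exact h'.direction_correct r hr
  · rcases List.mem_append.1 hr with hr | hr
    · exact h.prefix_correct r hr
    · exact h'.prefix_correct r hr

/-! ### Sums over the large directions in the order of the loops. -/

section DualSum

variable {M : Type*} [AddCommMonoid M] (f : ℕ × ℕ × ℕ → M) (n : ℕ)

/-- The sum over the triples `(u, x, y)` with `y ≤ k`. -/
def dualYSum (u x k : ℕ) : M :=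
  ∑ y ∈ Finset.range k, if 1 ≤ vMax n u x (y + 1) then f (u, x, y + 1) else 0

/-- The sum over the triples `(u, x, y)` with `y ≤ x ≤ k`. -/
def dualXSum (u k : ℕ) : M := ∑ x ∈ Finset.range k, dualYSum f n u (x + 1) (x + 1)

/-- The sum over the triples `(u, x, y)` with `B < u ≤ B + k`. -/
def dualUSum (B k : ℕ) : M :=
  ∑ i ∈ Finset.range k, dualXSum f n (B + 1 + i) (n / (B + 1 + i))

theorem sum_range_succ_eq_sum_Icc (k : ℕ) (g : ℕ → M) :
    ∑ i ∈ Finset.range k, g (i + 1) = ∑ i ∈ Finset.Icc 1 k, g i := by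
  rw [Finset.range_eq_Ico, Finset.sum_Ico_add' g 0 k 1]
  exact Finset.sum_congr (by ext; simp) fun _ _ => rfl

theorem threshold_le (n : ℕ) : threshold n ≤ n := by
  rcases Nat.eq_zero_or_pos n with rfl | hn
  · simp [threshold]
  · refine Nat.floor_le_of_le ?_
    have h1 : (1 : ℝ) ≤ n := by exact_mod_cast hn
    calc (n : ℝ) ^ (2 / 3 : ℝ) ≤ (n : ℝ) ^ (1 : ℝ) :=
          Real.rpow_le_rpow_of_exponent_le h1 (by norm_num)
      _ = n := Real.rpow_one _

/-- Stated for any commutative monoid, since it is used twice: for the accumulated integer and for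
the multiset of prefix-sum queries. -/
theorem dualUSum_eq : dualUSum f n (threshold n) (n - threshold n) =
    ∑ s ∈ dualTriples n, f s := by
  have hB := threshold_le n
  have h1 : dualUSum f n (threshold n) (n - threshold n) =
      ∑ u ∈ Finset.Ioc (threshold n) n, ∑ x ∈ Finset.Icc 1 (n / u), ∑ y ∈ Finset.Icc 1 x,
        if 1 ≤ vMax n u x y then f (u, x, y) else 0 := by
    rw [dualUSum]
    refine Finset.sum_nbij' (fun i => threshold n + 1 + i) (fun u => u - (threshold n + 1))
      ?_ ?_ ?_ ?_ ?_
    · intro i hi; simp only [Finset.mem_range, Finset.mem_Ioc] at hi ⊢; omega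
    · intro i hi; simp only [Finset.mem_range, Finset.mem_Ioc] at hi ⊢; omega
    · intro i hi; simp
    · intro i hi; simp only [Finset.mem_Ioc] at hi; omega
    · intro i _
      rw [dualXSum, ← sum_range_succ_eq_sum_Icc]
      refine Finset.sum_congr rfl fun x _ => ?_
      rw [dualYSum, ← sum_range_succ_eq_sum_Icc]
  rw [h1, dualTriples, Finset.sum_filter, Finset.sum_product]
  refine Finset.sum_congr rfl fun u _ => ?_
  rw [Finset.sum_product]
  have hsub : Finset.Icc 1 (n / u) ⊆ Finset.Icc 1 n :=
    Finset.Icc_subset_Icc_right (Nat.div_le_self _ _)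
  rw [← Finset.sum_subset hsub]
  · refine Finset.sum_congr rfl fun x hx => ?_
    have hx' := Finset.mem_Icc.1 hx
    rw [← Finset.sum_subset (Finset.Icc_subset_Icc_right (Finset.mem_Icc.1 (hsub hx)).2)]
    · refine Finset.sum_congr rfl fun y hy => ?_
      have hy' := Finset.mem_Icc.1 hy
      simp [hy'.2, hx'.2]
    · intro y hy hy'
      simp only [Finset.mem_Icc] at hy hy'
      rw [if_neg]
      simp only
      omega
  · intro x hx hx'
    simp only [Finset.mem_Icc] at hx hx'
    refine Finset.sum_eq_zero fun y _ => if_neg ?_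
    simp only
    omega

end DualSum

open Stmt Expr in
/-- Computes `vMax` of the triple in the cells `33, 34, 35`. -/
def dualRange : Stmt :=
  set 36 ((cell 30 - cell 34 * cell 33) / cell 35) ;;
  Stmt.ite (cell 33) (cell 36) (set 36 (cell 33 - 1)) Stmt.skip

open Stmt Expr in
/-- Adds the contribution of the triple in the cells `33, 34, 35`. -/
def dualAdd : Stmt :=
  set 0 (cell 33) ;; set 1 (cell 36) ;; Stmt.call 2 ;;
  set 32 (cell 32 + (4 - 2 * (cell 35 / cell 34)) *
    ((cell 30 - cell 34 * cell 33) * (cell 30 - cell 35 * cell 33) * cell 0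
      - (cell 34 * (cell 30 - cell 34 * cell 33) + cell 35 * (cell 30 - cell 35 * cell 33)) *
        cell 1
      + cell 34 * cell 35 * cell 2))

open Stmt Expr in
/-- The treatment of one triple. -/
def dualStep : Stmt :=
  dualRange ;; Stmt.ite 1 (cell 36) dualAdd Stmt.skip ;; set 35 (cell 35 + 1)

open Stmt Expr in
/-- The treatment of one pair `(u, x)`. -/
def dualX : Stmt :=
  set 35 1 ;; Stmt.loop (cell 35) (cell 34) dualStep ;; set 34 (cell 34 + 1)

open Stmt Expr in
/-- The treatment of one `u`. -/
def dualU : Stmt :=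
  (set 37 (cell 30 / cell 33) ;; set 34 1) ;; Stmt.loop (cell 34) (cell 37) dualX ;;
    set 33 (cell 33 + 1)

open Stmt Expr in
/-- The treatment of the large directions. -/
def dualPhase : Stmt := set 33 (cell 31 + 1) ;; Stmt.loop (cell 33) (cell 30) dualU

theorem abs_coprimePrefix_le {n j u X : ℕ} (hu : 1 ≤ u) (hun : u ≤ n) (hX : X ≤ n)
    (hj : j ≤ 2) : |coprimePrefix j u X| ≤ ((n + 2) ^ 4 : ℕ) := by
  rw [coprimePrefix_eq_sum_list hu hun, ← List.take_length (l := divisorList n u)]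
  exact abs_sum_take_prefixTerm_le hX hj

theorem vMax_le (n u x y : ℕ) : vMax n u x y ≤ n :=
  (min_le_right _ _).trans ((Nat.div_le_self _ _).trans (Nat.sub_le _ _))

theorem abs_sideMult_le (x y : ℕ) : |sideMult x y| ≤ 4 := by
  rw [sideMult]; split_ifs <;> norm_num

theorem abs_dualTerm_le {n u x y : ℕ} (hu : 1 ≤ u) (hxu : x * u ≤ n) (hyx : y ≤ x) :
    |dualTerm n u x y| ≤ ((n + 2) ^ 10 : ℕ) := by
  -- For `x = 0` nothing bounds `u` by `n`. Then `y = 0` too, and division by zero makes `vMax` and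
  -- hence the term zero.
  rcases Nat.eq_zero_or_pos x with rfl | hx
  · obtain rfl : y = 0 := by omega
    have : vMax n u 0 0 = 0 := by simp [vMax]
    simp only [dualTerm, this]
    simp [coprimePrefix]
    positivity
  have hun : u ≤ n := (Nat.le_mul_of_pos_left u hx).trans hxu
  have hxn : x ≤ n := (Nat.le_mul_of_pos_right x hu).trans hxu
  have hyu : y * u ≤ n := (Nat.mul_le_mul_right u hyx).trans hxu
  have c0 := abs_coprimePrefix_le (j := 0) hu hun (vMax_le n u x y) (by norm_num)
  have c1 := abs_coprimePrefix_le (j := 1) hu hun (vMax_le n u x y) (by norm_num)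
  have c2 := abs_coprimePrefix_le (j := 2) hu hun (vMax_le n u x y) (by norm_num)
  rw [dualTerm]
  generalize coprimePrefix 0 u (vMax n u x y) = C0 at *
  generalize coprimePrefix 1 u (vMax n u x y) = C1 at *
  generalize coprimePrefix 2 u (vMax n u x y) = C2 at *
  obtain ⟨a, ha⟩ : ∃ a : ℕ, n = x * u + a := ⟨n - x * u, by omega⟩
  obtain ⟨b, hb⟩ : ∃ b : ℕ, n = y * u + b := ⟨n - y * u, by omega⟩
  have ea : (n : ℤ) - x * u = a := by rw [ha]; push_cast; ring
  have eb : (n : ℤ) - y * u = b := by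
    have : (n : ℤ) = y * u + b := by exact_mod_cast hb
    rw [this]; ring
  rw [ea, eb]
  have hm : ∀ p q : ℕ, p ≤ n → q ≤ n → p * q ≤ (n + 2) ^ 2 := fun p q hp hq => by
    rw [pow_two]; exact Nat.mul_le_mul (by omega) (by omega)
  have hP : ((n + 2) ^ 4 : ℕ) = ((n : ℤ) + 2) ^ 4 := by push_cast; ring
  rw [hP] at c0 c1 c2
  have key : ∀ (p q : ℕ) (C : ℤ), p ≤ n → q ≤ n → |C| ≤ ((n : ℤ) + 2) ^ 4 →
      |(p : ℤ) * q * C| ≤ ((n : ℤ) + 2) ^ 6 := by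
    intro p q C hp hq hC
    have h1 : |(p : ℤ) * q| ≤ ((n : ℤ) + 2) ^ 2 := by
      rw [abs_of_nonneg (by positivity)]
      exact_mod_cast hm p q hp hq
    rw [abs_mul, show ((n : ℤ) + 2) ^ 6 = ((n : ℤ) + 2) ^ 2 * ((n : ℤ) + 2) ^ 4 by ring]
    exact mul_le_mul h1 hC (abs_nonneg _) (by positivity)
  have k1 := key a b C0 (by omega) (by omega) c0
  have k2 := key x a C1 (by omega) (by omega) c1
  have k3 := key y b C1 (by omega) (by omega) c1
  have k4 := key x y C2 (by omega) (by omega) c2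
  have h16 : (16 : ℤ) * ((n : ℤ) + 2) ^ 6 ≤ ((n + 2) ^ 10 : ℕ) := by
    have : (2 : ℤ) ^ 4 ≤ ((n : ℤ) + 2) ^ 4 := pow_le_pow_left₀ (by norm_num) (by omega) 4
    push_cast
    rw [show ((n : ℤ) + 2) ^ 10 = ((n : ℤ) + 2) ^ 4 * ((n : ℤ) + 2) ^ 6 by ring]
    exact mul_le_mul_of_nonneg_right (by linarith) (by positivity)
  refine le_trans ?_ h16
  rw [abs_mul]
  have h4 := abs_sideMult_le x y
  have hs : |(a : ℤ) * b * C0 - (x * a + y * b) * C1 + x * y * C2| ≤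
      4 * ((n : ℤ) + 2) ^ 6 := by
    rw [abs_le] at k1 k2 k3 k4 ⊢
    constructor <;> nlinarith
  calc |sideMult x y| * _ ≤ 4 * (4 * ((n : ℤ) + 2) ^ 6) :=
        mul_le_mul h4 hs (abs_nonneg _) (by norm_num)
    _ = _ := by ring

/-- For `y ≤ x` the floor of `y/x` is the indicator of `y = x`; this allows the machine to compute
the multiplicity without a test. -/
theorem sideMult_eq {x y : ℕ} (hx : 1 ≤ x) (hyx : y ≤ x) :
    sideMult x y = 4 - 2 * ((y : ℤ) / x) := by
  rw [sideMult]
  split_ifs with h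
  · subst h
    rw [Int.ediv_self (by omega)]; norm_num
  · rw [Int.ediv_eq_zero_of_lt (by omega) (by omega)]; norm_num

theorem dualRange_runs {Γ : Program} {w Z n u x y : ℕ} (hW : WordBound w Z) (hnZ : n ≤ Z)
    {σ : Memory} (hu : 1 ≤ u) (hxu : x * u ≤ n) (hx : 1 ≤ x) (hy : 1 ≤ y) (hyx : y ≤ x)
    (h30 : σ 30 = n) (h33 : σ 33 = u) (h34 : σ 34 = x) (h35 : σ 35 = y) :
    Runs Γ w dualRange σ (fun _ L τ => L = [] ∧ τ 36 = vMax n u x y ∧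
      ∀ i, i ≠ 36 → τ i = σ i) := by
  have hun : u ≤ n := (Nat.le_mul_of_pos_left u hx).trans hxu
  have hxn : x ≤ n := (Nat.le_mul_of_pos_right x hu).trans hxu
  have hq : (n - x * u) / y ≤ n := (Nat.div_le_self _ _).trans (Nat.sub_le _ _)
  have cu := abs_natCast_le (show u ≤ Z by omega)
  have cx := abs_natCast_le (show x ≤ Z by omega)
  have cy := abs_natCast_le (show y ≤ Z by omega)
  have cn := abs_natCast_le (show n ≤ Z by omega)
  have cq := abs_natCast_le (show (n - x * u) / y ≤ Z by omega)
  refine Runs.seq (Runs.set hW (((n - x * u) / y : ℕ) : ℤ)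
    (by push_cast [Nat.cast_sub hxu]; simp [h30, h33, h34, h35])
    (by simp only [Expr.safe_div, Expr.safe_sub, Expr.safe_mul, Expr.safe_cell, Expr.eval_cell,
          h30, h33, h34, h35]
        exact ⟨⟨⟨by norm_num, cn⟩, ⟨by norm_num, cx⟩, by norm_num, cu⟩, ⟨by norm_num, cy⟩,
          by omega⟩) (by decide) ?_)
  generalize hqq : (n - x * u) / y = q at *
  refine Runs.ite hW (by simp [h33]; omega) (by simp; omega) (by decide) ?_ ?_
  · intro hc
    have hc' : u ≤ q := by simpa [h33] using hc
    refine Runs.set hW ((u - 1 : ℕ) : ℤ) (by push_cast [Nat.cast_sub hu]; simp [h33])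
      (by simp [h33]; omega) (by decide) ?_
    refine ⟨rfl, ?_, fun i hi => ?_⟩
    · rw [Function.update_self, vMax, hqq, min_eq_left (by omega)]
    · rw [Function.update_of_ne hi, Function.update_of_ne hi]
  · intro hc
    have hc' : q < u := by simpa [h33] using hc
    refine Runs.skip ⟨rfl, ?_, fun i hi => ?_⟩
    · rw [Function.update_self, vMax, hqq, min_eq_right (by omega)]
    · rw [Function.update_of_ne hi]

theorem dualStep_runs {Γ : Program} {w Z n T u x y : ℕ} (hΓ : Γ[2]? = some prefixBody)
    (hW : WordBound w Z) (hZ : (n + 2) ^ 10 ≤ Z) {σ : Memory} (hT : TableData σ n)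
    (hu : 1 ≤ u) (hxu : x * u ≤ n) (hx : 1 ≤ x) (hy : 1 ≤ y) (hyx : y ≤ x) (h30 : σ 30 = n)
    (h33 : σ 33 = u) (h34 : σ 34 = x) (h35 : σ 35 = y) (h32 : |σ 32| ≤ (Z : ℤ)) :
    Runs Γ w dualStep σ (fun t L τ =>
      t ≤ (dualStep.size + prefixCost) * u.divisors.card ∧
      CallsGood n T L 0 (if 1 ≤ vMax n u x y then {((u : ℤ), (vMax n u x y : ℤ))} else 0) ∧
      τ 32 = σ 32 + (if 1 ≤ vMax n u x y then dualTerm n u x y else 0) ∧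
      τ 35 = (y + 1 : ℕ) ∧
      ∀ i, (i = 30 ∨ i = 31 ∨ i = 33 ∨ i = 34 ∨ i = 37 ∨ 64 ≤ i) → τ i = σ i) := by
  obtain ⟨hZ1, hZ2, hZ3⟩ := table_bound hZ
  have hun : u ≤ n := (Nat.le_mul_of_pos_left u hx).trans hxu
  have hxn : x ≤ n := (Nat.le_mul_of_pos_right x hu).trans hxu
  have hvn := vMax_le n u x y
  have cu := abs_natCast_le (show u ≤ Z by omega)
  have cx := abs_natCast_le (show x ≤ Z by omega)
  have cy := abs_natCast_le (show y ≤ Z by omega)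
  have cn := abs_natCast_le (show n ≤ Z by omega)
  have cv := abs_natCast_le (show vMax n u x y ≤ Z by omega)
  have hc1 : 1 ≤ u.divisors.card := Finset.card_pos.2 ⟨u, Nat.mem_divisors_self u (by omega)⟩
  suffices h : Runs Γ w dualStep σ (fun _ L τ =>
      callCost L ≤ prefixCost * u.divisors.card ∧
      CallsGood n T L 0 (if 1 ≤ vMax n u x y then {((u : ℤ), (vMax n u x y : ℤ))} else 0) ∧
      τ 32 = σ 32 + (if 1 ≤ vMax n u x y then dualTerm n u x y else 0) ∧
      τ 35 = (y + 1 : ℕ) ∧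
      ∀ i, (i = 30 ∨ i = 31 ∨ i = 33 ∨ i = 34 ∨ i = 37 ∨ 64 ≤ i) → τ i = σ i) by
    refine (h.with_cost (by decide)).mono ?_
    rintro t L τ ⟨ht, hL, h⟩
    refine ⟨?_, h⟩
    have := Nat.mul_le_mul_left dualStep.size hc1
    rw [add_mul]
    omega
  refine Runs.seq ((dualRange_runs hW (by omega) hu hxu hx hy hyx h30 h33 h34 h35).mono ?_)
  rintro _ L₁ σ₁ ⟨rfl, g36, gfr⟩
  -- The increment of `y` is common to the branch with a query and the branch without one.
  have fin : ∀ (L : List CallRecord) (σ₂ : Memory), σ₂ 35 = y →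
      callCost L ≤ prefixCost * u.divisors.card →
      CallsGood n T L 0 (if 1 ≤ vMax n u x y then {((u : ℤ), (vMax n u x y : ℤ))} else 0) →
      σ₂ 32 = σ 32 + (if 1 ≤ vMax n u x y then dualTerm n u x y else 0) →
      (∀ i, (i = 30 ∨ i = 31 ∨ i = 33 ∨ i = 34 ∨ i = 37 ∨ 64 ≤ i) → σ₂ i = σ i) →
      Runs Γ w (Stmt.set 35 (Expr.cell 35 + 1)) σ₂ (fun _ L' τ =>
        callCost ([] ++ (L ++ L')) ≤ prefixCost * u.divisors.card ∧
        CallsGood n T ([] ++ (L ++ L')) 0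
          (if 1 ≤ vMax n u x y then {((u : ℤ), (vMax n u x y : ℤ))} else 0) ∧
        τ 32 = σ 32 + (if 1 ≤ vMax n u x y then dualTerm n u x y else 0) ∧
        τ 35 = (y + 1 : ℕ) ∧
        ∀ i, (i = 30 ∨ i = 31 ∨ i = 33 ∨ i = 34 ∨ i = 37 ∨ 64 ≤ i) → τ i = σ i) := by
    intro L σ₂ e35 hL hG e32 efr
    refine Runs.set hW ((y + 1 : ℕ) : ℤ) (by simp [e35]) (by simp [e35]; omega) (by decide) ?_
    refine ⟨by simpa using hL, by simpa using hG, by simpa using e32, by simp, fun i hi => ?_⟩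
    rw [Function.update_of_ne (by omega), efr i hi]
  refine Runs.seq (Runs.ite hW (by simp) (by simp [g36]; omega) (by decide) ?_ ?_)
  · intro hc
    have hv1 : 1 ≤ vMax n u x y := by
      simp only [Expr.eval_one, Expr.eval_cell, g36] at hc
      exact_mod_cast hc
    have q33 : σ₁ 33 = u := by rw [gfr 33 (by norm_num), h33]
    refine Runs.seq (Runs.set hW (u : ℤ) (by simp [q33]) (by simp [q33]; omega) (by decide) ?_)
    refine Runs.seq (Runs.set hW (vMax n u x y : ℤ) (by simp [g36]) (by simp [g36]; omega)
      (by decide) ?_)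
    refine Runs.seq (Runs.call hΓ ((prefixBody_runs hW hZ
      (hT.congr fun i hi => ?_) hu hun hvn (by simp) (by simp) ?_).mono ?_))
    · simp (disch := omega) only [Function.update_of_ne]
      exact gfr i (by omega)
    · simp (disch := omega) only [Function.update_of_ne]
      rw [gfr 30 (by norm_num), h30]
    rintro t L τ ⟨ht, p0, p1, p2, pfr⟩
    have pfr' : ∀ i, 10 ≤ i → i ≠ 36 → τ i = σ i := fun i hi hi' => by
      rw [pfr i hi]
      simp (disch := omega) only [Function.update_of_ne]
      exact gfr i hi'
    have hZ2' : (((n + 2) ^ 4 : ℕ) : ℤ) ≤ Z := by exact_mod_cast hZ2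
    have b0 := (abs_coprimePrefix_le (j := 0) hu hun hvn (by norm_num)).trans hZ2'
    have b1 := (abs_coprimePrefix_le (j := 1) hu hun hvn (by norm_num)).trans hZ2'
    have b2 := (abs_coprimePrefix_le (j := 2) hu hun hvn (by norm_num)).trans hZ2'
    refine Runs.set hW (σ 32 + dualTerm n u x y) ?_ ?_ (by decide) ?_
    · rw [dualTerm, sideMult_eq hx hyx]
      simp only [Expr.eval_add, Expr.eval_sub, Expr.eval_mul, Expr.eval_div, Expr.eval_cell,
        Expr.eval_ofNat, p0, p1, p2, pfr' 32 (by norm_num) (by norm_num),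
        pfr' 30 (by norm_num) (by norm_num), pfr' 33 (by norm_num) (by norm_num),
        pfr' 34 (by norm_num) (by norm_num), pfr' 35 (by norm_num) (by norm_num), h30, h33, h34,
        h35]
    · simp only [Expr.safe_add, Expr.safe_sub, Expr.safe_mul, Expr.safe_div, Expr.safe_cell,
        Expr.safe_ofNat, Expr.eval_cell, p0, p1, p2, pfr' 32 (by norm_num) (by norm_num),
        pfr' 30 (by norm_num) (by norm_num), pfr' 33 (by norm_num) (by norm_num),
        pfr' 34 (by norm_num) (by norm_num), pfr' 35 (by norm_num) (by norm_num), h30, h33, h34,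
        h35, b0, b1, b2, cn, cu, cx, cy, h32]
      norm_num
      omega
    · refine fin _ _ ?_ ?_ ?_ ?_ fun i hi => ?_
      · rw [Function.update_of_ne (by norm_num), pfr' 35 (by norm_num) (by norm_num), h35]
      · simpa using ht
      · rw [if_pos hv1]
        refine ⟨rfl, by simp [prefixCalls], by simp, ?_⟩
        intro r hr _
        simp only [List.nil_append, List.append_nil, List.mem_singleton] at hr
        subst hr
        exact ⟨u, vMax n u x y, by simp, by simp, p0, p1, p2, ht⟩
      · rw [if_pos hv1, Function.update_self]
      · rw [Function.update_of_ne (by omega), pfr' i (by omega) (by omega)]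
  · intro hc
    have hv0 : ¬ 1 ≤ vMax n u x y := by
      simp only [Expr.eval_one, Expr.eval_cell, g36] at hc
      have : vMax n u x y < 1 := by exact_mod_cast hc
      omega
    refine Runs.skip (fin _ _ ?_ (by simp) ?_ ?_ fun i hi => gfr i (by omega))
    · rw [gfr 35 (by norm_num), h35]
    · rw [if_neg hv0]; exact CallsGood.nil n T
    · rw [if_neg hv0, gfr 32 (by norm_num), add_zero]

/-- The contribution of a triple. -/
def tripleTerm (n : ℕ) (s : ℕ × ℕ × ℕ) : ℤ := dualTerm n s.1 s.2.1 s.2.2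

/-- The prefix-sum query for a triple. -/
def tripleQuery (n : ℕ) (s : ℕ × ℕ × ℕ) : Multiset (ℤ × ℤ) :=
  {((s.1 : ℤ), (vMax n s.1 s.2.1 s.2.2 : ℤ))}

theorem abs_sum_range_le {k : ℕ} {g : ℕ → ℤ} {K : ℤ} (h : ∀ i < k, |g i| ≤ K) :
    |∑ i ∈ Finset.range k, g i| ≤ k * K := by
  refine (Finset.abs_sum_le_sum_abs _ _).trans ?_
  refine (Finset.sum_le_card_nsmul _ _ K fun i hi => h i (Finset.mem_range.1 hi)).trans ?_
  simp

theorem abs_dualYSum_le {n u x k : ℕ} (hu : 1 ≤ u) (hxu : x * u ≤ n) (hk : k ≤ x) :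
    |dualYSum (tripleTerm n) n u x k| ≤ k * ((n + 2) ^ 10 : ℕ) := by
  refine abs_sum_range_le fun i hi => ?_
  split_ifs
  · exact abs_dualTerm_le hu hxu (show i + 1 ≤ x by omega)
  · simp only [abs_zero]; positivity

theorem abs_dualXSum_le {n u k : ℕ} (hu : 1 ≤ u) (hku : k * u ≤ n) :
    |dualXSum (tripleTerm n) n u k| ≤ k * (n * ((n + 2) ^ 10 : ℕ)) := by
  refine abs_sum_range_le fun i hi => ?_
  have h1 : (i + 1) * u ≤ n := (Nat.mul_le_mul_right u (show i + 1 ≤ k from hi)).trans hku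
  refine (abs_dualYSum_le hu h1 le_rfl).trans ?_
  have h2 : i + 1 ≤ n := (Nat.le_mul_of_pos_right _ hu).trans h1
  exact_mod_cast Nat.mul_le_mul_right _ h2

/-- The cost of the treatment of a pair `(u, x)` per divisor and value of `y`. -/
def dualXCost : ℕ := dualStep.size + prefixCost + dualX.size + 20

/-- The cost of the treatment of `u` per divisor and pair `(x, y)`. -/
def dualUCost : ℕ := dualXCost + dualU.size + 20

/-- The hypothesis on cell `32` reserves room for every partial sum formed here. Each surrounding
loop reserves one or two further powers of `n + 2`, so the accumulator fits into a word throughout.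
-/
theorem dualX_runs {Γ : Program} {w Z n T u x : ℕ} (hΓ : Γ[2]? = some prefixBody)
    (hW : WordBound w Z) (hZ : (n + 2) ^ 10 ≤ Z) {σ : Memory} (hT : TableData σ n)
    (hu : 1 ≤ u) (hxu : x * u ≤ n) (hx : 1 ≤ x) (h30 : σ 30 = n)
    (h33 : σ 33 = u) (h34 : σ 34 = x) (h32 : |σ 32| + ((n + 2) ^ 11 : ℕ) ≤ (Z : ℤ)) :
    Runs Γ w dualX σ (fun t L τ => t ≤ dualXCost * (x * u.divisors.card) ∧
      CallsGood n T L 0 (dualYSum (tripleQuery n) n u x x) ∧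
      τ 32 = σ 32 + dualYSum (tripleTerm n) n u x x ∧ τ 34 = (x + 1 : ℕ) ∧
      ∀ i, (i = 30 ∨ i = 31 ∨ i = 33 ∨ i = 37 ∨ 64 ≤ i) → τ i = σ i) := by
  obtain ⟨hZ1, hZ2, hZ3⟩ := table_bound hZ
  have hxn : x ≤ n := (Nat.le_mul_of_pos_right x hu).trans hxu
  have cx := abs_natCast_le (show x ≤ Z by omega)
  have hc1 : 1 ≤ u.divisors.card := Finset.card_pos.2 ⟨u, Nat.mem_divisors_self u (by omega)⟩
  refine Runs.seq (Runs.set hW 1 (by simp) (by simp) (by decide) ?_)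
  refine Runs.seq (Runs.loop hW (by decide) x
    (fun k t L σ' => t ≤ k * (5 + (dualStep.size + prefixCost) * u.divisors.card) ∧
      CallsGood n T L 0 (dualYSum (tripleQuery n) n u x k) ∧
      σ' 32 = σ 32 + dualYSum (tripleTerm n) n u x k ∧ σ' 35 = (k + 1 : ℕ) ∧
      ∀ i, (i = 30 ∨ i = 31 ∨ i = 33 ∨ i = 34 ∨ i = 37 ∨ 64 ≤ i) → σ' i = σ i) ?_ ?_ ?_ ?_)
  · refine ⟨by simp, CallsGood.nil n T, by simp [dualYSum], by simp, fun i hi => ?_⟩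
    rw [Function.update_of_ne (by omega)]
  · rintro k t L σ' hk ⟨-, -, -, g35, gfr⟩
    have ck := abs_natCast_le (show k + 1 ≤ Z by omega)
    simp only [Expr.safe_cell, Expr.eval_cell, g35, gfr 34 (by omega), h34]
    exact ⟨⟨by norm_num, ck⟩, ⟨by norm_num, cx⟩, by rw [Nat.cast_le]; rfl⟩
  · rintro k t L σ' hk ⟨ht, gL, g32, g35, gfr⟩
    have hacc : |σ' 32| ≤ (Z : ℤ) := by
      rw [g32]
      refine (abs_add_le _ _).trans (le_trans ?_ h32)
      have h1 := abs_dualYSum_le hu hxu hk.le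
      have h2 : k * (n + 2) ^ 10 ≤ (n + 2) ^ 11 := by
        rw [pow_succ' (n + 2) 10]; exact Nat.mul_le_mul_right _ (by omega)
      have h3 : (k : ℤ) * ((n + 2) ^ 10 : ℕ) ≤ ((n + 2) ^ 11 : ℕ) := by exact_mod_cast h2
      linarith
    refine (dualStep_runs (T := T) (y := k + 1) hΓ hW hZ
      (hT.congr fun i hi => gfr i (by omega)) hu hxu hx (by omega) hk
      (by rw [gfr 30 (by omega), h30]) (by rw [gfr 33 (by omega), h33])
      (by rw [gfr 34 (by omega), h34]) g35 hacc).mono ?_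
    rintro t' L' τ ⟨ht', kL, k32, k35, kfr⟩
    refine ⟨?_, ?_, ?_, k35, fun i hi => by rw [kfr i hi, gfr i (by omega)]⟩
    · simp only [Expr.cell, Expr.cost, Nat.succ_mul]
      omega
    · have := gL.append kL
      rw [add_zero] at this
      rw [dualYSum, Finset.sum_range_succ]
      exact this
    · rw [k32, g32, dualYSum, dualYSum, Finset.sum_range_succ, add_assoc]
      rfl
  · rintro t L σ' ⟨ht, gL, g32, g35, gfr⟩
    have e34 : σ' 34 = x := by rw [gfr 34 (by omega), h34]
    refine Runs.set hW ((x + 1 : ℕ) : ℤ) (by simp [e34]) (by simp [e34]; omega) (by decide) ?_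
    refine ⟨?_, by simpa using gL, by simpa using g32, by simp, fun i hi => ?_⟩
    · simp only [Expr.cell, Expr.cost]
      have h1 : 1 ≤ x * u.divisors.card := Nat.mul_pos hx hc1
      have h2 : x ≤ x * u.divisors.card := Nat.le_mul_of_pos_right _ hc1
      have h3 : dualXCost * (x * u.divisors.card) =
          (dualStep.size + prefixCost) * (x * u.divisors.card) + dualX.size *
            (x * u.divisors.card) + 20 * (x * u.divisors.card) := by rw [dualXCost]; ring
      have h4 : x * (5 + (dualStep.size + prefixCost) * u.divisors.card) =
          5 * x + (dualStep.size + prefixCost) * (x * u.divisors.card) := by ring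
      have h5 : 20 ≤ dualX.size := by decide
      have h6 := Nat.mul_le_mul_left dualX.size h1
      omega
    · rw [Function.update_of_ne (by omega), gfr i (by omega)]

/-- There are at most `⌊n/u⌋²` pairs `y ≤ x ≤ ⌊n/u⌋`, each costing `O(τ(u))`; the loop overhead is
absorbed because both factors are at least 1. -/
theorem dualU_runs {Γ : Program} {w Z n T u : ℕ} (hΓ : Γ[2]? = some prefixBody)
    (hW : WordBound w Z) (hZ : (n + 2) ^ 10 ≤ Z) {σ : Memory} (hT : TableData σ n)
    (hu : 1 ≤ u) (hun : u ≤ n) (h30 : σ 30 = n) (h33 : σ 33 = u)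
    (h32 : |σ 32| + ((n + 2) ^ 12 : ℕ) ≤ (Z : ℤ)) :
    Runs Γ w dualU σ (fun t L τ => t ≤ dualUCost * ((n / u) ^ 2 * u.divisors.card) ∧
      CallsGood n T L 0 (dualXSum (tripleQuery n) n u (n / u)) ∧
      τ 32 = σ 32 + dualXSum (tripleTerm n) n u (n / u) ∧ τ 33 = (u + 1 : ℕ) ∧
      ∀ i, (i = 30 ∨ i = 31 ∨ 64 ≤ i) → τ i = σ i) := by
  obtain ⟨hZ1, hZ2, hZ3⟩ := table_bound hZ
  have hq : n / u ≤ n := Nat.div_le_self _ _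
  have hq1 : 1 ≤ n / u := (Nat.one_le_div_iff hu).2 hun
  have hqu : n / u * u ≤ n := Nat.div_mul_le_self n u
  have cq := abs_natCast_le (show n / u ≤ Z by omega)
  have hc1 : 1 ≤ u.divisors.card := Finset.card_pos.2 ⟨u, Nat.mem_divisors_self u (by omega)⟩
  refine Runs.seq (Runs.seq (Runs.set hW ((n / u : ℕ) : ℤ) (by simp [h30, h33])
    (by simp [h30, h33]; omega) (by decide) (Runs.set hW 1 (by simp) (by simp) (by decide) ?_)))
  refine Runs.seq (Runs.loop hW (by decide) (n / u)
    (fun k t L σ' => t ≤ k * (5 + dualXCost * (n / u * u.divisors.card)) ∧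
      CallsGood n T L 0 (dualXSum (tripleQuery n) n u k) ∧
      σ' 32 = σ 32 + dualXSum (tripleTerm n) n u k ∧ σ' 34 = (k + 1 : ℕ) ∧
      σ' 37 = (n / u : ℕ) ∧
      ∀ i, (i = 30 ∨ i = 31 ∨ i = 33 ∨ 64 ≤ i) → σ' i = σ i) ?_ ?_ ?_ ?_)
  · refine ⟨by simp, CallsGood.nil n T, by simp [dualXSum], by simp, by simp, fun i hi => ?_⟩
    simp (disch := omega) only [Function.update_of_ne]
  · rintro k t L σ' hk ⟨-, -, -, g34, g37, gfr⟩
    have ck := abs_natCast_le (show k + 1 ≤ Z by omega)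
    simp only [Expr.safe_cell, Expr.eval_cell, g34, g37]
    exact ⟨⟨by norm_num, ck⟩, ⟨by norm_num, cq⟩, by rw [Nat.cast_le]; rfl⟩
  · rintro k t L σ' hk ⟨ht, gL, g32, g34, g37, gfr⟩
    have hku : (k + 1) * u ≤ n := (Nat.mul_le_mul_right u (show k + 1 ≤ n / u from hk)).trans hqu
    have hacc : |σ' 32| + ((n + 2) ^ 11 : ℕ) ≤ (Z : ℤ) := by
      have h0 : |σ' 32| ≤ |σ 32| + |dualXSum (tripleTerm n) n u k| := by
        rw [g32]; exact abs_add_le _ _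
      have h1 := abs_dualXSum_le (k := k) hu ((Nat.mul_le_mul_right u (by omega)).trans hku)
      have h2 : k * (n * (n + 2) ^ 10) + (n + 2) ^ 11 ≤ (n + 2) ^ 12 := by
        have e1 : (n + 2) ^ 11 = (n + 2) * (n + 2) ^ 10 := pow_succ' _ _
        have e2 : (n + 2) ^ 12 = (n + 2) * (n + 2) * (n + 2) ^ 10 := by ring
        rw [e1, e2, ← mul_assoc, ← add_mul]
        refine Nat.mul_le_mul_right _ ?_
        have : k * n ≤ n * n := Nat.mul_le_mul_right _ (by omega)
        nlinarith
      have h3 : (k : ℤ) * (n * ((n + 2) ^ 10 : ℕ)) + ((n + 2) ^ 11 : ℕ) ≤ ((n + 2) ^ 12 : ℕ) := by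
        exact_mod_cast h2
      linarith
    refine (dualX_runs (T := T) (x := k + 1) hΓ hW hZ
      (hT.congr fun i hi => gfr i (by omega)) hu hku (by omega)
      (by rw [gfr 30 (by omega), h30]) (by rw [gfr 33 (by omega), h33]) g34 hacc).mono ?_
    rintro t' L' τ ⟨ht', kL, k32, k34, kfr⟩
    refine ⟨?_, ?_, ?_, k34, by rw [kfr 37 (by omega), g37],
      fun i hi => by rw [kfr i (by omega), gfr i (by omega)]⟩
    · have h1 : dualXCost * ((k + 1) * u.divisors.card) ≤
          dualXCost * (n / u * u.divisors.card) :=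
        Nat.mul_le_mul_left _ (Nat.mul_le_mul_right _ hk)
      simp only [Expr.cell, Expr.cost, Nat.succ_mul k]
      omega
    · have := gL.append kL
      rw [add_zero] at this
      rw [dualXSum, Finset.sum_range_succ]
      exact this
    · rw [k32, g32, dualXSum, dualXSum, Finset.sum_range_succ, add_assoc]
  · rintro t L σ' ⟨ht, gL, g32, g34, g37, gfr⟩
    have e33 : σ' 33 = u := by rw [gfr 33 (by omega), h33]
    refine Runs.set hW ((u + 1 : ℕ) : ℤ) (by simp [e33]) (by simp [e33]; omega) (by decide) ?_
    refine ⟨?_, by simpa using gL, by simpa using g32, by simp, fun i hi => ?_⟩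
    · simp only [Expr.cell, Expr.cost,
        show ((Expr.lit 30).read / (Expr.lit 33).read : Expr).cost = 5 from rfl]
      have h1 : 1 ≤ (n / u) ^ 2 * u.divisors.card := Nat.mul_pos (Nat.pow_pos hq1) hc1
      have h2 : n / u ≤ (n / u) ^ 2 * u.divisors.card :=
        (Nat.le_self_pow (by norm_num) _).trans (Nat.le_mul_of_pos_right _ hc1)
      have h3 : dualUCost * ((n / u) ^ 2 * u.divisors.card) =
          dualXCost * ((n / u) ^ 2 * u.divisors.card) + dualU.size *
            ((n / u) ^ 2 * u.divisors.card) + 20 * ((n / u) ^ 2 * u.divisors.card) := by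
        rw [dualUCost]; ring
      have h4 : n / u * (5 + dualXCost * (n / u * u.divisors.card)) =
          5 * (n / u) + dualXCost * ((n / u) ^ 2 * u.divisors.card) := by ring
      have h5 : 20 ≤ dualU.size := by decide
      have h6 := Nat.mul_le_mul_left dualU.size h1
      omega
    · rw [Function.update_of_ne (by omega), gfr i (by omega)]

theorem abs_dualUSum_le (n B k : ℕ) :
    |dualUSum (tripleTerm n) n B k| ≤ k * (n * (n * ((n + 2) ^ 10 : ℕ))) := by
  refine abs_sum_range_le fun i _ => ?_
  have h1 : n / (B + 1 + i) * (B + 1 + i) ≤ n := Nat.div_mul_le_self _ _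
  refine (abs_dualXSum_le (by omega) h1).trans ?_
  exact_mod_cast Nat.mul_le_mul_right _ (Nat.div_le_self n (B + 1 + i))

/-- The number of steps of the treatment of the large directions, up to a constant factor. -/
def dualWork (n B k : ℕ) : ℕ :=
  ∑ i ∈ Finset.range k, (n / (B + 1 + i)) ^ 2 * (B + 1 + i).divisors.card

theorem dualPhase_runs {Γ : Program} {w Z n T B : ℕ} (hΓ : Γ[2]? = some prefixBody)
    (hW : WordBound w Z) (hZ : (n + 2) ^ 14 ≤ Z) {σ : Memory} (hT : TableData σ n)
    (hB : B ≤ n) (h30 : σ 30 = n) (h31 : σ 31 = B) (h32 : σ 32 = 0) :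
    Runs Γ w dualPhase σ (fun t L τ =>
      t ≤ (dualUCost + 5) * dualWork n B (n - B) + 20 ∧
      CallsGood n T L 0 (dualUSum (tripleQuery n) n B (n - B)) ∧
      τ 32 = dualUSum (tripleTerm n) n B (n - B) ∧
      ∀ i, (i = 30 ∨ i = 31) → τ i = σ i) := by
  have hZ' : (n + 2) ^ 10 ≤ Z := (Nat.pow_le_pow_right (by omega) (by norm_num)).trans hZ
  obtain ⟨hZ1, hZ2, hZ3⟩ := table_bound hZ'
  have cn := abs_natCast_le (show n ≤ Z by omega)
  refine Runs.seq (Runs.set hW ((B + 1 : ℕ) : ℤ) (by simp [h31]) (by simp [h31]; omega)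
    (by decide) ?_)
  refine Runs.loop hW (by decide) (n - B)
    (fun k t L σ' => t ≤ (dualUCost + 5) * dualWork n B k ∧
      CallsGood n T L 0 (dualUSum (tripleQuery n) n B k) ∧
      σ' 32 = dualUSum (tripleTerm n) n B k ∧ σ' 33 = (B + 1 + k : ℕ) ∧
      ∀ i, (i = 30 ∨ i = 31 ∨ 64 ≤ i) → σ' i = σ i) ?_ ?_ ?_ ?_
  · refine ⟨by simp, CallsGood.nil n T, by simp [dualUSum, h32], by simp, fun i hi => ?_⟩
    rw [Function.update_of_ne (by omega)]
  · rintro k t L σ' hk ⟨-, -, -, g33, gfr⟩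
    have ck := abs_natCast_le (show B + 1 + k ≤ Z by omega)
    simp only [Expr.safe_cell, Expr.eval_cell, g33, gfr 30 (by omega), h30]
    exact ⟨⟨by norm_num, ck⟩, ⟨by norm_num, cn⟩, by rw [Nat.cast_le]; omega⟩
  · rintro k t L σ' hk ⟨ht, gL, g32, g33, gfr⟩
    have hacc : |σ' 32| + ((n + 2) ^ 12 : ℕ) ≤ (Z : ℤ) := by
      rw [g32]
      have h1 := abs_dualUSum_le n B k
      have h2 : k * (n * (n * (n + 2) ^ 10)) + (n + 2) ^ 12 ≤ Z := by
        refine le_trans ?_ hZ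
        have e1 : k * (n * (n * (n + 2) ^ 10)) ≤
            (n + 2) * ((n + 2) * ((n + 2) * (n + 2) ^ 10)) := by gcongr <;> omega
        have e2 : (n + 2) * ((n + 2) * ((n + 2) * (n + 2) ^ 10)) = (n + 2) ^ 13 := by ring
        have e3 : (n + 2) ^ 12 ≤ (n + 2) ^ 13 := Nat.pow_le_pow_right (by omega) (by norm_num)
        have e4 : 2 * (n + 2) ^ 13 ≤ (n + 2) ^ 14 := by
          rw [pow_succ' (n + 2) 13]; exact Nat.mul_le_mul_right _ (by omega)
        omega
      have h3 : (k : ℤ) * (n * (n * ((n + 2) ^ 10 : ℕ))) + ((n + 2) ^ 12 : ℕ) ≤ (Z : ℤ) := by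
        exact_mod_cast h2
      linarith
    refine (dualU_runs (T := T) (u := B + 1 + k) hΓ hW hZ'
      (hT.congr fun i hi => gfr i (by omega)) (by omega) (by omega)
      (by rw [gfr 30 (by omega), h30]) g33 hacc).mono ?_
    rintro t' L' τ ⟨ht', kL, k32, k33, kfr⟩
    refine ⟨?_, ?_, ?_, k33, fun i hi => by rw [kfr i (by omega), gfr i (by omega)]⟩
    · have hc1 : 1 ≤ (B + 1 + k).divisors.card :=
        Finset.card_pos.2 ⟨_, Nat.mem_divisors_self _ (by omega)⟩
      have hq1 : 1 ≤ n / (B + 1 + k) := (Nat.one_le_div_iff (by omega)).2 (by omega)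
      have h1 : 1 ≤ (n / (B + 1 + k)) ^ 2 * (B + 1 + k).divisors.card :=
        Nat.mul_pos (Nat.pow_pos hq1) hc1
      rw [dualWork, Finset.sum_range_succ, mul_add]
      rw [dualWork] at ht
      simp only [Expr.cell, Expr.cost]
      rw [add_mul _ _ ((n / (B + 1 + k)) ^ 2 * (B + 1 + k).divisors.card)]
      omega
    · have := gL.append kL
      rw [add_zero] at this
      rw [dualUSum, Finset.sum_range_succ]
      exact this
    · rw [k32, g32, dualUSum, dualUSum, Finset.sum_range_succ]
  · rintro t L σ' ⟨ht, gL, g32, -, gfr⟩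
    refine ⟨?_, by simpa using gL, g32, fun i hi => gfr i (by omega)⟩
    simp only [Expr.cell, Expr.cost]
    omega

/-! ## The small directions -/

/-- A one-step rule, for the gcd loop, whose number of iterations is not known in advance. -/
theorem Runs.loop_unfold {Γ : Program} {w Z : ℕ} {s : Stmt} {σ : Memory} {e f : Expr}
    {Q : ℕ → List CallRecord → Memory → Prop} (hW : WordBound w Z) (hes : e.Safe Z σ)
    (hfs : f.Safe Z σ) (hd : max e.deg f.deg ≤ 200)
    (h : e.eval σ ≤ f.eval σ → Runs Γ w s σ (fun t L σ' => Runs Γ w (Stmt.loop e f s) σ'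
      (fun t' L' τ => Q (e.cost + f.cost + 1 + t + t') (L ++ L') τ)))
    (h' : f.eval σ < e.eval σ → Q (e.cost + f.cost + 1) [] σ) :
    Runs Γ w (Stmt.loop e f s) σ Q := by
  have he := hW.legal hes ((le_max_left _ _).trans hd)
  have hf := hW.legal hfs ((le_max_right _ _).trans hd)
  by_cases hc : e.eval σ ≤ f.eval σ
  · obtain ⟨t, L, σ', hx, t', L', τ, hy, hq⟩ := h hc
    exact ⟨_, _, _, Exec.loop_step he hf hc hx hy, hq⟩
  · exact ⟨_, _, _, Exec.loop_done he hf hc, h' (not_le.1 hc)⟩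

open Stmt Expr in
/-- One step of the Euclidean algorithm. -/
def gcdStep : Stmt :=
  set 37 (cell 35 - cell 36 * (cell 35 / cell 36)) ;; set 35 (cell 36) ;; set 36 (cell 37)

open Stmt Expr in
/-- The Euclidean algorithm for the cells `35` and `36`. -/
def gcdLoop : Stmt := Stmt.loop 1 (cell 36) gcdStep

theorem gcdStep_runs {Γ : Program} {w Z : ℕ} (hW : WordBound w Z) {a b : ℕ} {σ : Memory}
    (haZ : a ≤ Z) (hb : 1 ≤ b) (hba : b < a) (h35 : σ 35 = a) (h36 : σ 36 = b) :
    Runs Γ w gcdStep σ (fun t L τ => t ≤ gcdStep.size ∧ L = [] ∧ τ 35 = b ∧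
      τ 36 = (a % b : ℕ) ∧ ∀ i, (i < 35 ∨ 38 ≤ i) → τ i = σ i) := by
  suffices h : Runs Γ w gcdStep σ (fun _ L τ => L = [] ∧ τ 35 = b ∧
      τ 36 = (a % b : ℕ) ∧ ∀ i, (i < 35 ∨ 38 ≤ i) → τ i = σ i) by
    refine (h.with_cost (by decide)).mono ?_
    rintro t L τ ⟨ht, rfl, h⟩
    exact ⟨by simpa using ht, rfl, h⟩
  have hm := Nat.mod_lt a hb
  have ca := abs_natCast_le haZ
  have cb := abs_natCast_le (show b ≤ Z by omega)
  have cm := abs_natCast_le (show a % b ≤ Z by omega)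
  refine Runs.seq (Runs.set hW ((a % b : ℕ) : ℤ)
    (by simp only [Expr.eval_sub, Expr.eval_mul, Expr.eval_div, Expr.eval_cell, h35, h36]
        push_cast; rw [Int.emod_def])
    (by simp only [Expr.safe_sub, Expr.safe_mul, Expr.safe_div, Expr.safe_cell, Expr.eval_cell,
          h35, h36]
        exact ⟨⟨by norm_num, ca⟩, ⟨by norm_num, cb⟩, ⟨by norm_num, ca⟩, ⟨by norm_num, cb⟩,
          by omega⟩) (by decide) ?_)
  refine Runs.seq (Runs.set hW (b : ℤ) (by simp [h36])
    (by simp [h36]; omega) (by decide) ?_)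
  refine Runs.set hW ((a % b : ℕ) : ℤ) (by simp)
    (by simp only [Expr.safe_cell]
        simp (disch := omega) only [Function.update_of_ne, Function.update_self]
        exact ⟨by norm_num, cm⟩) (by decide) ?_
  refine ⟨rfl, by simp, by simp, fun i hi => ?_⟩
  simp (disch := omega) only [Function.update_of_ne]

/-- Induction on `k`: the product of the two cells at least halves in each step by `mul_mod_halves`,
so `k` bounds the number of divisions. -/
theorem gcdLoop_runs {Γ : Program} {w Z : ℕ} (hW : WordBound w Z) :
    ∀ (k a b : ℕ) (σ : Memory), a ≤ Z → b < a → a * b < 2 ^ k → σ 35 = a → σ 36 = b →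
      Runs Γ w gcdLoop σ (fun t L τ => t ≤ (k + 1) * (gcdStep.size + 4) ∧ L = [] ∧
        τ 35 = (Nat.gcd a b : ℕ) ∧ ∀ i, (i < 35 ∨ 38 ≤ i) → τ i = σ i) := by
  intro k
  induction k with
  | zero =>
    intro a b σ haZ hba hk h35 h36
    obtain rfl : b = 0 := by
      by_contra hb
      have := Nat.mul_le_mul (show 1 ≤ a by omega) (show 1 ≤ b by omega)
      omega
    refine Runs.loop_unfold hW (by simp) (by simp [h36]) (by decide) (fun hc => ?_) fun _ => ?_
    · simp [h36] at hc
    · refine ⟨?_, rfl, by simp [h35], fun _ _ => rfl⟩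
      simp only [Expr.cell, Expr.cost]
      omega
  | succ k ih =>
    intro a b σ haZ hba hk h35 h36
    refine Runs.loop_unfold hW (by simp) (by simp [h36]; omega) (by decide) (fun hc => ?_)
      fun hc => ?_
    · have hb : 1 ≤ b := by
        simp only [Expr.eval_one, Expr.eval_cell, h36] at hc
        exact_mod_cast hc
      refine (gcdStep_runs hW haZ hb hba h35 h36).mono ?_
      rintro t L σ' ⟨ht, rfl, g35, g36, gfr⟩
      refine (ih b (a % b) σ' (by omega) (Nat.mod_lt a hb) (mul_mod_halves hb hba hk)
        g35 g36).mono ?_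
      rintro t' L' τ ⟨ht', rfl, k35, kfr⟩
      refine ⟨?_, rfl, ?_, fun i hi => by rw [kfr i hi, gfr i hi]⟩
      · simp only [Expr.cell, Expr.cost, Nat.succ_mul (k + 1)]
        omega
      · rw [k35, Nat.gcd_comm b, ← Nat.gcd_rec, Nat.gcd_comm]
    · obtain rfl : b = 0 := by
        simp only [Expr.eval_one, Expr.eval_cell, h36] at hc
        omega
      refine ⟨?_, rfl, by simp [h35], fun _ _ => rfl⟩
      simp only [Expr.cell, Expr.cost, Nat.succ_mul (k + 1)]
      omega

/-! ### Sums over the small directions in the order of the loops. -/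

section DirectionSum

variable {M : Type*} [AddCommMonoid M] (f : ℕ × ℕ → M)

/-- The sum over the primitive directions `(u, v)` with `v ≤ k`. -/
def directionVSum (u k : ℕ) : M :=
  ∑ v ∈ Finset.range k, if Nat.gcd u (v + 1) = 1 then f (u, v + 1) else 0

/-- The sum over the primitive directions `(u, v)` with `v < u ≤ k`. -/
def directionUSum (k : ℕ) : M := ∑ i ∈ Finset.range k, directionVSum f (i + 1) i

theorem directionUSum_eq (n : ℕ) :
    directionUSum f (threshold n) = ∑ d ∈ smallDirections n, f d := by
  rw [smallDirections, Finset.sum_filter, Finset.sum_product, directionUSum,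
    ← sum_range_succ_eq_sum_Icc]
  refine Finset.sum_congr rfl fun i hi => ?_
  rw [Finset.mem_range] at hi
  rw [directionVSum, sum_range_succ_eq_sum_Icc i
    (fun v => if Nat.gcd (i + 1) v = 1 then f (i + 1, v) else 0),
    ← Finset.sum_subset (Finset.Icc_subset_Icc_right hi.le)]
  · refine Finset.sum_congr rfl fun v hv => ?_
    have := (Finset.mem_Icc.1 hv).2
    simp only [show v < i + 1 by omega, true_and]
  · intro v hv hv'
    simp only [Finset.mem_Icc] at hv hv'
    rw [if_neg]
    simp only
    omega

end DirectionSum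

/-- There are at most `n²` terms, each at most `4n²`: from `(x-y)(u-v) ≥ 0` one gets `xv+yu ≤ xu+yv
≤ n`, so both factors lie in `[0, n]`. -/
theorem abs_directionContribution_le {n u v : ℕ} (hvu : v ≤ u) :
    |directionContribution n u v| ≤ ((n + 2) ^ 6 : ℕ) := by
  have h1 : ∀ p ∈ (Finset.Icc 1 n ×ˢ Finset.Icc 1 n).filter
      (fun p => p.2 ≤ p.1 ∧ p.1 * u + p.2 * v ≤ n),
      |sideMult p.1 p.2 * ((n : ℤ) - p.1 * u - p.2 * v) * ((n : ℤ) - p.1 * v - p.2 * u)| ≤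
        4 * (n * n) := by
    rintro ⟨x, y⟩ hp
    obtain ⟨-, hyx, hle⟩ := Finset.mem_filter.1 hp
    simp only at hyx hle ⊢
    have h2 : (x : ℤ) * u + y * v ≤ n := by exact_mod_cast hle
    have h3 : (x : ℤ) * v + y * u ≤ x * u + y * v := by
      have e1 : (y : ℤ) ≤ x := by exact_mod_cast hyx
      have e2 : (v : ℤ) ≤ u := by exact_mod_cast hvu
      nlinarith [mul_nonneg (sub_nonneg.2 e1) (sub_nonneg.2 e2)]
    have p1 : (0 : ℤ) ≤ x * u := by positivity
    have p2 : (0 : ℤ) ≤ y * v := by positivity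
    have p3 : (0 : ℤ) ≤ x * v := by positivity
    have p4 : (0 : ℤ) ≤ y * u := by positivity
    rw [mul_assoc, abs_mul, abs_mul]
    have a1 : |(n : ℤ) - x * u - y * v| ≤ n := by rw [abs_le]; constructor <;> linarith
    have a2 : |(n : ℤ) - x * v - y * u| ≤ n := by rw [abs_le]; constructor <;> linarith
    exact mul_le_mul (abs_sideMult_le x y) (mul_le_mul a1 a2 (abs_nonneg _) (by positivity))
      (by positivity) (by norm_num)
  refine (Finset.abs_sum_le_sum_abs _ _).trans ((Finset.sum_le_card_nsmul _ _ _ h1).trans ?_)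
  have h2 : ((Finset.Icc 1 n ×ˢ Finset.Icc 1 n).filter
      (fun p => p.2 ≤ p.1 ∧ p.1 * u + p.2 * v ≤ n)).card ≤ n * n := by
    refine (Finset.card_filter_le _ _).trans ?_
    rw [Finset.card_product, Nat.card_Icc]
    simp
  rw [nsmul_eq_mul]
  have h3 : n * n * (4 * (n * n)) ≤ (n + 2) ^ 6 := by
    calc n * n * (4 * (n * n)) ≤ (n + 2) * (n + 2) * ((n + 2) * (n + 2) * ((n + 2) * (n + 2))) := by
          have : 4 ≤ (n + 2) * (n + 2) := by nlinarith
          gcongr <;> omega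
      _ = _ := by ring
  have h4 := (Nat.mul_le_mul_right (4 * (n * n)) h2).trans h3
  exact_mod_cast h4

/-- The bound for the cost of the direction procedure. -/
def directionCallCost (n : ℕ) : ℕ :=
  (directionBody.size + kernelCost + 2) * (Nat.log 2 n + 1)

open Stmt Expr in
/-- Adds the contribution of the direction in the cells `33, 34`, if it is primitive. -/
def directionAdd : Stmt :=
  Stmt.ite (cell 35) 1
    (set 0 (cell 30) ;; set 1 (cell 33) ;; set 2 (cell 34) ;; Stmt.call 1 ;;
      set 32 (cell 32 + cell 0)) Stmt.skip ;;
  set 34 (cell 34 + 1)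

open Stmt Expr in
/-- The treatment of one pair `(u, v)`. -/
def directionStep : Stmt := (set 35 (cell 33) ;; set 36 (cell 34)) ;; gcdLoop ;; directionAdd

open Stmt Expr in
/-- The treatment of one `u`. -/
def directionU : Stmt :=
  set 34 1 ;; Stmt.loop (cell 34 + 1) (cell 33) directionStep ;; set 33 (cell 33 + 1)

open Stmt Expr in
/-- The treatment of the small directions. -/
def directionPhase : Stmt := set 33 1 ;; Stmt.loop (cell 33) (cell 31) directionU

theorem directionAdd_runs {Γ : Program} {w Y n u v : ℕ} (hΓ : Γ[4]? = some recKernelBody)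
    (hΓ0 : Γ[0]? = some kernelBody) (hΓ1 : Γ[1]? = some directionBody) (hY : (n + 2) ^ 8 ≤ Y)
    (hW : WordBound w (Y ^ 10)) {σ : Memory} (hv : 1 ≤ v) (hvu : v < u) (hun : u ≤ n)
    (h30 : σ 30 = n) (h32 : |σ 32| ≤ ((Y ^ 10 : ℕ) : ℤ)) (h33 : σ 33 = u) (h34 : σ 34 = v)
    (h35 : σ 35 = (Nat.gcd u v : ℕ)) :
    Runs Γ w directionAdd σ (fun t L τ => t ≤ directionAdd.size + directionCallCost n ∧
      CallsGood n (directionCallCost n) L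
        (if Nat.gcd u v = 1 then {((n : ℤ), (u : ℤ), (v : ℤ))} else 0) 0 ∧
      τ 32 = σ 32 + (if Nat.gcd u v = 1 then directionContribution n u v else 0) ∧
      τ 34 = (v + 1 : ℕ) ∧ ∀ i, (i = 30 ∨ i = 31 ∨ i = 33) → τ i = σ i) := by
  have hY8 : (n + 2) ^ 6 ≤ Y := (Nat.pow_le_pow_right (by omega) (by norm_num)).trans hY
  have hYn : 2 * (n + 2) ≤ Y := by
    refine le_trans ?_ hY8
    have : 2 ≤ (n + 2) ^ 5 := (show 2 ≤ n + 2 by omega).trans (Nat.le_self_pow (by norm_num) _)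
    rw [pow_succ]; exact Nat.mul_le_mul_right _ this
  have hYZ : Y ≤ Y ^ 10 := Nat.le_self_pow (by norm_num) Y
  have hgu : Nat.gcd u v ≤ u := Nat.gcd_le_left v (by omega)
  have hg0 : 0 < Nat.gcd u v := Nat.gcd_pos_of_pos_left v (by omega)
  have hcon : |directionContribution n u v| ≤ ((Y ^ 10 : ℕ) : ℤ) :=
    (abs_directionContribution_le hvu.le).trans (by exact_mod_cast hY8.trans hYZ)
  have hW' := hW
  obtain ⟨Z, hZ⟩ : ∃ Z, Z = Y ^ 10 := ⟨_, rfl⟩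
  rw [← hZ] at hYZ hcon h32 hW
  suffices h : Runs Γ w directionAdd σ (fun _ L τ => callCost L ≤ directionCallCost n ∧
      CallsGood n (directionCallCost n) L
        (if Nat.gcd u v = 1 then {((n : ℤ), (u : ℤ), (v : ℤ))} else 0) 0 ∧
      τ 32 = σ 32 + (if Nat.gcd u v = 1 then directionContribution n u v else 0) ∧
      τ 34 = (v + 1 : ℕ) ∧ ∀ i, (i = 30 ∨ i = 31 ∨ i = 33) → τ i = σ i) by
    refine (h.with_cost (by decide)).mono ?_
    rintro t L τ ⟨ht, hL, h⟩
    exact ⟨by omega, h⟩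
  have fin : ∀ (L : List CallRecord) (σ₂ : Memory), σ₂ 34 = v →
      callCost L ≤ directionCallCost n →
      CallsGood n (directionCallCost n) L
        (if Nat.gcd u v = 1 then {((n : ℤ), (u : ℤ), (v : ℤ))} else 0) 0 →
      σ₂ 32 = σ 32 + (if Nat.gcd u v = 1 then directionContribution n u v else 0) →
      (∀ i, (i = 30 ∨ i = 31 ∨ i = 33) → σ₂ i = σ i) →
      Runs Γ w (Stmt.set 34 (Expr.cell 34 + 1)) σ₂ (fun _ L' τ =>
        callCost (L ++ L') ≤ directionCallCost n ∧
        CallsGood n (directionCallCost n) (L ++ L')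
          (if Nat.gcd u v = 1 then {((n : ℤ), (u : ℤ), (v : ℤ))} else 0) 0 ∧
        τ 32 = σ 32 + (if Nat.gcd u v = 1 then directionContribution n u v else 0) ∧
        τ 34 = (v + 1 : ℕ) ∧ ∀ i, (i = 30 ∨ i = 31 ∨ i = 33) → τ i = σ i) := by
    intro L σ₂ e34 hL hG e32 efr
    refine Runs.set hW ((v + 1 : ℕ) : ℤ) (by simp [e34]) (by simp [e34]; omega) (by decide) ?_
    refine ⟨by simpa using hL, by simpa using hG, by simpa using e32, by simp, fun i hi => ?_⟩
    rw [Function.update_of_ne (by omega), efr i hi]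
  refine Runs.seq (Runs.ite hW (by simp [h35]; omega) (by simp) (by decide) ?_ ?_)
  · intro hc
    have hg : Nat.gcd u v = 1 := by
      simp only [Expr.eval_one, Expr.eval_cell, h35] at hc
      have : Nat.gcd u v ≤ 1 := by exact_mod_cast hc
      omega
    refine Runs.seq (Runs.set hW (n : ℤ) (by simp [h30]) (by simp [h30]; omega) (by decide) ?_)
    refine Runs.seq (Runs.set hW (u : ℤ) (by simp [h33]) (by simp [h33]; omega) (by decide) ?_)
    refine Runs.seq (Runs.set hW (v : ℤ) (by simp [h34]) (by simp [h34]; omega) (by decide) ?_)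
    refine Runs.seq (Runs.call hΓ1 ((directionBody_runs hΓ hΓ0 (by omega) hW' hv hvu.le
      (n := n) (by omega) (by omega) (by simp) (by simp) (by simp)).mono ?_))
    rintro t L τ ⟨ht, -, -, hcost, hτ0, hfr⟩
    have hfr' : ∀ i, 24 ≤ i → i < 64 → τ i = σ i := fun i hi hi' => by
      rw [hfr i hi hi']
      simp (disch := omega) only [Function.update_of_ne]
    have ht' : t + 1 ≤ directionCallCost n := by
      have h1 : directionCallCost n = kernelCost * (Nat.log 2 n + 1) +
        (directionBody.size + 2) * (Nat.log 2 n + 1) := by rw [directionCallCost]; ring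
      have h2 := Nat.mul_le_mul_left (directionBody.size + 2) (show 1 ≤ Nat.log 2 n + 1 by omega)
      omega
    refine Runs.set hW (σ 32 + directionContribution n u v)
      (by simp [hτ0, hfr' 32]) (by simp [hτ0, hfr' 32, h32, hcon]) (by decide) ?_
    refine fin _ _ ?_ ?_ ?_ ?_ fun i hi => ?_
    · rw [Function.update_of_ne (by norm_num), hfr' 34 (by norm_num) (by norm_num), h34]
    · simpa using ht'
    · rw [if_pos hg]
      refine ⟨by simp [directionCalls], by simp [prefixCalls], ?_, by simp⟩
      intro r hr _
      simp only [List.nil_append, List.append_nil, List.mem_singleton] at hr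
      subst hr
      exact ⟨u, v, by simp, by simp, hτ0, ht'⟩
    · rw [if_pos hg, Function.update_self]
    · rw [Function.update_of_ne (by omega), hfr' i (by omega) (by omega)]
  · intro hc
    have hg : ¬ Nat.gcd u v = 1 := by
      simp only [Expr.eval_one, Expr.eval_cell, h35] at hc
      have : 1 < Nat.gcd u v := by exact_mod_cast hc
      omega
    refine Runs.skip (fin _ _ h34 (by simp) ?_ ?_ fun i hi => rfl)
    · rw [if_neg hg]; exact CallsGood.nil _ _
    · rw [if_neg hg, add_zero]

/-- The bound for the cost of the treatment of one pair `(u, v)`. -/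
def directionStepCost (n : ℕ) : ℕ :=
  (2 * (Nat.log 2 n + 1) + 1) * (gcdStep.size + 4) + directionAdd.size + directionCallCost n + 11

/-- The direction query for a pair `(u, v)`. -/
def directionQuery (n : ℕ) (d : ℕ × ℕ) : Multiset (ℤ × ℤ × ℤ) :=
  {((n : ℤ), (d.1 : ℤ), (d.2 : ℤ))}

/-- The contribution of a pair `(u, v)`. -/
def directionTerm (n : ℕ) (d : ℕ × ℕ) : ℤ := directionContribution n d.1 d.2

theorem abs_directionVSum_le {n u k : ℕ} (hk : k < u) :
    |directionVSum (directionTerm n) u k| ≤ k * ((n + 2) ^ 6 : ℕ) := by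
  refine abs_sum_range_le fun i hi => ?_
  split_ifs
  · exact abs_directionContribution_le (show i + 1 ≤ u by omega)
  · simp only [abs_zero]; positivity

theorem abs_directionUSum_le {n k : ℕ} (hk : k ≤ n) :
    |directionUSum (directionTerm n) k| ≤ k * (n * ((n + 2) ^ 6 : ℕ)) := by
  refine abs_sum_range_le fun i hi => (abs_directionVSum_le (by omega)).trans ?_
  exact_mod_cast Nat.mul_le_mul_right _ (show i ≤ n by omega)

section

variable {Γ : Program} {w Y n : ℕ}

theorem directionStep_runs {u v : ℕ} (hΓ : Γ[4]? = some recKernelBody)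
    (hΓ0 : Γ[0]? = some kernelBody) (hΓ1 : Γ[1]? = some directionBody) (hY : (n + 2) ^ 8 ≤ Y)
    (hW : WordBound w (Y ^ 10)) {σ : Memory} (hv : 1 ≤ v) (hvu : v < u) (hun : u ≤ n)
    (h30 : σ 30 = n) (h32 : |σ 32| ≤ ((Y ^ 10 : ℕ) : ℤ)) (h33 : σ 33 = u) (h34 : σ 34 = v) :
    Runs Γ w directionStep σ (fun t L τ => t ≤ directionStepCost n ∧
      CallsGood n (directionCallCost n) L
        (if Nat.gcd u v = 1 then directionQuery n (u, v) else 0) 0 ∧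
      τ 32 = σ 32 + (if Nat.gcd u v = 1 then directionTerm n (u, v) else 0) ∧
      τ 34 = (v + 1 : ℕ) ∧ ∀ i, (i = 30 ∨ i = 31 ∨ i = 33) → τ i = σ i) := by
  have hYn : n + 2 ≤ Y ^ 10 :=
    (Nat.le_self_pow (by norm_num) _).trans (hY.trans (Nat.le_self_pow (by norm_num) Y))
  have hlog : ∀ a ≤ n, a < 2 ^ (Nat.log 2 n + 1) := fun a ha =>
    ha.trans_lt (Nat.lt_pow_succ_log_self (by norm_num) n)
  have hk : u * v < 2 ^ (2 * (Nat.log 2 n + 1)) := by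
    rw [two_mul, pow_add]
    exact Nat.mul_lt_mul'' (hlog u hun) (hlog v (by omega))
  have cu := abs_natCast_le (show u ≤ Y ^ 10 by omega)
  have cv := abs_natCast_le (show v ≤ Y ^ 10 by omega)
  refine Runs.seq (Runs.seq (Runs.set hW (u : ℤ) (by simp [h33])
    (by simp only [Expr.safe_cell, h33]; exact ⟨by norm_num, cu⟩) (by decide)
    (Runs.set hW (v : ℤ) (by simp [h34])
      (by simp only [Expr.safe_cell]
          rw [Function.update_of_ne (by norm_num), h34]; exact ⟨by norm_num, cv⟩) (by decide) ?_)))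
  refine Runs.seq ((gcdLoop_runs hW _ u v _ (by omega) hvu hk (by simp) (by simp)).mono ?_)
  rintro t L σ₁ ⟨ht, rfl, g35, gfr⟩
  have gfr' : ∀ i < 35, σ₁ i = σ i := fun i hi => by
    rw [gfr i (by omega)]
    simp (disch := omega) only [Function.update_of_ne]
  refine (directionAdd_runs hΓ hΓ0 hΓ1 hY hW hv hvu hun (by rw [gfr' 30 (by omega), h30])
    (by rw [gfr' 32 (by omega)]; exact h32) (by rw [gfr' 33 (by omega), h33])
    (by rw [gfr' 34 (by omega), h34]) g35).mono ?_
  rintro t' L' τ ⟨ht', kL, k32, k34, kfr⟩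
  refine ⟨?_, kL, by rw [k32, gfr' 32 (by omega)]; rfl, k34, fun i hi => ?_⟩
  · simp only [Expr.cell, Expr.cost, directionStepCost]
    omega
  · rw [kfr i hi, gfr' i (by omega)]

theorem directionU_runs {u : ℕ} (hΓ : Γ[4]? = some recKernelBody)
    (hΓ0 : Γ[0]? = some kernelBody) (hΓ1 : Γ[1]? = some directionBody) (hY : (n + 2) ^ 8 ≤ Y)
    (hW : WordBound w (Y ^ 10)) {σ : Memory} (hu : 1 ≤ u) (hun : u ≤ n)
    (h30 : σ 30 = n) (h32 : |σ 32| + ((n + 2) ^ 7 : ℕ) ≤ ((Y ^ 10 : ℕ) : ℤ)) (h33 : σ 33 = u) :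
    Runs Γ w directionU σ (fun t L τ => t ≤ u * (directionStepCost n + 7) + 19 ∧
      CallsGood n (directionCallCost n) L (directionVSum (directionQuery n) u (u - 1)) 0 ∧
      τ 32 = σ 32 + directionVSum (directionTerm n) u (u - 1) ∧
      τ 33 = (u + 1 : ℕ) ∧ ∀ i, (i = 30 ∨ i = 31) → τ i = σ i) := by
  have hYn : n + 2 ≤ Y ^ 10 :=
    (Nat.le_self_pow (by norm_num) _).trans (hY.trans (Nat.le_self_pow (by norm_num) Y))
  have cu := abs_natCast_le (show u ≤ Y ^ 10 by omega)
  refine Runs.seq (Runs.set hW 1 (by simp) (by simp) (by decide) ?_)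
  refine Runs.seq (Runs.loop hW (by decide) (u - 1)
    (fun k t L σ' => t ≤ k * (directionStepCost n + 7) ∧
      CallsGood n (directionCallCost n) L (directionVSum (directionQuery n) u k) 0 ∧
      σ' 32 = σ 32 + directionVSum (directionTerm n) u k ∧ σ' 34 = (k + 1 : ℕ) ∧
      ∀ i, (i = 30 ∨ i = 31 ∨ i = 33) → σ' i = σ i) ?_ ?_ ?_ ?_)
  · refine ⟨by simp, CallsGood.nil n _, by simp [directionVSum], by simp, fun i hi => ?_⟩
    rw [Function.update_of_ne (by omega)]
  · rintro k t L σ' hk ⟨-, -, -, g34, gfr⟩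
    have ck := abs_natCast_le (show k + 1 ≤ Y ^ 10 by omega)
    simp only [Expr.safe_add, Expr.safe_cell, Expr.eval_add, Expr.eval_one, Expr.eval_cell, g34,
      gfr 33 (by omega), h33]
    exact ⟨⟨⟨by norm_num, ck⟩, by simp⟩, ⟨by norm_num, cu⟩, by push_cast; omega⟩
  · rintro k t L σ' hk ⟨ht, gL, g32, g34, gfr⟩
    have hacc : |σ' 32| ≤ ((Y ^ 10 : ℕ) : ℤ) := by
      rw [g32]
      refine (abs_add_le _ _).trans (le_trans ?_ h32)
      have h1 := abs_directionVSum_le (n := n) (show k < u by omega)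
      have h2 : k * (n + 2) ^ 6 ≤ (n + 2) ^ 7 := by
        rw [pow_succ' (n + 2) 6]; exact Nat.mul_le_mul_right _ (by omega)
      have h3 : (k : ℤ) * ((n + 2) ^ 6 : ℕ) ≤ ((n + 2) ^ 7 : ℕ) := by exact_mod_cast h2
      linarith
    refine (directionStep_runs (v := k + 1) hΓ hΓ0 hΓ1 hY hW (by omega) (by omega) hun
      (by rw [gfr 30 (by omega), h30]) hacc (by rw [gfr 33 (by omega), h33]) g34).mono ?_
    rintro t' L' τ ⟨ht', kL, k32, k34, kfr⟩
    refine ⟨?_, ?_, ?_, k34, fun i hi => by rw [kfr i hi, gfr i hi]⟩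
    · simp only [Expr.cell, Expr.cost, Nat.succ_mul k]
      omega
    · have := gL.append kL
      rw [add_zero] at this
      rw [directionVSum, Finset.sum_range_succ]
      exact this
    · rw [k32, g32, directionVSum, directionVSum, Finset.sum_range_succ, add_assoc]
  · rintro t L σ' ⟨ht, gL, g32, g34, gfr⟩
    have e33 : σ' 33 = u := by rw [gfr 33 (by omega), h33]
    refine Runs.set hW ((u + 1 : ℕ) : ℤ) (by simp [e33])
      (by simp only [Expr.safe_add, Expr.safe_cell, e33]; exact ⟨⟨by norm_num, cu⟩, by simp⟩)
      (by decide) ?_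
    refine ⟨?_, by simpa using gL, by simpa using g32, by simp, fun i hi => ?_⟩
    · have h1 : (u - 1) * (directionStepCost n + 7) ≤ u * (directionStepCost n + 7) :=
        Nat.mul_le_mul_right _ (by omega)
      simp only [Expr.cell, Expr.cost]
      omega
    · rw [Function.update_of_ne (by omega), gfr i (by omega)]

theorem directionPhase_runs {B : ℕ} (hΓ : Γ[4]? = some recKernelBody)
    (hΓ0 : Γ[0]? = some kernelBody) (hΓ1 : Γ[1]? = some directionBody) (hY : (n + 2) ^ 8 ≤ Y)
    (hW : WordBound w (Y ^ 10)) {σ : Memory} (hB : B ≤ n) (h30 : σ 30 = n) (h31 : σ 31 = B)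
    (h32 : |σ 32| + ((n + 2) ^ 9 : ℕ) ≤ ((Y ^ 10 : ℕ) : ℤ)) :
    Runs Γ w directionPhase σ (fun t L τ =>
      t ≤ B * (B * (directionStepCost n + 7) + 24) + 9 ∧
      CallsGood n (directionCallCost n) L (directionUSum (directionQuery n) B) 0 ∧
      τ 32 = σ 32 + directionUSum (directionTerm n) B ∧ τ 30 = n) := by
  have hYn : n + 2 ≤ Y ^ 10 :=
    (Nat.le_self_pow (by norm_num) _).trans (hY.trans (Nat.le_self_pow (by norm_num) Y))
  have cB := abs_natCast_le (show B ≤ Y ^ 10 by omega)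
  refine Runs.seq (Runs.set hW 1 (by simp) (by simp) (by decide) ?_)
  refine Runs.loop hW (by decide) B
    (fun k t L σ' => t ≤ k * (B * (directionStepCost n + 7) + 24) ∧
      CallsGood n (directionCallCost n) L (directionUSum (directionQuery n) k) 0 ∧
      σ' 32 = σ 32 + directionUSum (directionTerm n) k ∧ σ' 33 = (k + 1 : ℕ) ∧
      ∀ i, (i = 30 ∨ i = 31) → σ' i = σ i) ?_ ?_ ?_ ?_
  · refine ⟨by simp, CallsGood.nil n _, by simp [directionUSum], by simp, fun i hi => ?_⟩
    rw [Function.update_of_ne (by omega)]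
  · rintro k t L σ' hk ⟨-, -, -, g33, gfr⟩
    have ck := abs_natCast_le (show k + 1 ≤ Y ^ 10 by omega)
    simp only [Expr.safe_cell, Expr.eval_cell, g33, gfr 31 (by omega), h31]
    exact ⟨⟨by norm_num, ck⟩, ⟨by norm_num, cB⟩, by rw [Nat.cast_le]; rfl⟩
  · rintro k t L σ' hk ⟨ht, gL, g32, g33, gfr⟩
    have hacc : |σ' 32| + ((n + 2) ^ 7 : ℕ) ≤ ((Y ^ 10 : ℕ) : ℤ) := by
      have h0 : |σ' 32| ≤ |σ 32| + |directionUSum (directionTerm n) k| := by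
        rw [g32]; exact abs_add_le _ _
      have h1 := abs_directionUSum_le (n := n) (show k ≤ n by omega)
      have h2 : k * (n * (n + 2) ^ 6) + (n + 2) ^ 7 ≤ (n + 2) ^ 9 := by
        have e1 : (n + 2) ^ 7 = (n + 2) * (n + 2) ^ 6 := pow_succ' _ _
        have e2 : (n + 2) ^ 8 = (n + 2) * (n + 2) * (n + 2) ^ 6 := by ring
        have e3 : (n + 2) ^ 8 ≤ (n + 2) ^ 9 := Nat.pow_le_pow_right (by omega) (by norm_num)
        refine le_trans ?_ e3
        rw [e1, e2, ← mul_assoc, ← add_mul]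
        refine Nat.mul_le_mul_right _ ?_
        have : k * n ≤ n * n := Nat.mul_le_mul_right _ (by omega)
        nlinarith
      have h3 : (k : ℤ) * (n * ((n + 2) ^ 6 : ℕ)) + ((n + 2) ^ 7 : ℕ) ≤ ((n + 2) ^ 9 : ℕ) := by
        exact_mod_cast h2
      linarith
    refine (directionU_runs (u := k + 1) hΓ hΓ0 hΓ1 hY hW (by omega) (by omega)
      (by rw [gfr 30 (by omega), h30]) hacc g33).mono ?_
    rintro t' L' τ ⟨ht', kL, k32, k33, kfr⟩
    refine ⟨?_, ?_, ?_, k33, fun i hi => by rw [kfr i hi, gfr i hi]⟩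
    · have h1 : (k + 1) * (directionStepCost n + 7) ≤ B * (directionStepCost n + 7) :=
        Nat.mul_le_mul_right _ hk
      simp only [Expr.cell, Expr.cost, Nat.succ_mul k (B * (directionStepCost n + 7) + 24)]
      omega
    · have := gL.append kL
      rw [add_zero] at this
      rw [directionUSum, Finset.sum_range_succ]
      exact this
    · rw [k32, g32, directionUSum, directionUSum, Finset.sum_range_succ, add_assoc]
      rfl
  · rintro t L σ' ⟨ht, gL, g32, -, gfr⟩
    refine ⟨?_, by simpa using gL, g32, by rw [gfr 30 (by omega), h30]⟩
    simp only [Expr.cell, Expr.cost]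
    omega

end

/-! ## The main procedure -/

/-- Cubing `k + 1 ≤ n^(2/3)` removes the real power; the machine finds the threshold by a linear
search with this integer test. -/
theorem lt_threshold_iff (n k : ℕ) : k < threshold n ↔ (k + 1) ^ 3 ≤ n ^ 2 := by
  have h0 : (0 : ℝ) ≤ (n : ℝ) ^ (2 / 3 : ℝ) := by positivity
  have h1 : ((n : ℝ) ^ (2 / 3 : ℝ)) ^ 3 = (n : ℝ) ^ 2 := by
    rw [← Real.rpow_natCast, ← Real.rpow_natCast, ← Real.rpow_mul (Nat.cast_nonneg n)]
    norm_num
  rw [← Nat.add_one_le_iff, threshold, Nat.le_floor_iff h0,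
    ← pow_le_pow_iff_left₀ (Nat.cast_nonneg _) h0 (show 3 ≠ 0 by norm_num), h1]
  exact_mod_cast Iff.rfl

open Stmt Expr in
/-- Computes the threshold. -/
def thresholdPhase : Stmt :=
  set 30 (cell 0) ;;
  Stmt.loop ((cell 31 + 1) * (cell 31 + 1) * (cell 31 + 1)) (cell 30 * cell 30)
    (set 31 (cell 31 + 1))

open Stmt Expr in
/-- Adds the boundary term. -/
def boundaryPhase : Stmt :=
  set 0 (cell 32 + (3 * (cell 30 * cell 30) * ((cell 30 - 1) * (cell 30 - 1)) +
    cell 30 * ((cell 30 - 1) * (cell 30 - 1)) * (cell 30 - 2)) / 12)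

/-- The main procedure. -/
def mainBody : Stmt :=
  thresholdPhase ;; sieve ;; dualPhase ;; directionPhase ;; boundaryPhase

theorem thresholdPhase_runs {Γ : Program} {w Z n : ℕ} (hW : WordBound w Z) (hZ : n + 2 ≤ Z)
    {σ : Memory} (h0 : σ 0 = n) (h31 : σ 31 = 0) :
    Runs Γ w thresholdPhase σ (fun t L τ => t ≤ threshold n * 30 + 30 ∧ L = [] ∧ τ 30 = n ∧
      τ 31 = threshold n ∧ ∀ i, (i ≠ 30 ∧ i ≠ 31) → τ i = σ i) := by
  have hB := threshold_le n
  refine Runs.seq (Runs.set hW (n : ℤ) (by simp [h0]) (by simp [h0]; omega) (by decide) ?_)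
  refine Runs.loop hW (by decide) (threshold n)
    (fun k t L σ' => t ≤ k * 30 ∧ L = [] ∧ σ' 30 = n ∧ σ' 31 = k ∧
      ∀ i, (i ≠ 30 ∧ i ≠ 31) → σ' i = σ i) ?_ ?_ ?_ ?_
  · refine ⟨by simp, rfl, by simp, by simp [h31], fun i hi => ?_⟩
    rw [Function.update_of_ne hi.1]
  · rintro k t L σ' hk ⟨-, -, g30, g31, -⟩
    simp only [Expr.safe_add, Expr.safe_mul, Expr.safe_cell, Expr.eval_add, Expr.eval_mul,
      Expr.eval_one, Expr.eval_cell, g30, g31]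
    refine ⟨?_, ?_, ?_⟩
    · simp; omega
    · simp; omega
    · rw [lt_threshold_iff, pow_succ, pow_two, pow_two]
      exact_mod_cast Iff.rfl
  · rintro k t L σ' hk ⟨ht, rfl, g30, g31, gfr⟩
    refine Runs.set hW ((k + 1 : ℕ) : ℤ) (by simp [g31]) (by simp [g31]; omega) (by decide) ?_
    refine ⟨?_, rfl, by simpa using g30, by simp, fun i hi => ?_⟩
    · simp only [Expr.cell, Expr.cost]
      omega
    · rw [Function.update_of_ne hi.2, gfr i hi]
  · rintro t L σ' ⟨ht, rfl, g30, g31, gfr⟩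
    refine ⟨?_, rfl, g30, g31, gfr⟩
    simp only [Expr.cell, Expr.cost]
    omega

/-- The bound for the cost of the main procedure. -/
noncomputable def mainCost (n : ℕ) : ℕ :=
  threshold n * 30 + (sieveCost * ∑ d ∈ Finset.range n, n / (d + 1) + sieveCost) +
    (dualUCost + 5) * dualWork n (threshold n) (n - threshold n) +
    threshold n * (threshold n * (directionStepCost n + 7) + 24) + 200

/-- Twelve times the boundary count. -/
def boundaryNumerator (n : ℤ) : ℤ :=
  3 * (n * n) * ((n - 1) * (n - 1)) + n * ((n - 1) * (n - 1)) * (n - 2)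

/-- The divisor table and the kernel stack both occupy the cells from `64` on. Therefore the large
directions, which need the table, come before the small ones, which overwrite it. -/
theorem mainBody_runs {Γ : Program} {w n : ℕ} (hΓ : Γ[4]? = some recKernelBody)
    (hΓ0 : Γ[0]? = some kernelBody) (hΓ1 : Γ[1]? = some directionBody)
    (hΓ2 : Γ[2]? = some prefixBody) (hW : WordBound w (((n + 2) ^ 8) ^ 10)) :
    Runs Γ w mainBody (initialMemory n) (fun t L τ => t ≤ mainCost n ∧
      CallsGood n (directionCallCost n) L (∑ d ∈ smallDirections n, directionQuery n d)
        (∑ s ∈ dualTriples n, tripleQuery n s) ∧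
      τ 0 = ∑ s ∈ dualTriples n, tripleTerm n s + ∑ d ∈ smallDirections n, directionTerm n d +
        boundaryNumerator n / 12) := by
  have hpow : ∀ k ≤ 80, (n + 2) ^ k ≤ ((n + 2) ^ 8) ^ 10 := fun k hk => by
    rw [← pow_mul]; exact Nat.pow_le_pow_right (by omega) hk
  have hn : n + 2 ≤ ((n + 2) ^ 8) ^ 10 := by simpa using hpow 1 (by norm_num)
  have hB := threshold_le n
  have cn := abs_natCast_le (show n ≤ ((n + 2) ^ 8) ^ 10 by omega)
  refine Runs.seq ((thresholdPhase_runs hW hn (by simp [initialMemory])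
    (by simp [initialMemory])).mono ?_)
  rintro t₁ L₁ σ₁ ⟨ht₁, rfl, a30, a31, afr⟩
  have a32 : σ₁ 32 = 0 := by rw [afr 32 (by norm_num)]; simp [initialMemory]
  refine Runs.seq ((sieve_runs hW (hpow 10 (by norm_num)) a30 fun i hi => ?_).mono ?_)
  · rw [afr i (by omega), initialMemory, Function.update_of_ne (by omega)]
  rintro t₂ L₂ σ₂ ⟨ht₂, rfl, hT, bfr⟩
  refine Runs.seq ((dualPhase_runs (T := directionCallCost n) hΓ2 hW (hpow 14 (by norm_num)) hT hB
    (by rw [bfr 30 (by norm_num), a30]) (by rw [bfr 31 (by norm_num), a31])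
    (by rw [bfr 32 (by norm_num), a32])).mono ?_)
  rintro t₃ L₃ σ₃ ⟨ht₃, cL, c32, cfr⟩
  have c30 : σ₃ 30 = n := by rw [cfr 30 (by omega), bfr 30 (by norm_num), a30]
  have hD : |σ₃ 32| ≤ ((n + 2) ^ 13 : ℕ) := by
    rw [c32]
    refine (abs_dualUSum_le _ _ _).trans ?_
    have : (n - threshold n) * (n * (n * (n + 2) ^ 10)) ≤
        (n + 2) * ((n + 2) * ((n + 2) * (n + 2) ^ 10)) := by gcongr <;> omega
    have e : (n + 2) ^ 13 = (n + 2) * ((n + 2) * ((n + 2) * (n + 2) ^ 10)) := by ring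
    rw [e]
    exact_mod_cast this
  refine Runs.seq ((directionPhase_runs hΓ hΓ0 hΓ1 le_rfl hW hB c30
    (by rw [cfr 31 (by omega), bfr 31 (by norm_num), a31]) ?_).mono ?_)
  · have h1 : (n + 2) ^ 13 + (n + 2) ^ 9 ≤ ((n + 2) ^ 8) ^ 10 := by
      have e1 : (n + 2) ^ 9 ≤ (n + 2) ^ 13 := Nat.pow_le_pow_right (by omega) (by norm_num)
      have e2 : 2 * (n + 2) ^ 13 ≤ (n + 2) ^ 14 := by
        rw [pow_succ' (n + 2) 13]; exact Nat.mul_le_mul_right _ (by omega)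
      have := hpow 14 (by norm_num)
      omega
    have h2 : (((n + 2) ^ 13 : ℕ) : ℤ) + ((n + 2) ^ 9 : ℕ) ≤ ((((n + 2) ^ 8) ^ 10 : ℕ) : ℤ) := by
      exact_mod_cast h1
    linarith
  rintro t₄ L₄ σ₄ ⟨ht₄, dL, d32, d30⟩
  have hE : |σ₄ 32| ≤ ((((n + 2) ^ 8) ^ 10 : ℕ) : ℤ) := by
    have h0 : |σ₄ 32| ≤ |σ₃ 32| + |directionUSum (directionTerm n) (threshold n)| := by
      rw [d32]; exact abs_add_le _ _
    have h1 := abs_directionUSum_le (n := n) hB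
    have h2 : (n + 2) ^ 13 + threshold n * (n * (n + 2) ^ 6) ≤ ((n + 2) ^ 8) ^ 10 := by
      have e1 : threshold n * (n * (n + 2) ^ 6) ≤ (n + 2) * ((n + 2) * (n + 2) ^ 6) := by
        gcongr <;> omega
      have e2 : (n + 2) * ((n + 2) * (n + 2) ^ 6) = (n + 2) ^ 8 := by ring
      have e3 : (n + 2) ^ 8 ≤ (n + 2) ^ 13 := Nat.pow_le_pow_right (by omega) (by norm_num)
      have e4 : 2 * (n + 2) ^ 13 ≤ (n + 2) ^ 14 := by
        rw [pow_succ' (n + 2) 13]; exact Nat.mul_le_mul_right _ (by omega)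
      have := hpow 14 (by norm_num)
      omega
    have h3 : (((n + 2) ^ 13 : ℕ) : ℤ) + threshold n * (n * ((n + 2) ^ 6 : ℕ)) ≤
        ((((n + 2) ^ 8) ^ 10 : ℕ) : ℤ) := by exact_mod_cast h2
    linarith
  refine Runs.set hW _ rfl (Expr.safe_of_simpleOn (l := [30, 32]) ?_ (by decide)) (by decide) ?_
  · intro i hi
    simp only [List.mem_cons, List.not_mem_nil, or_false] at hi
    rcases hi with rfl | rfl
    · rw [d30]; exact cn
    · exact hE
  refine ⟨?_, ?_, ?_⟩
  · have hs : boundaryPhase.size ≤ 60 := by decide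
    simp only [boundaryPhase, Stmt.set, Stmt.size, Expr.cell] at hs
    simp only [mainCost, Expr.cell]
    simp only [Expr.cost] at hs ⊢
    omega
  · have := cL.append dL
    rw [zero_add, add_zero, dualUSum_eq, directionUSum_eq] at this
    simpa using this
  · rw [dualUSum_eq] at c32
    rw [directionUSum_eq, c32] at d32
    simp [d32, d30, boundaryNumerator]

/-! ## Counting lattice rectangles -/

/-- The rectangle with side vectors `(x u, x v)` and `(-y v, y u)` and bounding box with lower
left corner `q`, for the index `((u, v), (x, y))`. -/
def boxedRectangle (d : (ℕ × ℕ) × ℕ × ℕ) (q : ℕ × ℕ) : Finset (ℤ × ℤ) :=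
  {((q.1 + d.2.2 * d.1.2 : ℤ), (q.2 : ℤ)),
    ((q.1 + d.2.2 * d.1.2 + d.2.1 * d.1.1 : ℤ), (q.2 + d.2.1 * d.1.2 : ℤ)),
    ((q.1 : ℤ), (q.2 + d.2.2 * d.1.1 : ℤ)),
    ((q.1 + d.2.1 * d.1.1 : ℤ), (q.2 + d.2.1 * d.1.2 + d.2.2 * d.1.1 : ℤ))}

/-- Primitive directions in the half-open first quadrant together with side lengths. -/
def rectangleShapes (n : ℕ) : Finset ((ℕ × ℕ) × ℕ × ℕ) :=
  (Finset.Icc 1 n ×ˢ Finset.range (n + 1)).filter (fun d => Nat.gcd d.1 d.2 = 1) ×ˢ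
    (Finset.Icc 1 n ×ˢ Finset.Icc 1 n)

/-- The number of positions of a shape in the square. -/
def shapePositions (n : ℕ) (d : (ℕ × ℕ) × ℕ × ℕ) : Finset (ℕ × ℕ) :=
  Finset.range (n - (d.2.1 * d.1.1 + d.2.2 * d.1.2)) ×ˢ
    Finset.range (n - (d.2.1 * d.1.2 + d.2.2 * d.1.1))

/-- The extreme coordinates of the vertices determine `q₁, q₂, a₁ + b₁, a₂ + b₂`. The vertex `(q₁ +
b₁, q₂)` is the leftmost one on the lower edge of the box, which gives `b₁`; confusing it with the
other candidate would force `a₁ = 0`. Confusing the vertex on the right edge with the top one would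
force `b₂ = 0`, which gives `a₂`. -/
theorem box_unique {q₁ q₂ a₁ a₂ b₁ b₂ r₁ r₂ c₁ c₂ d₁ d₂ : ℤ}
    (ha₁ : 0 < a₁) (ha₂ : 0 ≤ a₂) (hb₁ : 0 ≤ b₁) (hb₂ : 0 < b₂)
    (hc₁ : 0 < c₁) (hc₂ : 0 ≤ c₂) (hd₁ : 0 ≤ d₁) (hd₂ : 0 < d₂)
    (h : ({(q₁ + b₁, q₂), (q₁ + b₁ + a₁, q₂ + a₂), (q₁, q₂ + b₂), (q₁ + a₁, q₂ + a₂ + b₂)} :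
        Finset (ℤ × ℤ)) =
      {(r₁ + d₁, r₂), (r₁ + d₁ + c₁, r₂ + c₂), (r₁, r₂ + d₂), (r₁ + c₁, r₂ + c₂ + d₂)}) :
    q₁ = r₁ ∧ q₂ = r₂ ∧ a₁ = c₁ ∧ a₂ = c₂ ∧ b₁ = d₁ ∧ b₂ = d₂ := by
  have hm : ∀ z : ℤ × ℤ, (z = (q₁ + b₁, q₂) ∨ z = (q₁ + b₁ + a₁, q₂ + a₂) ∨ z = (q₁, q₂ + b₂) ∨
      z = (q₁ + a₁, q₂ + a₂ + b₂)) ↔ (z = (r₁ + d₁, r₂) ∨ z = (r₁ + d₁ + c₁, r₂ + c₂) ∨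
      z = (r₁, r₂ + d₂) ∨ z = (r₁ + c₁, r₂ + c₂ + d₂)) := by
    intro z
    have := congrArg (z ∈ ·) h
    simpa using this
  have x1 := (hm (q₁ + b₁, q₂)).1 (by simp)
  have x2 := (hm (q₁ + b₁ + a₁, q₂ + a₂)).1 (by simp)
  have x3 := (hm (q₁, q₂ + b₂)).1 (by simp)
  have x4 := (hm (q₁ + a₁, q₂ + a₂ + b₂)).1 (by simp)
  have y1 := (hm (r₁ + d₁, r₂)).2 (by simp)
  have y2 := (hm (r₁ + d₁ + c₁, r₂ + c₂)).2 (by simp)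
  have y3 := (hm (r₁, r₂ + d₂)).2 (by simp)
  have y4 := (hm (r₁ + c₁, r₂ + c₂ + d₂)).2 (by simp)
  clear hm h
  simp only [Prod.mk.injEq] at x1 x2 x3 x4 y1 y2 y3 y4
  have e1 : q₁ = r₁ := le_antisymm (by omega) (by omega)
  have e2 : q₂ = r₂ := le_antisymm (by omega) (by omega)
  have e3 : a₁ + b₁ = c₁ + d₁ := le_antisymm (by omega) (by omega)
  have e4 : a₂ + b₂ = c₂ + d₂ := le_antisymm (by omega) (by omega)
  clear x3 x4 y1 y2 y3 y4
  have e5 : b₁ = d₁ := by omega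
  have e6 : a₂ = c₂ := by omega
  omega

/-- The side vectors are determined by `box_unique`, and `x = gcd(xu, xv)` because `(u,v)` is
primitive; then `u`, `v` and `y` follow by cancellation. -/
theorem boxedRectangle_injective {d d' : (ℕ × ℕ) × ℕ × ℕ} {q q' : ℕ × ℕ}
    (hu : 1 ≤ d.1.1) (hx : 1 ≤ d.2.1) (hy : 1 ≤ d.2.2) (hg : Nat.gcd d.1.1 d.1.2 = 1)
    (hu' : 1 ≤ d'.1.1) (hx' : 1 ≤ d'.2.1) (hy' : 1 ≤ d'.2.2) (hg' : Nat.gcd d'.1.1 d'.1.2 = 1)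
    (h : boxedRectangle d q = boxedRectangle d' q') : d = d' ∧ q = q' := by
  obtain ⟨⟨u, v⟩, x, y⟩ := d
  obtain ⟨⟨u', v'⟩, x', y'⟩ := d'
  obtain ⟨q₁, q₂⟩ := q
  obtain ⟨r₁, r₂⟩ := q'
  simp only at hu hx hy hg hu' hx' hy' hg'
  obtain ⟨e1, e2, e3, e4, e5, e6⟩ := box_unique (by positivity) (by positivity) (by positivity)
    (by positivity) (by positivity) (by positivity) (by positivity) (by positivity) h
  have e1' : q₁ = r₁ := by exact_mod_cast e1
  have e2' : q₂ = r₂ := by exact_mod_cast e2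
  have e3' : x * u = x' * u' := by exact_mod_cast e3
  have e4' : x * v = x' * v' := by exact_mod_cast e4
  have e6' : y * u = y' * u' := by exact_mod_cast e6
  have ex : x = x' := by
    have := congrArg₂ Nat.gcd e3' e4'
    simpa [Nat.gcd_mul_left, hg, hg'] using this
  subst ex
  have eu : u = u' := Nat.eq_of_mul_eq_mul_left hx e3'
  have ev : v = v' := Nat.eq_of_mul_eq_mul_left hx e4'
  subst eu ev
  have ey : y = y' := Nat.eq_of_mul_eq_mul_right hu e6'
  subst ey e1' e2'
  exact ⟨rfl, rfl⟩

theorem rectangle_flip (p a b : ℤ × ℤ) :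
    ({p, p + a, p + b, p + a + b} : Finset (ℤ × ℤ)) =
      {p + a, p + a + -a, p + a + b, p + a + -a + b} := by
  ext z
  simp only [Finset.mem_insert, Finset.mem_singleton, add_neg_cancel_right]
  tauto

theorem rectangle_swap (p a b : ℤ × ℤ) :
    ({p, p + a, p + b, p + a + b} : Finset (ℤ × ℤ)) = {p, p + b, p + a, p + b + a} := by
  ext z
  simp only [Finset.mem_insert, Finset.mem_singleton, add_right_comm p b a]
  tauto

/-- The half-open first and second quadrants together contain exactly one of `a` and `-a`; passing
to `-a` moves the base point to `p + a`. -/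
theorem rectangle_upper (p b : ℤ × ℤ) {a : ℤ × ℤ} (ha : a ≠ 0) :
    ∃ p' a' : ℤ × ℤ, (a' = a ∨ a' = -a) ∧ (0 < a'.1 ∧ 0 ≤ a'.2 ∨ a'.1 ≤ 0 ∧ 0 < a'.2) ∧
      ({p, p + a, p + b, p + a + b} : Finset (ℤ × ℤ)) = {p', p' + a', p' + b, p' + a' + b} := by
  by_cases h : 0 < a.1 ∧ 0 ≤ a.2 ∨ a.1 ≤ 0 ∧ 0 < a.2
  · exact ⟨p, a, Or.inl rfl, h, rfl⟩
  · refine ⟨p + a, -a, Or.inr rfl, ?_, rectangle_flip p a b⟩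
    have : ¬ (a.1 = 0 ∧ a.2 = 0) := fun h => ha (Prod.ext h.1 h.2)
    simp only [Prod.fst_neg, Prod.snd_neg]
    omega

/-- Two vectors in the same half-open quadrant have positive inner product. So after normalization
of both sides one lies in the first and the other in the second quadrant. -/
theorem IsLatticeRectangle.exists_oriented {R : Finset (ℤ × ℤ)} (h : IsLatticeRectangle R) :
    ∃ p a b : ℤ × ℤ, 0 < a.1 ∧ 0 ≤ a.2 ∧ b.1 ≤ 0 ∧ 0 < b.2 ∧ a.1 * b.1 + a.2 * b.2 = 0 ∧
      R = {p, p + a, p + b, p + a + b} := by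
  obtain ⟨p, a, b, ha, hb, hab, rfl⟩ := h
  obtain ⟨p₁, a', ha', hua, e1⟩ := rectangle_upper p b ha
  obtain ⟨p₂, b', hb', hub, e2⟩ := rectangle_upper p₁ a' hb
  have e3 := (e1.trans (rectangle_swap p₁ a' b)).trans e2
  have hab' : a'.1 * b'.1 + a'.2 * b'.2 = 0 := by
    rcases ha' with rfl | rfl <;> rcases hb' with rfl | rfl <;>
      first | exact hab | (simp only [Prod.fst_neg, Prod.snd_neg]; linarith)
  rcases hua with ⟨h1, h2⟩ | ⟨h1, h2⟩ <;> rcases hub with ⟨h3, h4⟩ | ⟨h3, h4⟩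
  · nlinarith [mul_pos h1 h3, mul_nonneg h2 h4]
  · exact ⟨p₂, a', b', h1, h2, h3, h4, hab', e3.trans (rectangle_swap p₂ b' a')⟩
  · exact ⟨p₂, b', a', h3, h4, h1, h2, by linarith, e3⟩
  · nlinarith [mul_pos h2 h4, mul_nonneg_of_nonpos_of_nonpos h1 h3]

theorem isLatticeRectangle_boxedRectangle {d : (ℕ × ℕ) × ℕ × ℕ} (q : ℕ × ℕ)
    (hu : 1 ≤ d.1.1) (hx : 1 ≤ d.2.1) (hy : 1 ≤ d.2.2) :
    IsLatticeRectangle (boxedRectangle d q) := by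
  obtain ⟨⟨u, v⟩, x, y⟩ := d
  obtain ⟨q₁, q₂⟩ := q
  simp only at hu hx hy
  refine ⟨(q₁ + y * v, q₂), (x * u, x * v), (-(y * v), y * u), ?_, ?_, by simp only; ring, ?_⟩
  · intro h
    have h1 : (x : ℤ) * u = 0 := congrArg Prod.fst h
    have h2 : (0 : ℤ) < x * u := by positivity
    omega
  · intro h
    have h1 : (y : ℤ) * u = 0 := congrArg Prod.snd h
    have h2 : (0 : ℤ) < y * u := by positivity
    omega
  · simp only [boxedRectangle, Prod.mk_add_mk]
    congr! 5 <;> ring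

/-- Write the first side as `x(u,v)` with `x` the gcd of its coordinates and the second as `(-E,
D)`. Orthogonality reads `uE = vD`, so coprimality gives `u ∣ D`, and with `D = yu` also `E = yv`.
-/
theorem exists_boxedRectangle {n : ℕ} {R : Finset (ℤ × ℤ)} (h : IsLatticeRectangle R)
    (hn : ∀ z ∈ R, 0 ≤ z.1 ∧ z.1 < (n : ℤ) ∧ 0 ≤ z.2 ∧ z.2 < (n : ℤ)) :
    ∃ d ∈ rectangleShapes n, ∃ q ∈ shapePositions n d, boxedRectangle d q = R := by
  obtain ⟨⟨p₁, p₂⟩, ⟨a₁, a₂⟩, ⟨b₁, b₂⟩, ha₁, ha₂, hb₁, hb₂, hab, rfl⟩ := h.exists_oriented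
  simp only at ha₁ ha₂ hb₁ hb₂ hab
  have m1 := hn (p₁, p₂) (by simp)
  have m2 := hn (p₁ + a₁, p₂ + a₂) (by simp)
  have m3 := hn (p₁ + b₁, p₂ + b₂) (by simp)
  have m4 := hn (p₁ + a₁ + b₁, p₂ + a₂ + b₂) (by simp)
  simp only at m1 m2 m3 m4
  obtain ⟨A, rfl⟩ := Int.eq_ofNat_of_zero_le ha₁.le
  obtain ⟨A', rfl⟩ := Int.eq_ofNat_of_zero_le ha₂
  obtain ⟨D, rfl⟩ := Int.eq_ofNat_of_zero_le hb₂.le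
  obtain ⟨E, hE⟩ := Int.eq_ofNat_of_zero_le (neg_nonneg.2 hb₁)
  obtain rfl : b₁ = -(E : ℤ) := by omega
  obtain ⟨q₁, hq₁⟩ := Int.eq_ofNat_of_zero_le m3.1
  obtain ⟨q₂, rfl⟩ := Int.eq_ofNat_of_zero_le m1.2.2.1
  obtain rfl : p₁ = q₁ + E := by omega
  have hA : 0 < A := by exact_mod_cast ha₁
  have hD : 0 < D := by exact_mod_cast hb₂
  have key : A * E = A' * D := by
    have : (A : ℤ) * E = A' * D := by linarith
    exact_mod_cast this
  obtain ⟨u, v, hx, hg, hu, hv⟩ : ∃ u v : ℕ, 0 < Nat.gcd A A' ∧ Nat.gcd u v = 1 ∧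
      A = Nat.gcd A A' * u ∧ A' = Nat.gcd A A' * v := by
    have hx : 0 < Nat.gcd A A' := Nat.gcd_pos_of_pos_left _ hA
    exact ⟨A / Nat.gcd A A', A' / Nat.gcd A A', hx, Nat.coprime_div_gcd_div_gcd hx,
      (Nat.mul_div_cancel' (Nat.gcd_dvd_left _ _)).symm,
      (Nat.mul_div_cancel' (Nat.gcd_dvd_right _ _)).symm⟩
  generalize Nat.gcd A A' = x at hx hu hv
  subst hu hv
  have hu0 : 0 < u := Nat.pos_of_mul_pos_left hA
  have key' : u * E = v * D := by
    refine Nat.eq_of_mul_eq_mul_left hx ?_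
    rw [← mul_assoc, ← mul_assoc]; exact key
  obtain ⟨y, rfl⟩ : u ∣ D := Nat.Coprime.dvd_of_dvd_mul_left hg ⟨E, key'.symm⟩
  obtain rfl : E = y * v := Nat.eq_of_mul_eq_mul_left hu0 (by rw [key']; ring)
  have hy : 0 < y := Nat.pos_of_mul_pos_left hD
  push_cast at m1 m2 m3 m4
  have k1 : q₁ + (x * u + y * v) < n := by zify; linarith [m2.2.1]
  have k2 : q₂ + (x * v + y * u) < n := by zify; linarith [m4.2.2.2]
  have l1 : u ≤ x * u := Nat.le_mul_of_pos_left u hx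
  have l2 : v ≤ x * v := Nat.le_mul_of_pos_left v hx
  have l3 : x ≤ x * u := Nat.le_mul_of_pos_right x hu0
  have l4 : y ≤ y * u := Nat.le_mul_of_pos_right y hu0
  refine ⟨((u, v), x, y), ?_, (q₁, q₂), ?_, ?_⟩
  · simp only [rectangleShapes, Finset.mem_product, Finset.mem_filter, Finset.mem_Icc,
      Finset.mem_range]
    refine ⟨⟨⟨⟨hu0, by omega⟩, by omega⟩, hg⟩, ⟨hx, by omega⟩, hy, by omega⟩
  · simp only [shapePositions, Finset.mem_product, Finset.mem_range]
    omega
  · simp only [boxedRectangle, Prod.mk_add_mk]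
    push_cast
    congr! 5 <;> ring

theorem rectangleCount_eq_sum (n : ℕ) :
    rectangleCount n = ∑ d ∈ rectangleShapes n, (shapePositions n d).card := by
  rw [← Finset.card_sigma, rectangleCount, ← Set.ncard_coe_finset,
    ← Set.InjOn.ncard_image (f := fun s : (Σ _ : (ℕ × ℕ) × ℕ × ℕ, ℕ × ℕ) =>
      boxedRectangle s.1 s.2)]
  · congr 1
    ext R
    simp only [Set.mem_ofPred_eq, Set.mem_image, Finset.mem_coe, Finset.mem_sigma]
    constructor
    · rintro ⟨h, hn⟩
      obtain ⟨d, hd, q, hq, e⟩ := exists_boxedRectangle h hn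
      exact ⟨⟨d, q⟩, ⟨hd, hq⟩, e⟩
    · rintro ⟨⟨⟨⟨u, v⟩, x, y⟩, q₁, q₂⟩, ⟨hd, hq⟩, rfl⟩
      simp only [rectangleShapes, Finset.mem_product, Finset.mem_filter, Finset.mem_Icc,
        Finset.mem_range] at hd
      simp only [shapePositions, Finset.mem_product, Finset.mem_range] at hq
      refine ⟨isLatticeRectangle_boxedRectangle _ hd.1.1.1.1 hd.2.1.1 hd.2.2.1, ?_⟩
      have k1 : (q₁ : ℤ) + x * u + y * v < n := by
        have : q₁ + x * u + y * v < n := by omega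
        exact_mod_cast this
      have k2 : (q₂ : ℤ) + x * v + y * u < n := by
        have : q₂ + x * v + y * u < n := by omega
        exact_mod_cast this
      have p1 : (0 : ℤ) ≤ x * u := by positivity
      have p2 : (0 : ℤ) ≤ y * v := by positivity
      have p3 : (0 : ℤ) ≤ x * v := by positivity
      have p4 : (0 : ℤ) ≤ y * u := by positivity
      simp only [boxedRectangle, Finset.mem_insert, Finset.mem_singleton]
      rintro z (rfl | rfl | rfl | rfl) <;> simp only <;> refine ⟨?_, ?_, ?_, ?_⟩ <;> omega
  · rintro ⟨d, q⟩ hs ⟨d', q'⟩ hs' h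
    simp only [Finset.coe_sigma, Set.mem_sigma_iff, Finset.mem_coe, rectangleShapes,
      Finset.mem_product, Finset.mem_filter, Finset.mem_Icc] at hs hs'
    obtain ⟨rfl, rfl⟩ := boxedRectangle_injective hs.1.1.1.1.1 hs.1.2.1.1 hs.1.2.2.1 hs.1.1.2
      hs'.1.1.1.1.1 hs'.1.2.1.1 hs'.1.2.2.1 hs'.1.1.2 h
    rfl

/-! ### Symmetries of the count and the sum over primitive directions. -/

/-- The number of rectangles with a given direction and given side lengths. -/
def shapeWeight (n u v x y : ℕ) : ℕ := (n - (x * u + y * v)) * (n - (x * v + y * u))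

/-- The number of rectangles with a given direction. -/
def directionWeight (n u v : ℕ) : ℕ :=
  ∑ x ∈ Finset.Icc 1 n, ∑ y ∈ Finset.Icc 1 n, shapeWeight n u v x y

theorem shapeWeight_swap (n u v x y : ℕ) : shapeWeight n u v x y = shapeWeight n u v y x := by
  rw [shapeWeight, shapeWeight, mul_comm]
  congr 2 <;> ring

theorem directionWeight_comm (n u v : ℕ) : directionWeight n u v = directionWeight n v u := by
  refine Finset.sum_congr rfl fun x _ => Finset.sum_congr rfl fun y _ => ?_
  rw [shapeWeight, shapeWeight, mul_comm]

/-- Folds a square along its diagonal; applied both to the side lengths `(x,y)` and to the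
directions `(u,v)`. -/
theorem sum_Icc_eq_sum_ite_lt {M : Type*} [AddCommMonoid M] (n : ℕ) (g : ℕ → ℕ → M) :
    ∑ x ∈ Finset.Icc 1 n, ∑ y ∈ Finset.Icc 1 n, g x y =
      (∑ x ∈ Finset.Icc 1 n, ∑ y ∈ Finset.Icc 1 n, if y < x then g x y + g y x else 0) +
        ∑ x ∈ Finset.Icc 1 n, g x x := by
  have h1 : ∀ x ∈ Finset.Icc 1 n, ∑ y ∈ Finset.Icc 1 n, g x y =
      ∑ y ∈ Finset.Icc 1 n, (if y < x then g x y else 0) +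
        ∑ y ∈ Finset.Icc 1 n, (if x < y then g x y else 0) + g x x := by
    intro x hx
    have : g x x = ∑ y ∈ Finset.Icc 1 n, if x = y then g x y else 0 := by
      rw [Finset.sum_ite_eq, if_pos hx]
    rw [this, ← Finset.sum_add_distrib, ← Finset.sum_add_distrib]
    refine Finset.sum_congr rfl fun y _ => ?_
    rcases lt_trichotomy x y with h | h | h
    · simp [h, h.not_gt, h.ne]
    · simp [h]
    · simp [h, h.not_gt, h.ne']
  rw [Finset.sum_congr rfl h1, Finset.sum_add_distrib, Finset.sum_add_distrib]
  congr 1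
  rw [Finset.sum_comm (f := fun x y => if x < y then g x y else 0), ← Finset.sum_add_distrib]
  refine Finset.sum_congr rfl fun x _ => ?_
  rw [← Finset.sum_add_distrib]
  refine Finset.sum_congr rfl fun y _ => ?_
  split_ifs <;> simp

/-- Interchanging `x` and `y` counts each pair `y < x` twice and the diagonal once; the doubling
accounts for the mirror direction `(v,u)`. This yields the multiplicities 4 and 2. -/
theorem two_mul_directionWeight {n u v : ℕ} (hvu : v ≤ u) :
    2 * (directionWeight n u v : ℤ) = directionContribution n u v := by
  have h1 : ∀ x y, y ≤ x → ((shapeWeight n u v x y : ℕ) : ℤ) =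
      if x * u + y * v ≤ n then ((n : ℤ) - x * u - y * v) * ((n : ℤ) - x * v - y * u) else 0 := by
    intro x y hyx
    -- By `(x-y)(u-v) ≥ 0` the second factor is not truncated when the first is not, so a single
    -- condition `xu+yv ≤ n` describes the support.
    have h2 : x * v + y * u ≤ x * u + y * v := by
      obtain ⟨a, rfl⟩ := Nat.exists_eq_add_of_le hyx
      obtain ⟨b, rfl⟩ := Nat.exists_eq_add_of_le hvu
      nlinarith [Nat.zero_le (a * b)]
    split_ifs with h
    · rw [shapeWeight, Nat.cast_mul, Nat.cast_sub h, Nat.cast_sub (h2.trans h)]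
      push_cast
      ring
    · rw [shapeWeight, Nat.sub_eq_zero_of_le (by omega), zero_mul, Nat.cast_zero]
  rw [directionContribution, Finset.sum_filter, Finset.sum_product, directionWeight]
  rw [sum_Icc_eq_sum_ite_lt n (shapeWeight n u v), sum_Icc_eq_sum_ite_lt n (fun x y : ℕ =>
    if y ≤ x ∧ x * u + y * v ≤ n then
      sideMult x y * ((n : ℤ) - x * u - y * v) * ((n : ℤ) - x * v - y * u) else 0)]
  push_cast
  rw [mul_add, Finset.mul_sum, Finset.mul_sum]
  congr 1
  · refine Finset.sum_congr rfl fun x _ => ?_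
    rw [Finset.mul_sum]
    refine Finset.sum_congr rfl fun y _ => ?_
    by_cases hyx : y < x
    · rw [shapeWeight_swap n u v y x, h1 x y hyx.le]
      simp only [hyx, hyx.le, hyx.not_ge, true_and, false_and, if_true, if_false, sideMult,
        hyx.ne', add_zero]
      split_ifs <;> ring
    · simp [hyx]
  · refine Finset.sum_congr rfl fun x _ => ?_
    rw [h1 x x le_rfl]
    simp only [le_refl, true_and, sideMult, if_true]
    split_ifs <;> ring

theorem sum_Icc_tsub {M : Type*} [AddCommMonoid M] {m n : ℕ} (hm : m ≤ n) (f : ℕ → M)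
    (hf : f 0 = 0) : ∑ y ∈ Finset.Icc 1 n, f (m - y) = ∑ j ∈ Finset.range m, f j := by
  rw [← Finset.sum_subset (Finset.Icc_subset_Icc_right hm), ← sum_range_succ_eq_sum_Icc,
    ← Finset.sum_range_reflect f]
  · refine Finset.sum_congr rfl fun i _ => ?_
    rw [Nat.sub_sub, add_comm 1 i]
  · intro y hy hy'
    simp only [Finset.mem_Icc] at hy hy'
    rw [Nat.sub_eq_zero_of_le (by omega), hf]

theorem four_mul_directionWeight_one_zero (n : ℕ) :
    4 * (directionWeight n 1 0 : ℤ) = (n : ℤ) ^ 2 * ((n : ℤ) - 1) ^ 2 := by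
  have h1 : directionWeight n 1 0 = (∑ j ∈ Finset.range n, j) * ∑ j ∈ Finset.range n, j := by
    rw [← sum_Icc_tsub le_rfl (fun j => j) rfl, Finset.sum_mul_sum]
    refine Finset.sum_congr rfl fun x _ => Finset.sum_congr rfl fun y _ => ?_
    simp [shapeWeight]
  rw [h1]
  push_cast
  linear_combination (2 * (∑ j ∈ Finset.range n, (j : ℤ)) + n * ((n : ℤ) - 1)) *
    two_mul_sum_range_id n

/-- Both sides of the bounding box are `x + y`, so the count is a double sum of the truncated
squares `(n-x-y)²`, that is, of sums of squares below `n - x`. -/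
theorem twelve_mul_directionWeight_one_one (n : ℕ) :
    12 * (directionWeight n 1 1 : ℤ) = (n : ℤ) * ((n : ℤ) - 1) ^ 2 * ((n : ℤ) - 2) := by
  have h1 : directionWeight n 1 1 =
      ∑ m ∈ Finset.range n, ∑ j ∈ Finset.range m, j ^ 2 := by
    rw [← sum_Icc_tsub le_rfl (fun m => ∑ j ∈ Finset.range m, j ^ 2) (by simp)]
    refine Finset.sum_congr rfl fun x _ => ?_
    rw [← sum_Icc_tsub (Nat.sub_le n x) (fun j => j ^ 2) rfl]
    refine Finset.sum_congr rfl fun y _ => ?_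
    rw [shapeWeight, pow_two, mul_one, mul_one, Nat.sub_sub]
  rw [h1]
  clear h1
  push_cast
  induction n with
  | zero => simp
  | succ n ih =>
    rw [Finset.sum_range_succ, mul_add, ih]
    push_cast
    linear_combination 2 * six_mul_sum_range_sq n

/-- The sum over the primitive directions `(u, v)` with `v < u`. -/
def primitiveSum (n : ℕ) (f : ℕ → ℕ → ℤ) (u : ℕ) : ℤ :=
  ∑ v ∈ Finset.Icc 1 n, if v < u ∧ Nat.gcd u v = 1 then f u v else 0

/-- Primitivity leaves only `(1,0)` with `v = 0` and only `(1,1)` on the diagonal; all remaining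
directions come in pairs `(u,v)`, `(v,u)` of equal weight. -/
theorem rectangleCount_eq_primitiveSum (n : ℕ) :
    (rectangleCount n : ℤ) = directionWeight n 1 0 + directionWeight n 1 1 +
      ∑ u ∈ Finset.Icc 1 n, primitiveSum n (directionContribution n) u := by
  have h1 : rectangleCount n = ∑ u ∈ Finset.Icc 1 n, ∑ v ∈ Finset.range (n + 1),
      if Nat.gcd u v = 1 then directionWeight n u v else 0 := by
    rw [rectangleCount_eq_sum, rectangleShapes, Finset.sum_product, Finset.sum_filter,
      Finset.sum_product]
    refine Finset.sum_congr rfl fun u _ => Finset.sum_congr rfl fun v _ => ?_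
    rw [Finset.sum_product]
    simp only [shapePositions, Finset.card_product, Finset.card_range]
    rfl
  have h2 : ∀ u ∈ Finset.Icc 1 n, (∑ v ∈ Finset.range (n + 1),
      if Nat.gcd u v = 1 then directionWeight n u v else 0) =
      (∑ v ∈ Finset.Icc 1 n, if Nat.gcd u v = 1 then directionWeight n u v else 0) +
        if u = 1 then directionWeight n 1 0 else 0 := by
    intro u _
    rw [Finset.sum_range_succ', sum_range_succ_eq_sum_Icc n
      (fun v => if Nat.gcd u v = 1 then directionWeight n u v else 0)]
    congr 1
    simp only [Nat.gcd_zero_right]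
    split_ifs with h
    · rw [h]
    · rfl
  have h0 : ∀ v, n = 0 → directionWeight n 1 v = 0 := by rintro v rfl; simp [directionWeight]
  have h3 : ∀ v, (∑ u ∈ Finset.Icc 1 n, if u = 1 then directionWeight n 1 v else 0) =
      directionWeight n 1 v := by
    intro v
    rw [Finset.sum_ite_eq']
    split_ifs with h
    · rfl
    · exact (h0 v (by simp at h; omega)).symm
  rw [h1, Finset.sum_congr rfl h2, Finset.sum_add_distrib, sum_Icc_eq_sum_ite_lt, h3]
  have h4 : (∑ u ∈ Finset.Icc 1 n, if Nat.gcd u u = 1 then directionWeight n u u else 0) =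
      directionWeight n 1 1 := by
    rw [← h3 1]
    refine Finset.sum_congr rfl fun u _ => ?_
    simp only [Nat.gcd_self]
    split_ifs with h
    · rw [h]
    · rfl
  rw [h4]
  have h5 : ((∑ u ∈ Finset.Icc 1 n, ∑ v ∈ Finset.Icc 1 n, if v < u then
      (if Nat.gcd u v = 1 then directionWeight n u v else 0) +
        (if Nat.gcd v u = 1 then directionWeight n v u else 0) else 0 : ℕ) : ℤ) =
      ∑ u ∈ Finset.Icc 1 n, primitiveSum n (directionContribution n) u := by
    push_cast
    refine Finset.sum_congr rfl fun u _ => Finset.sum_congr rfl fun v _ => ?_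
    by_cases hv : v < u
    · simp only [Nat.gcd_comm v u, directionWeight_comm n v u, hv, true_and, if_true]
      split_ifs
      · rw [← two_mul_directionWeight hv.le]; ring
      · simp
    · simp [hv]
  rw [Nat.cast_add, Nat.cast_add, h5]
  ring

theorem sum_smallDirections (n : ℕ) (f : ℕ → ℕ → ℤ) :
    ∑ d ∈ smallDirections n, f d.1 d.2 = ∑ u ∈ Finset.Icc 1 (threshold n), primitiveSum n f u := by
  rw [smallDirections, Finset.sum_filter, Finset.sum_product]
  refine Finset.sum_congr rfl fun u hu => ?_
  have hu' := (Finset.mem_Icc.1 hu).2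
  refine Finset.sum_subset (Finset.Icc_subset_Icc_right (threshold_le n)) fun v hv hv' => ?_
  simp only [Finset.mem_Icc] at hv hv'
  rw [if_neg (by simp only; omega)]

/-- Expand `((n-xu) - yv)((n-yu) - xv)` in powers of `v`; the coefficients of `1, v, v²` multiply
the three prefix sums. The bound `v ≤ vMax` combines `v < u` with `xu+yv ≤ n`. -/
theorem dualTerm_eq {n u x y : ℕ} (hu : u ≤ n) (hy : 1 ≤ y) (hx : x ≤ n / u) (hu0 : 1 ≤ u) :
    dualTerm n u x y = ∑ v ∈ Finset.Icc 1 n, if v < u ∧ Nat.gcd u v = 1 ∧ x * u + y * v ≤ n then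
      sideMult x y * ((n : ℤ) - x * u - y * v) * ((n : ℤ) - x * v - y * u) else 0 := by
  have hxu : x * u ≤ n := (Nat.le_div_iff_mul_le hu0).1 hx
  have h1 : vMax n u x y ≤ n := (min_le_left _ _).trans (by omega)
  have h2 : ∀ v, v ≤ vMax n u x y ↔ v < u ∧ x * u + y * v ≤ n := by
    intro v
    rw [vMax, le_min_iff, Nat.le_div_iff_mul_le hy, mul_comm v y]
    omega
  have h3 : ∀ g : ℕ → ℤ, (∑ v ∈ (Finset.Icc 1 (vMax n u x y)).filter
      (fun v => Nat.gcd u v = 1), g v) =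
      ∑ v ∈ Finset.Icc 1 n, if v < u ∧ Nat.gcd u v = 1 ∧ x * u + y * v ≤ n then g v else 0 := by
    intro g
    rw [← Finset.sum_filter]
    refine Finset.sum_congr ?_ fun _ _ => rfl
    ext v
    simp only [Finset.mem_filter, Finset.mem_Icc]
    have := h2 v
    constructor
    · rintro ⟨⟨k1, k2⟩, k3⟩
      exact ⟨⟨k1, k2.trans h1⟩, (this.1 k2).1, k3, (this.1 k2).2⟩
    · rintro ⟨⟨k1, -⟩, k2, k3, k4⟩
      exact ⟨⟨k1, this.2 ⟨k2, k4⟩⟩, k3⟩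
  rw [← h3, dualTerm, coprimePrefix, coprimePrefix, coprimePrefix, Finset.mul_sum,
    Finset.mul_sum, Finset.mul_sum, ← Finset.sum_sub_distrib, ← Finset.sum_add_distrib,
    Finset.mul_sum]
  exact Finset.sum_congr rfl fun v _ => by ring

/-- Exchanges the sum over `v` with that over `(x,y)`. Triples omitted because `vMax = 0` contribute
empty sums, and for `x > n/u` no `v` is admissible. -/
theorem sum_dualTriples (n : ℕ) :
    ∑ s ∈ dualTriples n, dualTerm n s.1 s.2.1 s.2.2 =
      ∑ u ∈ Finset.Ioc (threshold n) n, primitiveSum n (directionContribution n) u := by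
  rw [dualTriples, Finset.sum_filter, Finset.sum_product]
  refine Finset.sum_congr rfl fun u hu => ?_
  have hu' := Finset.mem_Ioc.1 hu
  have h1 : primitiveSum n (directionContribution n) u =
      ∑ p ∈ Finset.Icc 1 n ×ˢ Finset.Icc 1 n, if p.2 ≤ p.1 then
        ∑ v ∈ Finset.Icc 1 n, if v < u ∧ Nat.gcd u v = 1 ∧ p.1 * u + p.2 * v ≤ n then
          sideMult p.1 p.2 * ((n : ℤ) - p.1 * u - p.2 * v) * ((n : ℤ) - p.1 * v - p.2 * u)
          else 0 else 0 := by
    have h2 : ∀ v, (if v < u ∧ Nat.gcd u v = 1 then directionContribution n u v else 0) =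
        ∑ p ∈ Finset.Icc 1 n ×ˢ Finset.Icc 1 n, if p.2 ≤ p.1 then
          if v < u ∧ Nat.gcd u v = 1 ∧ p.1 * u + p.2 * v ≤ n then
          sideMult p.1 p.2 * ((n : ℤ) - p.1 * u - p.2 * v) * ((n : ℤ) - p.1 * v - p.2 * u)
          else 0 else 0 := by
      intro v
      split_ifs with h
      · rw [directionContribution, Finset.sum_filter]
        refine Finset.sum_congr rfl fun p _ => ?_
        simp only [h.1, h.2, true_and, ite_and]
      · refine (Finset.sum_eq_zero fun p _ => ?_).symm
        split_ifs with h3 h4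
        · exact absurd ⟨h4.1, h4.2.1⟩ h
        · rfl
        · rfl
    rw [primitiveSum, Finset.sum_congr rfl fun v _ => h2 v, Finset.sum_comm]
    refine Finset.sum_congr rfl fun p _ => ?_
    split_ifs
    · rfl
    · simp
  rw [h1]
  refine Finset.sum_congr rfl fun p hp => ?_
  obtain ⟨x, y⟩ := p
  obtain ⟨hx, hy⟩ := Finset.mem_product.1 hp
  simp only [Finset.mem_Icc] at hx hy ⊢
  by_cases hyx : y ≤ x
  · rw [if_pos hyx]
    by_cases hxu : x ≤ n / u
    · by_cases hv : 1 ≤ vMax n u x y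
      · rw [if_pos ⟨hyx, hxu, hv⟩, dualTerm_eq hu'.2 hy.1 hxu (by omega)]
      · rw [if_neg (by tauto), ← dualTerm_eq hu'.2 hy.1 hxu (by omega), dualTerm,
          show vMax n u x y = 0 by omega]
        simp [coprimePrefix]
    · rw [if_neg (by tauto)]
      refine (Finset.sum_eq_zero fun v _ => if_neg ?_).symm
      rw [Nat.le_div_iff_mul_le (by omega)] at hxu
      omega
  · rw [if_neg (by tauto), if_neg hyx]

theorem rectangleCount_eq (n : ℕ) : (rectangleCount n : ℚ) =
    boundaryCount n + ((∑ d ∈ smallDirections n, directionContribution n d.1 d.2 : ℤ) : ℚ)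
      + ((∑ s ∈ dualTriples n, dualTerm n s.1 s.2.1 s.2.2 : ℤ) : ℚ) := by
  have h1 : ∑ u ∈ Finset.Icc 1 n, primitiveSum n (directionContribution n) u =
      ∑ u ∈ Finset.Icc 1 (threshold n), primitiveSum n (directionContribution n) u +
      ∑ u ∈ Finset.Ioc (threshold n) n, primitiveSum n (directionContribution n) u := by
    rw [show Finset.Icc 1 n = Finset.Ioc 0 n from rfl,
      show Finset.Icc 1 (threshold n) = Finset.Ioc 0 (threshold n) from rfl,
      Finset.sum_Ioc_consecutive _ (Nat.zero_le _) (threshold_le n)]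
  have h2 := rectangleCount_eq_primitiveSum n
  rw [h1, ← sum_smallDirections n (directionContribution n), ← sum_dualTriples] at h2
  have h3 : (rectangleCount n : ℚ) = ((rectangleCount n : ℤ) : ℚ) := by norm_cast
  rw [h3, h2, Int.cast_add, Int.cast_add, Int.cast_add, boundaryCount]
  have h4 := congrArg (Int.cast : ℤ → ℚ) (four_mul_directionWeight_one_zero n)
  have h5 := congrArg (Int.cast : ℤ → ℚ) (twelve_mul_directionWeight_one_one n)
  push_cast at h4 h5
  rw [Int.cast_natCast, Int.cast_natCast]
  linear_combination h4 / 4 + h5 / 12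

/-! ## Asymptotics -/

theorem half_le_log {n : ℕ} (hn : 2 ≤ n) : (1 / 2 : ℝ) ≤ Real.log n := by
  have h1 : Real.log 2 ≤ Real.log n :=
    Real.log_le_log (by norm_num) (by exact_mod_cast hn)
  have := Real.log_two_gt_d9
  linarith

theorem natLog_le_two_mul_log (m : ℕ) : (Nat.log 2 m : ℝ) ≤ 2 * Real.log m := by
  rcases Nat.eq_zero_or_pos m with rfl | hm
  · simp
  have h1 : (Nat.log 2 m : ℝ) ≤ Real.logb 2 m := by exact_mod_cast Real.natLog_le_logb m 2
  have h2 : 0 ≤ Real.log m := Real.log_nonneg (by exact_mod_cast hm)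
  have h3 := Real.log_two_gt_d9
  rw [Real.logb, le_div_iff₀ (by linarith)] at h1
  nlinarith [Nat.cast_nonneg (α := ℝ) (Nat.log 2 m)]

theorem natLog_add_one_le {n : ℕ} (hn : 2 ≤ n) : ((Nat.log 2 n + 1 : ℕ) : ℝ) ≤ 4 * Real.log n := by
  have h1 := natLog_le_two_mul_log n
  have h2 := half_le_log hn
  push_cast
  linarith

theorem sum_div_le (n : ℕ) :
    ((∑ d ∈ Finset.range n, n / (d + 1) : ℕ) : ℝ) ≤ n * (1 + Real.log n) := by
  have h1 : ((harmonic n : ℚ) : ℝ) ≤ 1 + Real.log n := harmonic_le_one_add_log n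
  refine le_trans ?_ (mul_le_mul_of_nonneg_left h1 (Nat.cast_nonneg n))
  rw [harmonic]
  push_cast
  rw [Finset.mul_sum]
  refine Finset.sum_le_sum fun d _ => ?_
  have := Nat.cast_div_le (α := ℝ) (m := n) (n := d + 1)
  push_cast at this
  exact this

/-- With `u = d e` the sum is `d⁻²` times a tail over `e > ⌊B/d⌋`, which is at most `2/(⌊B/d⌋+1) ≤
2d/(B+1)`. The remaining factor `1/d` makes the later sum over `d` harmonic. -/
theorem sum_inv_sq_multiples_le (B n : ℕ) {d : ℕ} (hd : 1 ≤ d) :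
    ∑ u ∈ (Finset.Ioc B n).filter (fun u => d ∣ u), ((u : ℝ) ^ 2)⁻¹ ≤
      2 / (B + 1) * (d : ℝ)⁻¹ := by
  have hd0 : (0 : ℝ) < d := by exact_mod_cast hd
  have hsub : (Finset.Ioc B n).filter (fun u => d ∣ u) ⊆
      (Finset.Ioo (B / d) (n + 1)).image (fun e => d * e) := by
    intro u hu
    simp only [Finset.mem_filter, Finset.mem_Ioc] at hu
    obtain ⟨⟨h1, h2⟩, e, rfl⟩ := hu
    refine Finset.mem_image.2 ⟨e, Finset.mem_Ioo.2 ⟨?_, ?_⟩, rfl⟩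
    · rw [Nat.div_lt_iff_lt_mul hd, mul_comm]; exact h1
    · have := Nat.le_mul_of_pos_left e hd
      omega
  refine (Finset.sum_le_sum_of_subset_of_nonneg hsub fun _ _ _ => by positivity).trans ?_
  rw [Finset.sum_image fun a _ b _ h => Nat.eq_of_mul_eq_mul_left hd h]
  have h1 : ∑ e ∈ Finset.Ioo (B / d) (n + 1), ((e : ℝ) ^ 2)⁻¹ ≤ 2 / ((B / d : ℕ) + 1) :=
    sum_Ioo_inv_sq_le (B / d) (n + 1)
  have h2 : ((B : ℝ) + 1) ≤ d * ((B / d : ℕ) + 1) := by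
    have : B + 1 ≤ d * (B / d + 1) := Nat.lt_mul_div_succ B hd
    exact_mod_cast this
  have h3 : (2 : ℝ) / ((B / d : ℕ) + 1) ≤ 2 * d / (B + 1) := by
    rw [div_le_div_iff₀ (by positivity) (by positivity)]
    nlinarith
  have h4 : ∀ e : ℕ, (((d * e : ℕ) : ℝ) ^ 2)⁻¹ = ((d : ℝ) ^ 2)⁻¹ * ((e : ℝ) ^ 2)⁻¹ := by
    intro e; push_cast; rw [mul_pow, mul_inv]
  simp only [h4]
  rw [← Finset.mul_sum]
  refine (mul_le_mul_of_nonneg_left (h1.trans h3) (by positivity)).trans (le_of_eq ?_)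
  field_simp

/-- Write `τ(u) = ∑_{d ∣ u} 1`, exchange the sums, and sum the factors `1/d` to `1 + log n`. -/
theorem sum_divisors_card_div_sq_le (B n : ℕ) :
    ∑ u ∈ Finset.Ioc B n, (u.divisors.card : ℝ) * ((u : ℝ) ^ 2)⁻¹ ≤
      2 / (B + 1) * (1 + Real.log n) := by
  have h1 : ∀ u ∈ Finset.Ioc B n, (u.divisors.card : ℝ) * ((u : ℝ) ^ 2)⁻¹ =
      ∑ d ∈ Finset.Icc 1 n, if d ∣ u then ((u : ℝ) ^ 2)⁻¹ else 0 := by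
    intro u hu
    have hu' := Finset.mem_Ioc.1 hu
    rw [← Finset.sum_filter, Finset.sum_const, nsmul_eq_mul]
    congr 3
    ext d
    simp only [Nat.mem_divisors, Finset.mem_filter, Finset.mem_Icc]
    constructor
    · rintro ⟨h, -⟩
      have h2 := Nat.le_of_dvd (by omega) h
      have h3 := Nat.pos_of_dvd_of_pos h (by omega)
      exact ⟨⟨h3, by omega⟩, h⟩
    · rintro ⟨-, h⟩
      exact ⟨h, by omega⟩
  rw [Finset.sum_congr rfl h1, Finset.sum_comm]
  have h2 : ((harmonic n : ℚ) : ℝ) ≤ 1 + Real.log n := harmonic_le_one_add_log n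
  refine le_trans ?_ (mul_le_mul_of_nonneg_left h2 (by positivity))
  rw [harmonic_eq_sum_Icc]
  push_cast
  rw [Finset.mul_sum]
  refine Finset.sum_le_sum fun d hd => ?_
  rw [← Finset.sum_filter]
  exact sum_inv_sq_multiples_le B n (Finset.mem_Icc.1 hd).1

theorem dualWork_le (n B : ℕ) :
    (dualWork n B (n - B) : ℝ) ≤ (n : ℝ) ^ 2 * (2 / (B + 1) * (1 + Real.log n)) := by
  refine le_trans ?_ (mul_le_mul_of_nonneg_left (sum_divisors_card_div_sq_le B n) (by positivity))
  have h1 : dualWork n B (n - B) = ∑ u ∈ Finset.Ioc B n, (n / u) ^ 2 * u.divisors.card := by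
    rw [dualWork]
    refine Finset.sum_nbij' (fun i => B + 1 + i) (fun u => u - (B + 1)) ?_ ?_ ?_ ?_ ?_
    · intro i hi; simp only [Finset.mem_range, Finset.mem_Ioc] at hi ⊢; omega
    · intro i hi; simp only [Finset.mem_range, Finset.mem_Ioc] at hi ⊢; omega
    · intro i hi; simp
    · intro i hi; simp only [Finset.mem_Ioc] at hi; omega
    · intro i _; rfl
  rw [h1]
  push_cast
  rw [Finset.mul_sum]
  refine Finset.sum_le_sum fun u _ => ?_
  have h2 : ((n / u : ℕ) : ℝ) ^ 2 ≤ ((n : ℝ) / u) ^ 2 :=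
    pow_le_pow_left₀ (Nat.cast_nonneg _) Nat.cast_div_le 2
  refine (mul_le_mul_of_nonneg_right h2 (Nat.cast_nonneg _)).trans (le_of_eq ?_)
  rw [div_pow]
  ring

/-- A factor for the cost of the treatment of one pair. -/
def directionStepFactor : ℕ :=
  3 * (gcdStep.size + 4) + directionAdd.size + directionBody.size + kernelCost + 44

/-- The summand `31 = 7 + 24` collects the overheads of the inner and the outer loop in `mainCost`.
-/
theorem directionStepCost_le (n : ℕ) :
    directionStepCost n + 31 ≤ directionStepFactor * (Nat.log 2 n + 1) := by
  have h : directionStepFactor * (Nat.log 2 n + 1) = directionStepCost n + 31 +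
      Nat.log 2 n * (gcdStep.size + 4 + directionAdd.size + 42) := by
    rw [directionStepFactor, directionStepCost, directionCallCost]
    ring
  omega

/-- The constant in the bound for the cost of the main procedure. -/
def mainFactor : ℕ :=
  60 + 5 * sieveCost + 6 * (dualUCost + 5) + 4 * directionStepFactor + 400

/-- With `β = n^(2/3)` one has `B ≤ β ≤ B + 1`, hence `B² ≤ β² = n^(4/3)` and `n²/(B+1) ≤ n²/β =
n^(4/3)`. Lower-order terms are absorbed using `log n ≥ 1/2`. -/
theorem mainCost_le {n : ℕ} (hn : 2 ≤ n) :
    (mainCost n : ℝ) ≤ mainFactor * ((n : ℝ) ^ (4 / 3 : ℝ) * Real.log n) := by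
  have hn1 : (1 : ℝ) ≤ n := by exact_mod_cast (show 1 ≤ n by omega)
  have hn0 : (0 : ℝ) < n := by linarith
  have hl := half_le_log hn
  set ℓ := Real.log n with hℓ
  set A := (n : ℝ) ^ (4 / 3 : ℝ) with hA
  have hβ0 : (0 : ℝ) < (n : ℝ) ^ (2 / 3 : ℝ) := by positivity
  have hA1 : 1 ≤ A := Real.one_le_rpow hn1 (by norm_num)
  have hAn : (n : ℝ) ≤ A := by
    calc (n : ℝ) = (n : ℝ) ^ (1 : ℝ) := (Real.rpow_one _).symm
      _ ≤ A := Real.rpow_le_rpow_of_exponent_le hn1 (by norm_num)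
  have hβA : (n : ℝ) ^ (2 / 3 : ℝ) * (n : ℝ) ^ (2 / 3 : ℝ) = A := by
    rw [← Real.rpow_add hn0, hA]; norm_num
  have hβA' : (n : ℝ) ^ (2 / 3 : ℝ) * A = (n : ℝ) ^ 2 := by
    rw [hA, ← Real.rpow_add hn0, ← Real.rpow_natCast]; norm_num
  have hB1 : (threshold n : ℝ) ≤ (n : ℝ) ^ (2 / 3 : ℝ) := Nat.floor_le hβ0.le
  have hB2 : (n : ℝ) ^ (2 / 3 : ℝ) ≤ threshold n + 1 := (Nat.lt_floor_add_one _).le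
  have hB0 : (0 : ℝ) ≤ threshold n := Nat.cast_nonneg _
  have hBB : (threshold n : ℝ) * threshold n ≤ A := by
    rw [← hβA]; exact mul_le_mul hB1 hB1 hB0 hβ0.le
  have hBB' : (threshold n : ℝ) ≤ threshold n * threshold n := by
    have : threshold n ≤ threshold n * threshold n := Nat.le_mul_self _
    exact_mod_cast this
  have hAl : A ≤ 2 * (A * ℓ) := by nlinarith
  have hone : (1 : ℝ) ≤ 2 * (A * ℓ) := hA1.trans hAl
  have hlog : 1 + ℓ ≤ 3 * ℓ := by linarith
  have c1 : (threshold n : ℝ) * 30 ≤ 60 * (A * ℓ) := by linarith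
  have c2 : ((∑ d ∈ Finset.range n, n / (d + 1) : ℕ) : ℝ) ≤ 3 * (A * ℓ) := by
    refine (sum_div_le n).trans ?_
    calc (n : ℝ) * (1 + ℓ) ≤ A * (3 * ℓ) := mul_le_mul hAn hlog (by linarith) (by linarith)
      _ = _ := by ring
  have c3 : (dualWork n (threshold n) (n - threshold n) : ℝ) ≤ 6 * (A * ℓ) := by
    refine (dualWork_le n _).trans ?_
    have h1 : (n : ℝ) ^ 2 / (threshold n + 1) ≤ A := by
      rw [div_le_iff₀ (by positivity), ← hβA', mul_comm]
      exact mul_le_mul_of_nonneg_left hB2 (by linarith)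
    calc (n : ℝ) ^ 2 * (2 / (threshold n + 1) * (1 + ℓ))
        = 2 * ((n : ℝ) ^ 2 / (threshold n + 1)) * (1 + ℓ) := by ring
      _ ≤ 2 * A * (3 * ℓ) := mul_le_mul (by linarith) hlog (by linarith) (by linarith)
      _ = _ := by ring
  have c4 : (threshold n : ℝ) * (threshold n * ((directionStepCost n : ℝ) + 7) + 24) ≤
      4 * directionStepFactor * (A * ℓ) := by
    have h1 : ((directionStepCost n : ℝ) + 31) ≤ directionStepFactor * (4 * ℓ) := by
      have h2 : ((directionStepCost n : ℝ) + 31) ≤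
          directionStepFactor * ((Nat.log 2 n + 1 : ℕ) : ℝ) := by
        exact_mod_cast directionStepCost_le n
      exact h2.trans (mul_le_mul_of_nonneg_left (natLog_add_one_le hn) (Nat.cast_nonneg _))
    have h3 : (threshold n : ℝ) * (threshold n * ((directionStepCost n : ℝ) + 7) + 24) ≤
        (threshold n * threshold n) * ((directionStepCost n : ℝ) + 31) := by nlinarith
    refine h3.trans ?_
    calc (threshold n : ℝ) * threshold n * ((directionStepCost n : ℝ) + 31)
        ≤ A * (directionStepFactor * (4 * ℓ)) :=
          mul_le_mul hBB h1 (by positivity) (by linarith)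
      _ = _ := by ring
  unfold mainCost mainFactor
  generalize sieveCost = S
  generalize dualUCost = D at *
  generalize directionStepFactor = E at *
  generalize dualWork n (threshold n) (n - threshold n) = W at *
  generalize directionStepCost n = G at *
  have c2' := mul_le_mul_of_nonneg_left c2 (Nat.cast_nonneg (α := ℝ) S)
  have c2'' := mul_le_mul_of_nonneg_left hone (Nat.cast_nonneg (α := ℝ) S)
  have c3' := mul_le_mul_of_nonneg_left c3 (Nat.cast_nonneg (α := ℝ) (D + 5))
  push_cast at c2' c3' ⊢
  linarith

/-! ## The program -/

/-- The program. -/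
def rectangleProgram : Program :=
  [kernelBody, directionBody, prefixBody, mainBody, recKernelBody]

/-- The constant in all bounds. -/
def programFactor : ℕ :=
  2 * kernelCost + 4 * (directionBody.size + kernelCost + 2) + prefixCost + mainFactor + 1

/-- The exponents multiply: `j` for the size parameter `Y = s ^ j`, 10 for the moments and 200 for
the degree of expressions. The main procedure uses `j = 8`, which gives the exponent 16000. -/
theorem wordBound_of_pow_le {w s C k : ℕ} (hs : 2 ≤ s) (hC : 1 ≤ C) (h : C * s ^ k ≤ w) (j : ℕ)
    (hj0 : j ≠ 0) (hj : j * (10 * 200) ≤ k) : WordBound w ((s ^ j) ^ 10) where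
  two_le := hs.trans ((Nat.le_self_pow hj0 s).trans (Nat.le_self_pow (by norm_num) _))
  pow_le := by
    refine le_trans ?_ ((Nat.le_mul_of_pos_left _ hC).trans h)
    rw [← pow_mul, ← pow_mul]
    exact Nat.pow_le_pow_right (by omega) hj

theorem directionCallCost_le {n : ℕ} (hn : 2 ≤ n) :
    (directionCallCost n : ℝ) ≤ (4 * (directionBody.size + kernelCost + 2) : ℕ) * Real.log n := by
  have h := mul_le_mul_of_nonneg_left (natLog_add_one_le hn)
    (Nat.cast_nonneg (α := ℝ) (directionBody.size + kernelCost + 2))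
  rw [← Nat.cast_mul] at h
  refine h.trans (le_of_eq ?_)
  rw [Nat.cast_mul 4]
  push_cast
  ring

theorem sum_singleton_eq_map {ι α : Type*} (s : Finset ι) (f : ι → α) :
    ∑ i ∈ s, ({f i} : Multiset α) = s.val.map f := by
  rw [← Multiset.sum_map_singleton (s.val.map f), Multiset.map_map]
  rfl

/-- The division by 12 is exact because the decomposition itself shows that the boundary term is an
integer. -/
theorem rectangleCount_eq_int (n : ℕ) : (rectangleCount n : ℤ) =
    ∑ s ∈ dualTriples n, tripleTerm n s + ∑ d ∈ smallDirections n, directionTerm n d +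
      boundaryNumerator n / 12 := by
  have h := rectangleCount_eq n
  have h1 : boundaryNumerator n = 12 * ((rectangleCount n : ℤ) -
      ∑ s ∈ dualTriples n, tripleTerm n s - ∑ d ∈ smallDirections n, directionTerm n d) := by
    have h2 : ((boundaryNumerator n : ℤ) : ℚ) = 12 * boundaryCount n := by
      rw [boundaryNumerator, boundaryCount]
      push_cast
      ring
    have h3 : ((boundaryNumerator n : ℤ) : ℚ) = ((12 * ((rectangleCount n : ℤ) -
      ∑ s ∈ dualTriples n, tripleTerm n s - ∑ d ∈ smallDirections n, directionTerm n d) : ℤ) :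
        ℚ) := by
      rw [h2, Int.cast_mul, Int.cast_sub, Int.cast_sub, Int.cast_natCast, h]
      simp only [tripleTerm, directionTerm]
      push_cast
      ring
    exact_mod_cast h3
  rw [h1, Int.mul_ediv_cancel_left _ (by norm_num)]
  ring

theorem kernel_spec {N m a b w : ℕ} (hm : 1 ≤ m)
    (hw : programFactor * (N + m + a + b + 2) ^ 16000 ≤ w) {σ : Memory}
    (hin : KernelInput σ N m a b) :
    ∃ (t : ℕ) (L : List CallRecord) (τ : Memory),
      RunsProc rectangleProgram w kernelProc σ t L τ ∧ KernelOutput τ N m a b ∧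
      (t : ℝ) ≤ programFactor * (1 + Real.log m) := by
  have hC : 1 ≤ programFactor := Nat.le_add_left _ _
  -- The kernel requires `2 * m ≤ Y`, so `Y` is taken as the square of the input size.
  have hY : 2 * (N + m + a + b + 2) ≤ (N + m + a + b + 2) ^ 2 := by
    rw [pow_two]; exact Nat.mul_le_mul_right _ (by omega)
  obtain ⟨t, L, τ, hex, ht, hout, -⟩ := kernelBody_runs (Γ := rectangleProgram) rfl (by omega)
    (wordBound_of_pow_le (by omega) hC hw 2 (by norm_num) (by norm_num)) hm (by omega) (by omega)
    (by omega) (by omega) hin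
  refine ⟨t, L, τ, ⟨_, rfl, hex⟩, hout, ?_⟩
  have h1 : (t : ℝ) ≤ kernelCost * ((Nat.log 2 m : ℝ) + 1) := by exact_mod_cast ht
  have h2 := natLog_le_two_mul_log m
  have h3 : (0 : ℝ) ≤ Real.log m := Real.log_nonneg (by exact_mod_cast hm)
  have h4 : ((2 * kernelCost : ℕ) : ℝ) ≤ programFactor := by
    refine Nat.cast_le.2 ?_
    unfold programFactor
    omega
  calc (t : ℝ) ≤ kernelCost * ((Nat.log 2 m : ℝ) + 1) := h1
    _ ≤ kernelCost * (2 * (1 + Real.log m)) :=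
      mul_le_mul_of_nonneg_left (by linarith) (Nat.cast_nonneg _)
    _ = ((2 * kernelCost : ℕ) : ℝ) * (1 + Real.log m) := by push_cast; ring
    _ ≤ programFactor * (1 + Real.log m) := mul_le_mul_of_nonneg_right h4 (by linarith)

theorem four_mul_le_programFactor :
    4 * (directionBody.size + kernelCost + 2) ≤ programFactor := by
  unfold programFactor
  omega

theorem direction_spec {n u v w : ℕ} (hn : 2 ≤ n) (hv : 1 ≤ v) (hvu : v ≤ u)
    (hw : programFactor * (n + u + 2) ^ 16000 ≤ w) {σ : Memory} (h0 : σ 0 = n) (h1 : σ 1 = u)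
    (h2 : σ 2 = v) :
    ∃ (t : ℕ) (L : List CallRecord) (τ : Memory),
      RunsProc rectangleProgram w directionProc σ t L τ ∧ τ 0 = directionContribution n u v ∧
      (t : ℝ) ≤ programFactor * Real.log n ∧ L.length ≤ programFactor ∧
      (∀ r ∈ L, r.IsKernelQuery) ∧ t ≤ programFactor + (L.map CallRecord.cost).sum := by
  have hC : 1 ≤ programFactor := Nat.le_add_left _ _
  have hY : 2 * (n + u + 2) ≤ (n + u + 2) ^ 2 := by
    rw [pow_two]; exact Nat.mul_le_mul_right _ (by omega)
  obtain ⟨t, L, τ, hex, ht, hlen, hq, hcost, hout, -⟩ :=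
    directionBody_runs (Γ := rectangleProgram) rfl rfl (by omega)
      (wordBound_of_pow_le (by omega) hC hw 2 (by norm_num) (by norm_num)) hv hvu
      (n := n) (by omega) (by omega) h0 h1 h2
  have h4 := four_mul_le_programFactor
  refine ⟨t, L, τ, ⟨_, rfl, hex⟩, hout, ?_, hlen.trans hC, hq, ?_⟩
  · have h5 : t ≤ directionCallCost n := by
      have e1 : directionCallCost n = kernelCost * (Nat.log 2 n + 1) +
        (directionBody.size + 2) * (Nat.log 2 n + 1) := by rw [directionCallCost]; ring
      have e2 := Nat.mul_le_mul_left (directionBody.size + 2) (show 1 ≤ Nat.log 2 n + 1 by omega)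
      omega
    refine ((Nat.cast_le.2 h5).trans (directionCallCost_le hn)).trans ?_
    exact mul_le_mul_of_nonneg_right (Nat.cast_le.2 h4) (by linarith [half_le_log hn])
  · refine ht.trans (Nat.add_le_add_right ?_ _)
    omega

theorem main_spec {n w : ℕ} (hw : programFactor * (n + 2) ^ 16000 ≤ w) :
    ∃ (t : ℕ) (L : List CallRecord) (τ : Memory),
      RunsProc rectangleProgram w mainProc (initialMemory n) t L τ ∧
      τ 0 = rectangleCount n ∧
      (2 ≤ n → (t : ℝ) ≤ programFactor * ((n : ℝ) ^ (4 / 3 : ℝ) * Real.log n)) ∧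
      directionCalls L =
        (smallDirections n).val.map (fun d => ((n : ℤ), (d.1 : ℤ), (d.2 : ℤ))) ∧
      (∀ r ∈ L, r.proc = directionProc → ∀ d ∈ smallDirections n,
        r.entry 1 = d.1 → r.entry 2 = d.2 →
          r.exit 0 = directionContribution n d.1 d.2 ∧
          (r.cost : ℝ) ≤ programFactor * Real.log n) ∧
      prefixCalls L =
        (dualTriples n).val.map (fun s => ((s.1 : ℤ), (vMax n s.1 s.2.1 s.2.2 : ℤ))) ∧
      (∀ r ∈ L, r.proc = prefixProc → ∀ u X : ℕ, r.entry 0 = u → r.entry 1 = X →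
        r.exit 0 = coprimePrefix 0 u X ∧ r.exit 1 = coprimePrefix 1 u X ∧
        r.exit 2 = coprimePrefix 2 u X ∧ r.cost ≤ programFactor * u.divisors.card) := by
  have hC : 1 ≤ programFactor := Nat.le_add_left _ _
  obtain ⟨t, L, τ, hex, ht, hL, hout⟩ := mainBody_runs (Γ := rectangleProgram) (n := n) rfl rfl rfl
    rfl (wordBound_of_pow_le (by omega) hC hw 8 (by norm_num) (by norm_num))
  refine ⟨t, L, τ, ⟨_, rfl, hex⟩, ?_, fun hn => ?_, ?_, ?_, ?_, ?_⟩
  · rw [hout, rectangleCount_eq_int]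
  · have h1 : mainFactor ≤ programFactor := by
      unfold programFactor
      omega
    refine ((Nat.cast_le.2 ht).trans (mainCost_le hn)).trans ?_
    refine mul_le_mul_of_nonneg_right (Nat.cast_le.2 h1) ?_
    have := half_le_log hn
    positivity
  · rw [hL.direction_eq]
    exact sum_singleton_eq_map _ _
  · intro r hr hp d hd e1 e2
    obtain ⟨u, v, f1, f2, f3, f4⟩ := hL.direction_correct r hr hp
    obtain rfl : u = d.1 := by exact_mod_cast f1.symm.trans e1
    obtain rfl : v = d.2 := by exact_mod_cast f2.symm.trans e2
    -- A direction `1 ≤ v < u ≤ threshold n ≤ n` exists only for `n ≥ 2`, so the logarithmic bound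
    -- applies.
    have hn : 2 ≤ n := by
      have h1 := Finset.mem_filter.1 hd
      have h2 := Finset.mem_product.1 h1.1
      simp only [Finset.mem_Icc] at h2
      have := threshold_le n
      omega
    refine ⟨f3, ((Nat.cast_le.2 f4).trans (directionCallCost_le hn)).trans ?_⟩
    exact mul_le_mul_of_nonneg_right (Nat.cast_le.2 four_mul_le_programFactor)
      (by linarith [half_le_log hn])
  · rw [hL.prefix_eq]
    exact sum_singleton_eq_map _ _
  · intro r hr hp u X e1 e2
    obtain ⟨u', X', f1, f2, f3, f4, f5, f6⟩ := hL.prefix_correct r hr hp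
    obtain rfl : u' = u := by exact_mod_cast f1.symm.trans e1
    obtain rfl : X' = X := by exact_mod_cast f2.symm.trans e2
    refine ⟨f3, f4, f5, f6.trans (Nat.mul_le_mul_right _ ?_)⟩
    unfold programFactor
    omega

theorem mainTheorem5 :
    -- the decomposition of the count at the threshold `u = n^(2/3)`
    (∀ n : ℕ, (rectangleCount n : ℚ) =
      boundaryCount n
        + ((∑ d ∈ smallDirections n, directionContribution n d.1 d.2 : ℤ) : ℚ)
        + ((∑ s ∈ dualTriples n, dualTerm n s.1 s.2.1 s.2.2 : ℤ) : ℚ)) ∧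
    -- one program and constants `C`, `k`; words range over integers of polynomial size
    ∃ (Γ : Program) (C k : ℕ),
      -- the six-moment kernel, in `O(1 + log m)` steps
      (∀ N m a b : ℕ, 1 ≤ m → ∀ w : ℕ, C * (N + m + a + b + 2) ^ k ≤ w →
        ∀ σ : Memory, KernelInput σ N m a b →
        ∃ (t : ℕ) (L : List CallRecord) (τ : Memory),
          RunsProc Γ w kernelProc σ t L τ ∧ KernelOutput τ N m a b ∧
          (t : ℝ) ≤ C * (1 + Real.log m)) ∧
      -- one primitive direction in `O(log n)` steps, by `O(1)` arithmetic operations and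
      -- `O(1)` queries to the six-moment kernel
      (∀ n u v : ℕ, 2 ≤ n → 1 ≤ v → v ≤ u → Nat.gcd u v = 1 →
        ∀ w : ℕ, C * (n + u + 2) ^ k ≤ w →
        ∀ σ : Memory, σ 0 = n → σ 1 = u → σ 2 = v →
        ∃ (t : ℕ) (L : List CallRecord) (τ : Memory),
          RunsProc Γ w directionProc σ t L τ ∧ τ 0 = directionContribution n u v ∧
          (t : ℝ) ≤ C * Real.log n ∧
          L.length ≤ C ∧ (∀ r ∈ L, r.IsKernelQuery) ∧
          t ≤ C + (L.map CallRecord.cost).sum) ∧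
      -- the whole count in `O(n^(4/3) log n)` steps
      (∀ n w : ℕ, C * (n + 2) ^ k ≤ w →
        ∃ (t : ℕ) (L : List CallRecord) (τ : Memory),
          RunsProc Γ w mainProc (initialMemory n) t L τ ∧
          τ 0 = rectangleCount n ∧
          (2 ≤ n → (t : ℝ) ≤ C * ((n : ℝ) ^ (4 / 3 : ℝ) * Real.log n)) ∧
          -- each small direction is handled by exactly one call of the direction procedure
          directionCalls L =
            (smallDirections n).val.map (fun d => ((n : ℤ), (d.1 : ℤ), (d.2 : ℤ))) ∧
          (∀ r ∈ L, r.proc = directionProc → ∀ d ∈ smallDirections n,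
            r.entry 1 = d.1 → r.entry 2 = d.2 →
              r.exit 0 = directionContribution n d.1 d.2 ∧
              (r.cost : ℝ) ≤ C * Real.log n) ∧
          -- the large directions are handled by one prefix-sum query for each `(u,x,y)`
          prefixCalls L =
            (dualTriples n).val.map
              (fun s => ((s.1 : ℤ), (vMax n s.1 s.2.1 s.2.2 : ℤ))) ∧
          (∀ r ∈ L, r.proc = prefixProc → ∀ u X : ℕ, r.entry 0 = u → r.entry 1 = X →
            r.exit 0 = coprimePrefix 0 u X ∧ r.exit 1 = coprimePrefix 1 u X ∧
            r.exit 2 = coprimePrefix 2 u X ∧ r.cost ≤ C * u.divisors.card)) := by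
  refine ⟨rectangleCount_eq, rectangleProgram, programFactor, 16000, ?_, ?_, ?_⟩
  · intro N m a b hm w hw σ hin
    exact kernel_spec hm hw hin
  · intro n u v hn hv hvu _ w hw σ h0 h1 h2
    exact direction_spec hn hv hvu hw h0 h1 h2
  · intro n w hw
    exact main_spec hw
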